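/- **Setting.** Let $A$ be a finite-dimensional Hopf algebra over a field $k$, with antipode $S$ (which is then bijective). Tensor products are over $k$; write $\Delta(a)=\sum a^{(1)}\otimes a^{(2)}$ and, for iterated comultiplications, $\sum a^{(1)}\otimes a^{(2)}\otimes a^{(3)}$. A *Hopf bimodule* over $A$ is a vector space $M$ of arbitrary dimension that is an $A$-bimodule and an $A$-bicomodule, with coactions $m\mapsto\sum m_{(-1)}\otimes m_{(0)}\in A\otimes M$ and $m\mapsto\sum m_{(0)}\otimes m_{(1)}\in M\otimes A$ that are bimodule morphisms for the diagonal actions on $A\otimes M$ and $M\otimes A$. Morphisms are the $k$-linear maps that respect both actions and both coactions; their space is denoted $\mathrm{Hom}_{A4}(M,N)$. $A$ itself is a Hopf bimodule through its multiplication and comultiplication. **The algebra $X$.** $A^*$ carries the convolution product. Let $X=(A^{*op}\otimes A^*)\,\underline\otimes\,(A\otimes A^{op})$ be the associative algebra in which $A^{*op}\otimes A^*$ and $A\otimes A^{op}$ are subalgebras, $[(l\otimes l')\underline\otimes(1\otimes1)]\,[(1\otimes1)\underline\otimes(a\otimes b)]=(l\otimes l')\underline\otimes(a\otimes b)$, and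 $$[(1\otimes1)\underline\otimes(a\otimes b)]\,[(l\otimes l')\underline\otimes(1\otimes1)]=\sum\big[\,l\big(S(a^{(1)})\,\cdot\,S^{-1}(b^{(1)})\big)\otimes l'\big(S^{-1}(a^{(3)})\,\cdot\,S(b^{(3)})\big)\big]\underline\otimes(a^{(2)}\otimes b^{(2)}).$$ Each Hopf bimodule $M$ is a left $X$-module through $$[(l\otimes l')\underline\otimes(a\otimes b)].m=\sum l(a^{(1)}m_{(-1)}b^{(1)})\,l'(a^{(3)}m_{(1)}b^{(3)})\,a^{(2)}m_{(0)}b^{(2)},$$ and $\mathrm{Ext}_X^*(M,N)$ denotes Ext of left $X$-modules. **Bar and cobar resolutions.** For a Hopf bimodule $M$ and $q\ge-1$ let $B_q(M)=A^{\otimes q+1}\otimes M\otimes A^{\otimes q+1}$, with $A$ acting on the left and on the right by multiplication on the outermost factors, with codiagonal coactions, and with differentials $\partial_q:B_q(M)\to B_{q-1}(M)$ for $q\ge0$, $$\partial_q(a_0\otimes\cdots\otimes a_q\otimes m\otimes b_q\otimes\cdots\otimes b_0)=\sum_{i=0}^{q-1}(-1)^i\,a_0\otimes\cdots\otimes a_ia_{i+1}\otimes\cdots\otimes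 m\otimes\cdots\otimes b_{i+1}b_i\otimes\cdots\otimes b_0+(-1)^q\,a_0\otimes\cdots\otimes a_{q-1}\otimes a_qmb_q\otimes b_{q-1}\otimes\cdots\otimes b_0 .$$ Dually, for a Hopf bimodule $N$ and $p\ge-1$ let $C^p(N)=A^{\otimes p+1}\otimes N\otimes A^{\otimes p+1}$, with $A$ coacting by comultiplication on the outermost factors, with diagonal actions, and with differentials $\partial^p:C^p(N)\to C^{p+1}(N)$, $$\partial^p(a_0\otimes\cdots\otimes a_p\otimes n\otimes b_p\otimes\cdots\otimes b_0)=\sum_{i=0}^{p}(-1)^i\,a_0\otimes\cdots\otimes\Delta a_i\otimes\cdots\otimes n\otimes\cdots\otimes\Delta b_i\otimes\cdots\otimes b_0+(-1)^{p+1}\sum a_0\otimes\cdots\otimes a_p\otimes n_{(-1)}\otimes n_{(0)}\otimes n_{(1)}\otimes b_p\otimes\cdots\otimes b_0 .$$ **Cohomologies.** For $p,q\ge0$ put $C^{pq}(M,N)=\mathrm{Hom}_{A4}(B_q(M),C^p(N))$, with $\delta_h(\alpha)=\alpha\circ\partial_{q+1}\in C^{p,q+1}(M,N)$ and $\delta_c(\alpha)=(-1)^q\,\partial^p\circ\alpha\in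 C^{p+1,q}(M,N)$. The *Gerstenhaber–Schack cohomology* $H_{GS}^*(M,N)$ is the cohomology of the total complex of this double complex. The *bialgebra cohomology* $H_b^*(A,A)$ is obtained in the same way from the ordinary bar resolution $Bar_q(A)=A^{\otimes q+2}$ of $A$ (standard actions, codiagonal coactions, $a_0\otimes\cdots\otimes a_{q+1}\mapsto\sum_{i=0}^{q}(-1)^ia_0\otimes\cdots\otimes a_ia_{i+1}\otimes\cdots\otimes a_{q+1}$) and the ordinary cobar resolution $Cob^p(A)=A^{\otimes p+2}$ (standard coactions, diagonal actions, $a_0\otimes\cdots\otimes a_{p+1}\mapsto\sum_{i=0}^{p+1}(-1)^ia_0\otimes\cdots\otimes\Delta a_i\otimes\cdots\otimes a_{p+1}$): it is the cohomology of the total complex of the double complex $\mathrm{Hom}_{A4}(Bar_q(A),Cob^p(A))$, $p,q\ge0$, with the same signs. **Theorem.** For all Hopf bimodules $M$, $N$ over $A$ and all $n\ge0$ there is an isomorphism of $k$-vector spaces $$H_{GS}^n(M,N)\;\cong\;\mathrm{Ext}_X^n(M,N).$$ In particular, for all $n\ge0$, $\;H_b^n(A,A)\cong\mathrm{Ext}_X^n(A,A)$.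 -/

import Mathlib

set_option linter.unusedSectionVars false
set_option linter.unusedSimpArgs false

open TensorProduct Coalgebra CategoryTheory

universe u

noncomputable section

namespace HopfAlgebra

section Antipode
variable {k A : Type*} [Field k] [Ring A] [HopfAlgebra k A]

open WithConv LinearMap

lemma algHom_comp_antipode_convMul {E : Type*} [Ring E] [Algebra k E] (φ : A →ₐ[k] E) :
    toConv (φ.toLinearMap ∘ₗ antipode k) * toConv φ.toLinearMap = 1 := by
  have h := congrArg (fun f : WithConv (A →ₗ[k] A) => toConv (φ.toLinearMap ∘ₗ f.ofConv))
    (antipode_mul_id (R := k) (C := A))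
  simp only [algHom_comp_convMul_distrib] at h
  simpa [LinearMap.convOne_def] using! h.trans (by ext; simp)

lemma algHom_convMul_comp_antipode {E : Type*} [Ring E] [Algebra k E] (φ : A →ₐ[k] E) :
    toConv φ.toLinearMap * toConv (φ.toLinearMap ∘ₗ antipode k) = 1 := by
  have h := congrArg (fun f : WithConv (A →ₗ[k] A) => toConv (φ.toLinearMap ∘ₗ f.ofConv))
    (id_mul_antipode (R := k) (C := A))
  simp only [algHom_comp_convMul_distrib] at h
  simpa [LinearMap.convOne_def] using! h.trans (by ext; simp)

/-- The antipode is an anti-morphism of coalgebras. -/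
lemma comul_antipode (a : A) :
    comul (antipode k a) =
      TensorProduct.map (antipode k) (antipode k) (TensorProduct.comm k A A (comul (R := k) a)) := by
  let i₁ : A →ₐ[k] A ⊗[k] A := Algebra.TensorProduct.includeLeft
  let i₂ : A →ₐ[k] A ⊗[k] A := Algebra.TensorProduct.includeRight
  have hΔ : toConv (comul (R := k) (A := A)) = toConv i₁.toLinearMap * toConv i₂.toLinearMap := by
    ext a
    rw [(ℛ k a).convMul_apply]
    simp [i₁, i₂, Coalgebra.Repr.eq]
  let G : WithConv (A →ₗ[k] A ⊗[k] A) :=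
    toConv (i₂.toLinearMap ∘ₗ antipode k) * toConv (i₁.toLinearMap ∘ₗ antipode k)
  have hG : G * toConv (comul (R := k) (A := A)) = 1 := by
    rw [hΔ]
    calc _ = toConv (i₂.toLinearMap ∘ₗ antipode k) *
          ((toConv (i₁.toLinearMap ∘ₗ antipode k) * toConv i₁.toLinearMap) *
            toConv i₂.toLinearMap) := by simp only [G, mul_assoc]
      _ = 1 := by rw [algHom_comp_antipode_convMul, one_mul, algHom_comp_antipode_convMul]
  have h := left_inv_eq_right_inv hG comul_right_inv
  have h2 := congrArg (fun f : WithConv (A →ₗ[k] A ⊗[k] A) => f.ofConv a) h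
  simp only [LinearMap.comp_apply] at h2
  rw [← h2]
  change G a = _
  rw [(ℛ k a).convMul_apply]
  conv_rhs => rw [← (ℛ k a).eq]
  simp [i₁, i₂]

/-- The square of the antipode, as a morphism of coalgebras. -/
def antipodeSq : A →ₗc[k] A where
  toLinearMap := antipode k ∘ₗ antipode k
  counit_comp := by ext; simp
  map_comp_comul := by
    ext a
    simp only [LinearMap.comp_apply, comul_antipode]
    rw [← (ℛ k a).eq]
    simp

lemma coalgHom_antipode_convMul (u : A →ₗc[k] A) :
    toConv (antipode k ∘ₗ u.toLinearMap) * toConv u.toLinearMap = 1 := by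
  have h := convMul_comp_coalgHom_distrib (toConv (antipode k (A := A))) (toConv LinearMap.id) u
  rw [antipode_mul_id] at h
  refine WithConv.ext (h.symm.trans ?_)
  ext a
  simp [LinearMap.convOne_def]

lemma coalgHom_antipodeOp_convMul (u : A →ₗc[k] A) :
    toConv ((antipodeAlgHomOp k A).toLinearMap ∘ₗ u.toLinearMap) *
      toConv ((antipodeAlgHomOp k A).toLinearMap ∘ₗ antipode k ∘ₗ u.toLinearMap) = 1 := by
  have h := convMul_comp_coalgHom_distrib (toConv (antipodeAlgHomOp k A).toLinearMap)
    (toConv ((antipodeAlgHomOp k A).toLinearMap ∘ₗ antipode k)) u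
  rw [algHom_convMul_comp_antipode] at h
  refine WithConv.ext (h.symm.trans ?_)
  ext a
  simp [LinearMap.convOne_def]

lemma coalgHom_convMul_antipode (u : A →ₗc[k] A) :
    toConv u.toLinearMap * toConv (antipode k ∘ₗ u.toLinearMap) = 1 := by
  have h := convMul_comp_coalgHom_distrib (toConv LinearMap.id) (toConv (antipode k (A := A))) u
  rw [id_mul_antipode] at h
  refine WithConv.ext (h.symm.trans ?_)
  ext a
  simp [LinearMap.convOne_def]

lemma coalgHom_antipodeOp_convMul' (u : A →ₗc[k] A) :
    toConv ((antipodeAlgHomOp k A).toLinearMap ∘ₗ antipode k ∘ₗ u.toLinearMap) *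
      toConv ((antipodeAlgHomOp k A).toLinearMap ∘ₗ u.toLinearMap) = 1 := by
  have h := convMul_comp_coalgHom_distrib
    (toConv ((antipodeAlgHomOp k A).toLinearMap ∘ₗ antipode k))
    (toConv (antipodeAlgHomOp k A).toLinearMap) u
  rw [algHom_comp_antipode_convMul] at h
  refine WithConv.ext (h.symm.trans ?_)
  ext a
  simp [LinearMap.convOne_def]

lemma antipodeSq_comp_cancel {u v : A →ₗc[k] A}
    (h : ∀ a, antipode k (antipode k (u a)) = antipode k (antipode k (v a))) : u = v := by
  have h1 : antipode k ∘ₗ u.toLinearMap = antipode k ∘ₗ v.toLinearMap := by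
    have e : (antipodeAlgHomOp k A).toLinearMap ∘ₗ antipode k ∘ₗ u.toLinearMap =
        (antipodeAlgHomOp k A).toLinearMap ∘ₗ antipode k ∘ₗ v.toLinearMap := by
      ext a
      simpa using h a
    have h2 := coalgHom_antipodeOp_convMul' v
    rw [← e] at h2
    have h3 := left_inv_eq_right_inv (coalgHom_antipodeOp_convMul u) h2
    ext a
    have h4 := congrArg (fun f : WithConv (A →ₗ[k] Aᵐᵒᵖ) => f.ofConv a) h3
    simpa using h4
  have h2 := coalgHom_antipode_convMul v
  rw [← h1] at h2
  have h3 := left_inv_eq_right_inv (coalgHom_convMul_antipode u) h2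
  ext a
  exact congrArg (fun f : WithConv (A →ₗ[k] A) => f.ofConv a) h3

lemma antipodeSq_pow_comp_cancel (m : ℕ) {u v : A →ₗc[k] A}
    (h : ∀ a, ((antipode k ∘ₗ antipode k) ^ m : Module.End k A) (u a) =
      ((antipode k ∘ₗ antipode k) ^ m : Module.End k A) (v a)) : u = v := by
  induction m generalizing u v with
  | zero => ext a; simpa using h a
  | succ m ih =>
    have : antipodeSq.comp u = antipodeSq.comp v := ih fun a => by
      simpa [pow_succ, antipodeSq] using! h a
    exact antipodeSq_comp_cancel fun a => congrArg (fun f : A →ₗc[k] A => f a) this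

lemma antipode_bijective [FiniteDimensional k A] :
    Function.Bijective (antipode k : A →ₗ[k] A) := by
  let T : Module.End k A := antipode k ∘ₗ antipode k
  obtain ⟨m, ρ, hρ, hc⟩ : ∃ (m : ℕ) (ρ : Module.End k A),
      T ^ (m + 1) * T ^ (m + 1) * ρ = T ^ (m + 1) ∧ Commute (T ^ (m + 1)) ρ := by
    have : IsMulCommutative (Algebra.adjoin k {T}) :=
      Algebra.isMulCommutative_adjoin k (by simp)
    let t : Algebra.adjoin k {T} := ⟨T, Algebra.subset_adjoin rfl⟩
    have : IsNoetherian k (Module.End k A) := inferInstance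
    have : FiniteDimensional k (Algebra.adjoin k {T}) :=
      FiniteDimensional.finiteDimensional_subalgebra _
    have : IsArtinianRing (Algebra.adjoin k {T}) := IsArtinianRing.of_finite k (Algebra.adjoin k {T})
    obtain ⟨m, y, hy⟩ := IsArtinian.exists_pow_succ_smul_dvd t (1 : Algebra.adjoin k {T})
    simp only [smul_eq_mul, mul_one] at hy
    have key : ∀ j, t ^ m * (t ^ j * y ^ j) = t ^ m := by
      intro j
      induction j with
      | zero => simp
      | succ j ih =>
        calc _ = (t ^ m.succ * y) * (t ^ j * y ^ j) := by rw [Nat.succ_eq_add_one]; ring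
          _ = t ^ m := by rw [hy, ih]
    have key' : t ^ (m + 1) * (t ^ (m + 1) * y ^ (m + 1)) = t ^ (m + 1) := by
      calc _ = t * (t ^ m * (t ^ (m + 1) * y ^ (m + 1))) := by ring
        _ = t ^ (m + 1) := by rw [key, ← pow_succ']
    have h1 := congrArg Subtype.val key'
    have h2 := congrArg Subtype.val (mul_comm (t ^ (m + 1)) (y ^ (m + 1)))
    exact ⟨m, ((y ^ (m + 1) : Algebra.adjoin k {T}) : Module.End k A), by simpa [mul_assoc] using h1, h2⟩
  have hU : ∀ n, ∃ U : A →ₗc[k] A, U.toLinearMap = T ^ n := by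
    intro n
    induction n with
    | zero => exact ⟨CoalgHom.id k A, rfl⟩
    | succ n ih =>
      obtain ⟨U, hU⟩ := ih
      exact ⟨U.comp antipodeSq, by rw [pow_succ, ← hU]; rfl⟩
  obtain ⟨U, hUT⟩ := hU (m + 1)
  rw [← hUT] at hρ hc
  have hρU : ∀ a, ρ (U a) = U (ρ a) := fun a => (LinearMap.congr_fun hc a).symm
  have hUUρ : ∀ a, U (U (ρ a)) = U a := fun a => LinearMap.congr_fun hρ a
  have hΔ : ∀ a, comul (R := k) (U a) = TensorProduct.map U.toLinearMap U.toLinearMap (comul a) :=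
    fun a => (LinearMap.congr_fun U.map_comp_comul a).symm
  -- the Fitting idempotent `π = U ∘ ρ` is a morphism of coalgebras
  let π : A →ₗc[k] A :=
    { U.toLinearMap ∘ₗ ρ with
      counit_comp := by
        ext a
        have h : ∀ b, counit (R := k) (U b) = counit b := fun b =>
          LinearMap.congr_fun U.counit_comp b
        change counit (R := k) (U (ρ a)) = counit a
        rw [← h (U (ρ a)), hUUρ, h]
      map_comp_comul := by
        ext a
        have e1 : U.toLinearMap ∘ₗ U.toLinearMap ∘ₗ ρ = U.toLinearMap := by
          ext a; exact hUUρ a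
        have e2 : (U.toLinearMap ∘ₗ ρ) ∘ₗ U.toLinearMap = U.toLinearMap := by
          ext a
          change U (ρ (U a)) = U a
          rw [hρU, hUUρ]
        have e3 : ρ ∘ₗ U.toLinearMap = U.toLinearMap ∘ₗ ρ := by ext a; exact hρU a
        change TensorProduct.map (U.toLinearMap ∘ₗ ρ) (U.toLinearMap ∘ₗ ρ) (comul a) =
          comul (U (ρ a))
        symm
        have hm : ∀ (f g : A →ₗ[k] A) (z : A ⊗[k] A), TensorProduct.map f f
            (TensorProduct.map g g z) = TensorProduct.map (f ∘ₗ g) (f ∘ₗ g) z := fun f g z => by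
          rw [TensorProduct.map_comp]; rfl
        calc comul (U (ρ a))
            = TensorProduct.map (U.toLinearMap ∘ₗ ρ) (U.toLinearMap ∘ₗ ρ)
              (TensorProduct.map U.toLinearMap U.toLinearMap (comul (ρ a))) := by
              rw [hm, e2, hΔ]
          _ = TensorProduct.map ρ ρ (TensorProduct.map U.toLinearMap U.toLinearMap
              (comul (U (ρ a)))) := by
              rw [hΔ, hm ρ, e3, hm]
          _ = TensorProduct.map ρ ρ (TensorProduct.map U.toLinearMap U.toLinearMap (comul a)) := by
              rw [← hΔ, hUUρ, hΔ]
          _ = _ := by rw [hm, e3] }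
  have hπ : π = CoalgHom.id k A := antipodeSq_pow_comp_cancel (m + 1) fun a => by
    change (T ^ (m + 1)) (U (ρ a)) = (T ^ (m + 1)) a
    rw [← hUT]
    exact hUUρ a
  have hinj : Function.Injective (antipode k : A →ₗ[k] A) := by
    rw [injective_iff_map_eq_zero]
    intro a ha
    have hUa : U a = 0 := by
      have := LinearMap.congr_fun hUT a
      have h : T a = 0 := by simp [T, ha]
      change U a = (T ^ (m + 1)) a at this
      rw [this, pow_succ, Module.End.mul_apply, h, map_zero]
    have h3 : π a = a := by rw [hπ]; rfl
    rw [← h3]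
    change U (ρ a) = 0
    rw [← hρU, hUa, map_zero]
  exact ⟨hinj, LinearMap.injective_iff_surjective.mp hinj⟩
end Antipode
end HopfAlgebra

namespace GS

open HopfAlgebra WithConv

section Operators

variable {k : Type*} [Field k]

/-- The diagonal action of a bialgebra `H` on the tensor product of two `H`-modules:
`h (v ⊗ w) = ∑ h⁽¹⁾ v ⊗ h⁽²⁾ w`. -/
def diag {H V W : Type*} [Ring H] [Bialgebra k H] [AddCommGroup V] [Module k V]
    [AddCommGroup W] [Module k W] (ρ : H →ₐ[k] Module.End k V) (σ : H →ₐ[k] Module.End k W) :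
    H →ₐ[k] Module.End k (V ⊗[k] W) :=
  (Module.endTensorEndAlgHom.comp (Algebra.TensorProduct.map ρ σ)).comp
    (Bialgebra.comulAlgHom k H)

/-- The opposite algebra of a bialgebra, with the same comultiplication, is a bialgebra. -/
instance instBialgebraMulOpposite {A : Type*} [Ring A] [Bialgebra k A] : Bialgebra k Aᵐᵒᵖ :=
  Bialgebra.mk' k Aᵐᵒᵖ
    (by simp [MulOpposite.counit_def])
    (by intro a b; simp [MulOpposite.counit_def, mul_comm])
    (by simp [MulOpposite.comul_def, Algebra.TensorProduct.one_def])
    (by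
      intro a b
      simp only [MulOpposite.comul_def, LinearMap.comp_apply, LinearEquiv.coe_coe,
        MulOpposite.coe_opLinearEquiv_symm, MulOpposite.unop_mul, Bialgebra.comul_mul]
      generalize comul (R := k) a.unop = x
      generalize comul (R := k) b.unop = y
      induction x with
      | zero => simp
      | add x x' hx hx' => simp only [mul_add, add_mul, map_add, hx, hx']
      | tmul x x' =>
        induction y with
        | zero => simp
        | add y y' hy hy' => simp only [mul_add, add_mul, map_add, hy, hy']
        | tmul y y' => simp)

end Operators

section Antipode

variable {k A : Type*} [Field k] [Ring A] [HopfAlgebra k A] [FiniteDimensional k A]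

variable (k A) in
/-- The antipode of a finite-dimensional Hopf algebra, as a linear automorphism. -/
def antipodeEquiv : A ≃ₗ[k] A := LinearEquiv.ofBijective (antipode k) antipode_bijective

variable (k A) in
/-- The inverse `S⁻¹` of the antipode of a finite-dimensional Hopf algebra. -/
def antipodeInv : A →ₗ[k] A := (antipodeEquiv k A).symm.toLinearMap

@[simp] lemma antipode_antipodeInv (a : A) : antipode k (antipodeInv k A a) = a :=
  (antipodeEquiv k A).apply_symm_apply a

@[simp] lemma antipodeInv_antipode (a : A) : antipodeInv k A (antipode k a) = a :=
  (antipodeEquiv k A).symm_apply_apply a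

lemma antipode_injective : Function.Injective (antipode k : A →ₗ[k] A) := antipode_bijective.1

@[simp] lemma antipodeInv_one : antipodeInv k A 1 = 1 :=
  antipode_injective (k := k) (by simp)

lemma antipodeInv_mul (a b : A) :
    antipodeInv k A (a * b) = antipodeInv k A b * antipodeInv k A a :=
  antipode_injective (k := k) (by simp [antipode_mul_antidistrib])

lemma comul_antipodeInv (a : A) :
    comul (antipodeInv k A a) = TensorProduct.map (antipodeInv k A) (antipodeInv k A)
      (TensorProduct.comm k A A (comul (R := k) a)) := by
  obtain ⟨b, rfl⟩ := (antipode_bijective (k := k) (A := A)).2 a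
  rw [antipodeInv_antipode, comul_antipode]
  generalize comul (R := k) b = x
  induction x with
  | zero => simp
  | tmul x y => simp
  | add x y hx hy => rw [map_add, map_add, map_add, map_add, ← hx, ← hy]

variable (k A) in
/-- The inverse of the antipode as an anti-morphism of algebras. -/
def antipodeInvAlgHomOp : A →ₐ[k] Aᵐᵒᵖ := .ofLinearMap
    ((MulOpposite.opLinearEquiv k).toLinearMap ∘ₗ antipodeInv k A)
    (MulOpposite.op_injective (by simp))
    (fun x y ↦ MulOpposite.op_injective (by simp [antipodeInv_mul]))

/-- The opposite algebra of a finite-dimensional Hopf algebra is a Hopf algebra,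
with antipode `S⁻¹`. -/
instance instHopfAlgebraMulOpposite : HopfAlgebra k Aᵐᵒᵖ where
  antipode := (MulOpposite.opLinearEquiv k).toLinearMap ∘ₗ antipodeInv k A ∘ₗ
    (MulOpposite.opLinearEquiv k).symm.toLinearMap
  mul_antipode_rTensor_comul := by
    refine LinearMap.ext fun a => ?_
    apply MulOpposite.unop_injective
    apply antipode_injective (k := k)
    have h := mul_antipode_lTensor_comul_apply (R := k) a.unop
    simp only [LinearMap.comp_apply, MulOpposite.comul_def, MulOpposite.counit_def,
      LinearEquiv.coe_coe, MulOpposite.coe_opLinearEquiv_symm]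
    rw [← (ℛ k a.unop).eq] at h ⊢
    simpa [antipode_mul_antidistrib, Algebra.algebraMap_eq_smul_one] using h
  mul_antipode_lTensor_comul := by
    refine LinearMap.ext fun a => ?_
    apply MulOpposite.unop_injective
    apply antipode_injective (k := k)
    have h := mul_antipode_rTensor_comul_apply (R := k) a.unop
    simp only [LinearMap.comp_apply, MulOpposite.comul_def, MulOpposite.counit_def,
      LinearEquiv.coe_coe, MulOpposite.coe_opLinearEquiv_symm]
    rw [← (ℛ k a.unop).eq] at h ⊢
    simpa [antipode_mul_antidistrib, Algebra.algebraMap_eq_smul_one] using h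

end Antipode

end GS

namespace GS

open HopfAlgebra WithConv

section Crossed

/-! The smash-type product `(C^{*op} ⊗ C^*) ⊗ H`, for a Hopf algebra `H` acting on a coalgebra `C`.
The algebra `X` is the case `H = A ⊗ A^{op}` and `C = A`. -/

variable {k H C : Type*} [Field k] [Ring H] [HopfAlgebra k H]
  [AddCommGroup C] [Module k C] [Coalgebra k C] (act : H →ₐ[k] Module.End k C)

variable (k C) in
/-- The dual `C^*` of a coalgebra, with the convolution product
`(l l')(c) = ∑ l(c⁽¹⁾) l'(c⁽²⁾)`. -/
def DualAlg : Type _ := WithConv (C →ₗ[k] k)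

instance : Ring (DualAlg k C) := inferInstanceAs (Ring (WithConv (C →ₗ[k] k)))

instance : Algebra k (DualAlg k C) := inferInstanceAs (Algebra k (WithConv (C →ₗ[k] k)))

/-- The elements of `C^*` are the linear forms on `C`. -/
def DualAlg.lin : DualAlg k C ≃ₗ[k] (C →ₗ[k] k) where
  toFun l := WithConv.ofConv l
  invFun l := WithConv.toConv l
  map_add' _ _ := rfl
  map_smul' _ _ := rfl
  left_inv _ := rfl
  right_inv _ := rfl

lemma DualAlg.mul_apply (l l' : DualAlg k C) (c : C) :
    DualAlg.lin (l * l') c =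
      LinearMap.mul' k k (TensorProduct.map (DualAlg.lin l) (DualAlg.lin l') (comul c)) := rfl

@[simp] lemma DualAlg.one_apply (c : C) : DualAlg.lin (1 : DualAlg k C) c = counit (R := k) c := rfl

lemma DualAlg.ext {l l' : DualAlg k C} (h : ∀ c, DualAlg.lin l c = DualAlg.lin l' c) : l = l' :=
  DualAlg.lin.injective (LinearMap.ext h)

variable (k C) in
/-- The algebra `C^{*op} ⊗ C^*`. -/
def PAlg : Type _ := (DualAlg k C)ᵐᵒᵖ ⊗[k] DualAlg k C

instance : Ring (PAlg k C) := inferInstanceAs (Ring ((DualAlg k C)ᵐᵒᵖ ⊗[k] DualAlg k C))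

instance : Algebra k (PAlg k C) :=
  inferInstanceAs (Algebra k ((DualAlg k C)ᵐᵒᵖ ⊗[k] DualAlg k C))

variable (k C) in
/-- The identity `C^{*op} ⊗ C^* = PAlg k C`. -/
def PAlg.of : (DualAlg k C)ᵐᵒᵖ ⊗[k] DualAlg k C ≃ₐ[k] PAlg k C := AlgEquiv.refl

/-- The element `l ⊗ l'` of `C^{*op} ⊗ C^*`. -/
def PAlg.tmul (l l' : DualAlg k C) : PAlg k C := PAlg.of k C (MulOpposite.op l ⊗ₜ l')

lemma PAlg.induction {P : PAlg k C → Prop} (h0 : P 0) (h1 : ∀ l l', P (PAlg.tmul l l'))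
    (h2 : ∀ x y, P x → P y → P (x + y)) (x : PAlg k C) : P x :=
  TensorProduct.induction_on (motive := P) x h0 (fun l l' => h1 l.unop l') h2

lemma PAlg.one_def : (1 : PAlg k C) = PAlg.tmul 1 1 := rfl

@[simp] lemma PAlg.tmul_mul (l l' m m' : DualAlg k C) :
    PAlg.tmul l l' * PAlg.tmul m m' = PAlg.tmul (m * l) (l' * m') :=
  Algebra.TensorProduct.tmul_mul_tmul (MulOpposite.op l) (MulOpposite.op m) l' m'

@[simp] lemma PAlg.smul_tmul (r : k) (l l' : DualAlg k C) :
    PAlg.tmul (r • l) l' = r • PAlg.tmul l l' := rfl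

@[simp] lemma PAlg.tmul_smul (r : k) (l l' : DualAlg k C) :
    PAlg.tmul l (r • l') = r • PAlg.tmul l l' :=
  TensorProduct.tmul_smul r (MulOpposite.op l) l'

lemma PAlg.sum_tmul {ι : Type*} (s : Finset ι) (f : ι → DualAlg k C) (l' : DualAlg k C) :
    PAlg.tmul (∑ i ∈ s, f i) l' = ∑ i ∈ s, PAlg.tmul (f i) l' := by
  simp [PAlg.tmul, TensorProduct.sum_tmul, Finset.op_sum]

lemma PAlg.tmul_sum {ι : Type*} (s : Finset ι) (f : ι → DualAlg k C) (l : DualAlg k C) :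
    PAlg.tmul l (∑ i ∈ s, f i) = ∑ i ∈ s, PAlg.tmul l (f i) := by
  simp [PAlg.tmul, TensorProduct.tmul_sum]

variable (k C) in
/-- Endomorphisms of the first tensorand of `C^{*op} ⊗ C^*`. -/
def PAlg.endLeft : Module.End k (DualAlg k C) →ₐ[k] Module.End k (PAlg k C) :=
  (LinearEquiv.conjAlgEquiv k (PAlg.of k C).toLinearEquiv).toAlgHom.comp <|
    (Module.End.rTensorAlgHom k (DualAlg k C)ᵐᵒᵖ (DualAlg k C)).comp
      (LinearEquiv.conjAlgEquiv k (MulOpposite.opLinearEquiv k)).toAlgHom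

variable (k C) in
/-- Endomorphisms of the second tensorand of `C^{*op} ⊗ C^*`. -/
def PAlg.endRight : Module.End k (DualAlg k C) →ₐ[k] Module.End k (PAlg k C) :=
  (LinearEquiv.conjAlgEquiv k (PAlg.of k C).toLinearEquiv).toAlgHom.comp
    (Module.End.lTensorAlgHom k (DualAlg k C) (DualAlg k C)ᵐᵒᵖ)

@[simp] lemma PAlg.endLeft_tmul (f : Module.End k (DualAlg k C)) (l l' : DualAlg k C) :
    PAlg.endLeft k C f (PAlg.tmul l l') = PAlg.tmul (f l) l' := rfl

@[simp] lemma PAlg.endRight_tmul (f : Module.End k (DualAlg k C)) (l l' : DualAlg k C) :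
    PAlg.endRight k C f (PAlg.tmul l l') = PAlg.tmul l (f l') := rfl

/-- For an anti-morphism of algebras `s : H → H`, the left action of `H` on `C^*` for which
`h` sends the linear form `l` to `c ↦ l (s(h) c)`. -/
def dualAct (s : H →ₐ[k] Hᵐᵒᵖ) : H →ₐ[k] Module.End k (DualAlg k C) :=
  .ofLinearMap
    { toFun := fun h =>
        { toFun := fun l => DualAlg.lin.symm (DualAlg.lin l ∘ₗ act (s h).unop)
          map_add' := fun l l' => DualAlg.ext fun c => by simp
          map_smul' := fun r l => DualAlg.ext fun c => by simp }
      map_add' := fun h h' => LinearMap.ext fun l => DualAlg.ext fun c => by simp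
      map_smul' := fun r h => LinearMap.ext fun l => DualAlg.ext fun c => by simp }
    (LinearMap.ext fun l => DualAlg.ext fun c => by simp)
    (fun h h' => LinearMap.ext fun l => DualAlg.ext fun c => by simp)

@[simp] lemma dualAct_apply (s : H →ₐ[k] Hᵐᵒᵖ) (h : H) (l : DualAlg k C) (c : C) :
    DualAlg.lin (dualAct act s h l) c = DualAlg.lin l (act (s h).unop c) := rfl

/-- `h ↦ (l ↦ l (S(h) · ))` on the tensorand `C^{*op}`. -/
def opL : H →ₐ[k] Module.End k (PAlg k C ⊗[k] H) :=
  (Module.End.rTensorAlgHom k (PAlg k C) H).comp <|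
    (PAlg.endLeft k C).comp (dualAct act (antipodeAlgHomOp k H))

variable (k H C) in
/-- Left multiplication on the tensorand `H`. -/
def opH : H →ₐ[k] Module.End k (PAlg k C ⊗[k] H) :=
  (Module.End.lTensorAlgHom k H (PAlg k C)).comp (Algebra.lmul k H)

variable (k H C) in
/-- Left multiplication on the tensorand `C^{*op} ⊗ C^*`. -/
def opP : PAlg k C →ₐ[k] Module.End k (PAlg k C ⊗[k] H) :=
  (Module.End.rTensorAlgHom k (PAlg k C) H).comp (Algebra.lmul k (PAlg k C))

@[simp] lemma opL_tmul (h h' : H) (l l' : DualAlg k C) :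
    opL act h (PAlg.tmul l l' ⊗ₜ h') =
      PAlg.tmul (dualAct act (antipodeAlgHomOp k H) h l) l' ⊗ₜ h' := rfl

@[simp] lemma opH_tmul (h h' : H) (p : PAlg k C) : opH k H C h (p ⊗ₜ h') = p ⊗ₜ (h * h') := rfl

@[simp] lemma opP_tmul (h' : H) (p p' : PAlg k C) : opP k H C p (p' ⊗ₜ h') = (p * p') ⊗ₜ h' := rfl

variable [FiniteDimensional k H]

/-- `h ↦ (l ↦ l (S⁻¹(h) · ))` on the tensorand `C^*`. -/
def opR : H →ₐ[k] Module.End k (PAlg k C ⊗[k] H) :=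
  (Module.End.rTensorAlgHom k (PAlg k C) H).comp <|
    (PAlg.endRight k C).comp (dualAct act (antipodeInvAlgHomOp k H))

@[simp] lemma opR_tmul (h h' : H) (l l' : DualAlg k C) :
    opR act h (PAlg.tmul l l' ⊗ₜ h') =
      PAlg.tmul l (dualAct act (antipodeInvAlgHomOp k H) h l') ⊗ₜ h' := rfl

/-- Left multiplication by `1 ⊗ h` in the crossed product:
`(l ⊗ l') ⊗ h' ↦ ∑ (l(S(h⁽¹⁾)·) ⊗ l'(S⁻¹(h⁽³⁾)·)) ⊗ h⁽²⁾ h'`. -/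
def opT : H →ₗ[k] Module.End k (PAlg k C ⊗[k] H) :=
  (toConv (opL act).toLinearMap * toConv (opH k H C).toLinearMap *
    toConv (opR act).toLinearMap).ofConv

/-- Left multiplication in the crossed product, `(p ⊗ h) (p' ⊗ h') = (p ⊗ 1) ((1 ⊗ h) (p' ⊗ h'))`. -/
def crossedMul : PAlg k C ⊗[k] H →ₗ[k] Module.End k (PAlg k C ⊗[k] H) :=
  TensorProduct.lift ((LinearMap.mul k (Module.End k (PAlg k C ⊗[k] H))).compl₁₂
    (opP k H C).toLinearMap (opT act))

@[simp] lemma crossedMul_tmul (p : PAlg k C) (h : H) :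
    crossedMul act (p ⊗ₜ h) = opP k H C p * opT act h := rfl

lemma opT_apply (h : H) (x : PAlg k C ⊗[k] H) :
    opT act h x = ∑ i ∈ (ℛ k h).index, ∑ j ∈ (ℛ k ((ℛ k h).left i)).index,
      opL act ((ℛ k ((ℛ k h).left i)).left j) (opH k H C ((ℛ k ((ℛ k h).left i)).right j)
        (opR act ((ℛ k h).right i) x)) := by
  change ((toConv (opL act).toLinearMap * toConv (opH k H C).toLinearMap *
    toConv (opR act).toLinearMap) h) x = _
  rw [(ℛ k h).convMul_apply]
  simp only [(ℛ k _).convMul_apply]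
  simp [Finset.sum_mul]

end Crossed
end GS

namespace GS

open HopfAlgebra WithConv

section Crossed

variable {k H C E : Type*} [Field k] [Ring H] [HopfAlgebra k H]
  [AddCommGroup C] [Module k C] [Coalgebra k C] (act : H →ₐ[k] Module.End k C)
  [Ring E] [Algebra k E]

variable (k E) in
/-- The linear map `E → E^{op}`. -/
abbrev opl : E →ₗ[k] Eᵐᵒᵖ := (MulOpposite.opLinearEquiv k).toLinearMap

lemma mulRight_comp_conv (f g : H →ₗ[k] E) (e : E) (hc : ∀ h, g h * e = e * g h) :
    toConv (LinearMap.mulRight k e ∘ₗ (toConv f * toConv g).ofConv) =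
      toConv (LinearMap.mulRight k e ∘ₗ f) * toConv g := by
  ext h
  change (toConv f * toConv g) h * e = (toConv (LinearMap.mulRight k e ∘ₗ f) * toConv g) h
  rw [(ℛ k h).convMul_apply, (ℛ k h).convMul_apply, Finset.sum_mul]
  refine Finset.sum_congr rfl fun i _ => ?_
  simp [mul_assoc, hc]

lemma opl_mulRight_comp_conv (f g : H →ₗ[k] E) (e : E) (hfg : ∀ h h', f h * g h' = g h' * f h)
    (hc : ∀ h, f h * e = e * f h) :
    toConv (opl k E ∘ₗ LinearMap.mulRight k e ∘ₗ (toConv f * toConv g).ofConv) =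
      toConv (opl k E ∘ₗ f) * toConv (opl k E ∘ₗ LinearMap.mulRight k e ∘ₗ g) := by
  ext h
  change MulOpposite.op ((toConv f * toConv g) h * e) = (toConv (opl k E ∘ₗ f) *
    toConv (opl k E ∘ₗ LinearMap.mulRight k e ∘ₗ g)) h
  rw [(ℛ k h).convMul_apply, (ℛ k h).convMul_apply, Finset.sum_mul]
  simp only [Finset.op_sum]
  refine Finset.sum_congr rfl fun i _ => ?_
  simp only [LinearMap.comp_apply, LinearMap.mulRight_apply,
    LinearEquiv.coe_coe, MulOpposite.coe_opLinearEquiv, ← MulOpposite.op_mul]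
  rw [hfg, mul_assoc, hc, mul_assoc]

lemma conv_mul_of_commute (f g : H →ₐ[k] E) (hc : ∀ h h', Commute (f h) (g h')) (h h' : H) :
    (toConv f.toLinearMap * toConv g.toLinearMap) (h * h') =
      (toConv f.toLinearMap * toConv g.toLinearMap) h *
        (toConv f.toLinearMap * toConv g.toLinearMap) h' := by
  have key : ∀ h, (toConv f.toLinearMap * toConv g.toLinearMap) h =
      Algebra.TensorProduct.lift f g hc (comul h) := fun h => by
    rw [(ℛ k h).convMul_apply, ← (ℛ k h).eq]
    simp
  rw [key, key, key, Bialgebra.comul_mul, map_mul]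

lemma conv_one_of_commute (f g : H →ₐ[k] E) :
    (toConv f.toLinearMap * toConv g.toLinearMap) 1 = 1 := by
  simp [Algebra.TensorProduct.one_def]

lemma sum_smul_counit {h : H} {ι : Type*} (r : Coalgebra.Repr k h ι) :
    ∑ i ∈ r.index, counit (R := k) (r.right i) • r.left i = h := by
  simpa only [map_sum, TensorProduct.lift.tmul, LinearMap.flip_apply, LinearMap.lsmul_apply,
    one_smul] using congr(TensorProduct.lift (LinearMap.lsmul k H).flip $(sum_tmul_counit_eq (R := k) r))

lemma conv_apply_of_right {V : Type*} [AddCommGroup V] [Module k V]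
    (f g : H →ₗ[k] Module.End k V) (x : V) (hg : ∀ h, g h x = counit (R := k) h • x) (h : H) :
    (toConv f * toConv g) h x = f h x := by
  conv_rhs => rw [← sum_smul_counit (ℛ k h)]
  rw [(ℛ k h).convMul_apply]
  simp [hg]

lemma conv_apply_of_left {V : Type*} [AddCommGroup V] [Module k V]
    (f g : H →ₗ[k] Module.End k V) (x : V) (hf : ∀ h h', f h (g h' x) = counit (R := k) h • g h' x)
    (h : H) : (toConv f * toConv g) h x = g h x := by
  conv_rhs => rw [← sum_counit_smul (ℛ k h)]
  rw [(ℛ k h).convMul_apply]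
  simp [hf]

lemma diag_apply {B V W : Type*} [Ring B] [Bialgebra k B] [AddCommGroup V] [Module k V]
    [AddCommGroup W] [Module k W]
    (ρ : B →ₐ[k] Module.End k V) (σ : B →ₐ[k] Module.End k W) {h : B} {ι : Type*}
    (r : Coalgebra.Repr k h ι) :
    diag ρ σ h = ∑ i ∈ r.index, TensorProduct.map (ρ (r.left i)) (σ (r.right i)) := by
  simp only [diag, AlgHom.comp_apply, Bialgebra.comulAlgHom_apply]
  rw [← r.eq]
  simp only [map_sum, Algebra.TensorProduct.map_tmul, Module.endTensorEndAlgHom_apply]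
  rfl

/-- The comultiplication of the image under an anti-morphism of coalgebras. -/
def antiRepr {σ : H →ₗ[k] H}
    (hσ : ∀ h, comul (σ h) = TensorProduct.map σ σ (TensorProduct.comm k H H (comul (R := k) h)))
    {h : H} {ι : Type*} (r : Coalgebra.Repr k h ι) : Coalgebra.Repr k (σ h) ι where
  index := r.index
  left i := σ (r.right i)
  right i := σ (r.left i)
  eq := by rw [hσ, ← r.eq]; simp

lemma dualAct_convMul (s : H →ₐ[k] Hᵐᵒᵖ) (σ : H →ₗ[k] H) (hs : ∀ h, (s h).unop = σ h)
    (hσ : ∀ h, comul (σ h) = TensorProduct.map σ σ (TensorProduct.comm k H H (comul (R := k) h)))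
    (hΔ : ∀ h c, comul (act h c) = diag act act h (comul (R := k) c)) (h : H) (l l' : DualAlg k C) :
    dualAct act s h (l' * l) = ∑ i ∈ (ℛ k h).index,
      dualAct act s ((ℛ k h).right i) l' * dualAct act s ((ℛ k h).left i) l := by
  refine DualAlg.ext fun c => ?_
  rw [dualAct_apply, hs, DualAlg.mul_apply, hΔ, diag_apply act act (antiRepr hσ (ℛ k h))]
  simp only [LinearMap.sum_apply, map_sum]
  refine Finset.sum_congr rfl fun i _ => ?_
  rw [DualAlg.mul_apply]
  generalize comul (R := k) c = x
  induction x with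
  | zero => simp
  | add x y hx hy => simp only [map_add, hx, hy]
  | tmul x y => simp [antiRepr, hs]

lemma dualAct_one (s : H →ₐ[k] Hᵐᵒᵖ) (σ : H →ₗ[k] H) (hs : ∀ h, (s h).unop = σ h)
    (hσ : ∀ h, counit (R := k) (σ h) = counit (R := k) h)
    (hε : ∀ h c, counit (R := k) (act h c) = counit (R := k) h * counit (R := k) c) (h : H) :
    dualAct act s h 1 = counit (R := k) h • 1 := by
  refine DualAlg.ext fun c => ?_
  rw [dualAct_apply, hs, DualAlg.one_apply, hε, hσ]
  simp

end Crossed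

section Crossed

variable {k H C E : Type*} [Field k] [Ring H] [HopfAlgebra k H] [FiniteDimensional k H]
  [AddCommGroup C] [Module k C] [Coalgebra k C] (act : H →ₐ[k] Module.End k C)
  [Ring E] [Algebra k E]

lemma counit_antipodeInv (h : H) : counit (R := k) (antipodeInv k H h) = counit (R := k) h := by
  conv_rhs => rw [← antipode_antipodeInv (k := k) h]
  rw [counit_antipode]

/-- The straightening rule, for an action `τ` of `H` and an action `F` of `C^{*op}` on the
same space. -/
def StraightL (F : DualAlg k C →ₗ[k] E) (τ : H →ₗ[k] E) : Prop :=
  ∀ h l, τ h * F l = ∑ i ∈ (ℛ k h).index,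
    F (dualAct act (antipodeAlgHomOp k H) ((ℛ k h).left i) l) * τ ((ℛ k h).right i)

/-- The straightening rule, for an action `τ` of `H` and an action `G` of `C^*` on the
same space. -/
def StraightR (G : DualAlg k C →ₗ[k] E) (τ : H →ₗ[k] E) : Prop :=
  ∀ h l, τ h * G l = ∑ i ∈ (ℛ k h).index,
    G (dualAct act (antipodeInvAlgHomOp k H) ((ℛ k h).right i) l) * τ ((ℛ k h).left i)

variable (k H C) in
/-- Left multiplication on `C^{*op}`. -/
def opF : DualAlg k C →ₗ[k] Module.End k (PAlg k C ⊗[k] H) :=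
  (opP k H C).toLinearMap ∘ₗ (PAlg.of k C).toLinearMap ∘ₗ
    (Algebra.TensorProduct.includeLeft : (DualAlg k C)ᵐᵒᵖ →ₐ[k] _).toLinearMap ∘ₗ
    (MulOpposite.opLinearEquiv k).toLinearMap

variable (k H C) in
/-- Left multiplication on `C^*`. -/
def opG : DualAlg k C →ₗ[k] Module.End k (PAlg k C ⊗[k] H) :=
  (opP k H C).toLinearMap ∘ₗ (PAlg.of k C).toLinearMap ∘ₗ
    (Algebra.TensorProduct.includeRight : DualAlg k C →ₐ[k] _).toLinearMap

lemma opF_apply (l : DualAlg k C) : opF k H C l = opP k H C (PAlg.tmul l 1) := rfl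

lemma opG_apply (l : DualAlg k C) : opG k H C l = opP k H C (PAlg.tmul 1 l) := rfl

lemma opT_intertwine (φ : PAlg k C ⊗[k] H →ₗ[k] E) (F' G' : DualAlg k C →ₗ[k] E) (τ : H →ₗ[k] E)
    (hF : StraightL act (opF k H C) (opT act)) (hG : StraightR act (opG k H C) (opT act))
    (h0 : ∀ h h', opT act h (1 ⊗ₜ h') = 1 ⊗ₜ (h * h'))
    (h1 : ∀ l x, φ (opF k H C l x) = F' l * φ x)
    (h2 : ∀ l x, φ (opG k H C l x) = G' l * φ x)
    (h3 : StraightL act F' τ) (h4 : StraightR act G' τ)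
    (h5 : ∀ h h', φ (1 ⊗ₜ (h * h')) = τ h * φ (1 ⊗ₜ h')) (h : H) (x : PAlg k C ⊗[k] H) :
    φ (opT act h x) = τ h * φ x := by
  have stepF : ∀ l y, (∀ h, φ (opT act h y) = τ h * φ y) →
      ∀ h, φ (opT act h (opF k H C l y)) = τ h * φ (opF k H C l y) := by
    intro l y hy h
    rw [h1, ← mul_assoc, h3, ← Module.End.mul_apply, hF]
    simp only [LinearMap.sum_apply, Module.End.mul_apply, map_sum, h1, hy, Finset.sum_mul,
      mul_assoc]
  have stepG : ∀ l y, (∀ h, φ (opT act h y) = τ h * φ y) →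
      ∀ h, φ (opT act h (opG k H C l y)) = τ h * φ (opG k H C l y) := by
    intro l y hy h
    rw [h2, ← mul_assoc, h4, ← Module.End.mul_apply, hG]
    simp only [LinearMap.sum_apply, Module.End.mul_apply, map_sum, h2, hy, Finset.sum_mul,
      mul_assoc]
  induction x with
  | zero => simp
  | add x y hx hy => simp only [map_add, hx, hy, mul_add]
  | tmul p h' =>
    induction p using PAlg.induction with
    | h0 => simp
    | h2 x y hx hy => simp only [TensorProduct.add_tmul, map_add, hx, hy, mul_add]
    | h1 l l' =>
      have e : (PAlg.tmul l l' ⊗ₜ[k] h' : PAlg k C ⊗[k] H) =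
          opF k H C l (opG k H C l' (1 ⊗ₜ h')) := by
        simp [opF_apply, opG_apply, PAlg.one_def]
      rw [e]
      exact stepF _ _ (stepG _ _ fun h => by rw [h0, h5]) h

variable (hΔ : ∀ h c, comul (act h c) = diag act act h (comul (R := k) c))
  (hε : ∀ h c, counit (R := k) (act h c) = counit (R := k) h * counit (R := k) c)

lemma opL_one_tmul (hε : ∀ h c, counit (R := k) (act h c) = counit (R := k) h * counit (R := k) c)
    (h h' : H) : opL act h ((1 : PAlg k C) ⊗ₜ h') = counit (R := k) h • (1 ⊗ₜ h') := by
  rw [PAlg.one_def, opL_tmul,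
    dualAct_one act _ (antipode k) (fun _ => rfl) (fun _ => counit_antipode _) hε]
  simp [TensorProduct.smul_tmul']

lemma opR_one_tmul (hε : ∀ h c, counit (R := k) (act h c) = counit (R := k) h * counit (R := k) c)
    (h h' : H) : opR act h ((1 : PAlg k C) ⊗ₜ h') = counit (R := k) h • (1 ⊗ₜ h') := by
  rw [PAlg.one_def, opR_tmul,
    dualAct_one act _ (antipodeInv k H) (fun _ => rfl) (fun _ => counit_antipodeInv _) hε]
  simp [TensorProduct.smul_tmul']

lemma opT_one_tmul (hε : ∀ h c, counit (R := k) (act h c) = counit (R := k) h * counit (R := k) c)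
    (h h' : H) : opT act h ((1 : PAlg k C) ⊗ₜ h') = 1 ⊗ₜ (h * h') := by
  refine (conv_apply_of_right ((toConv (opL act).toLinearMap *
    toConv (opH k H C).toLinearMap).ofConv) (opR act).toLinearMap _
    (fun h => opR_one_tmul act hε h h') h).trans ?_
  exact conv_apply_of_left (opL act).toLinearMap (opH k H C).toLinearMap _
    (fun h h'' => opL_one_tmul act hε h (h'' * h')) h

end Crossed
end GS

namespace GS

open HopfAlgebra WithConv

section Crossed

variable {k H C E : Type*} [Field k] [Ring H] [HopfAlgebra k H] [FiniteDimensional k H]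
  [AddCommGroup C] [Module k C] [Coalgebra k C] (act : H →ₐ[k] Module.End k C)
  [Ring E] [Algebra k E]

/-- The convolution of two commuting morphisms of algebras. -/
def convAlgHom (f g : H →ₐ[k] E) (hc : ∀ h h', Commute (f h) (g h')) : H →ₐ[k] E :=
  (Algebra.TensorProduct.lift f g hc).comp (Bialgebra.comulAlgHom k H)

lemma toConv_convAlgHom (f g : H →ₐ[k] E) (hc : ∀ h h', Commute (f h) (g h')) :
    toConv (convAlgHom f g hc).toLinearMap = toConv f.toLinearMap * toConv g.toLinearMap := by
  ext h
  rw [(ℛ k h).convMul_apply]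
  change Algebra.TensorProduct.lift f g hc (comul h) = _
  conv_lhs => rw [← (ℛ k h).eq]
  simp

lemma straightL_iff (F : DualAlg k C →ₗ[k] E) (τ : H →ₗ[k] E) : StraightL act F τ ↔
    ∀ l, toConv (LinearMap.mulRight k (F l) ∘ₗ τ) =
      toConv (F ∘ₗ (dualAct act (antipodeAlgHomOp k H)).toLinearMap.flip l) * toConv τ := by
  constructor
  · intro h l
    ext x
    rw [(ℛ k x).convMul_apply]
    exact h x l
  · intro h x l
    have := congr($(h l) x)
    rw [(ℛ k x).convMul_apply] at this
    exact this

lemma straightR_iff (G : DualAlg k C →ₗ[k] E) (τ : H →ₗ[k] E) : StraightR act G τ ↔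
    ∀ l, toConv (opl k E ∘ₗ LinearMap.mulRight k (G l) ∘ₗ τ) =
      toConv (opl k E ∘ₗ τ) *
        toConv (opl k E ∘ₗ G ∘ₗ (dualAct act (antipodeInvAlgHomOp k H)).toLinearMap.flip l) := by
  constructor
  · intro h l
    ext x
    rw [(ℛ k x).convMul_apply]
    change MulOpposite.op (τ x * G l) = _
    rw [h x l]
    simp
  · intro h x l
    have := congr(MulOpposite.unop ($(h l) x))
    rw [(ℛ k x).convMul_apply] at this
    simpa using this

lemma end_ext {V : Type*} [AddCommMonoid V] [Module k V]
    {f g : Module.End k (PAlg k C ⊗[k] V)}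
    (h : ∀ m m' x, f (PAlg.tmul m m' ⊗ₜ x) = g (PAlg.tmul m m' ⊗ₜ x)) : f = g := by
  refine LinearMap.ext fun x => ?_
  induction x with
  | zero => simp
  | add x y hx hy => simp only [map_add, hx, hy]
  | tmul p x =>
    induction p using PAlg.induction with
    | h0 => simp
    | h1 m m' => exact h m m' x
    | h2 x y hx hy => simp only [TensorProduct.add_tmul, map_add, hx, hy]

lemma commute_opL_opH (h h' : H) : Commute (opL act h) (opH k H C h') :=
  end_ext fun m m' x => by simp [Module.End.mul_apply]

lemma commute_opL_opR (h h' : H) : Commute (opL act h) (opR act h') :=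
  end_ext fun m m' x => by simp [Module.End.mul_apply]

lemma commute_opH_opR (h h' : H) : Commute (opH k H C h) (opR act h') :=
  end_ext fun m m' x => by simp [Module.End.mul_apply]

lemma commute_opH_opF (h : H) (l : DualAlg k C) : Commute (opH k H C h) (opF k H C l) :=
  end_ext fun m m' x => by simp [Module.End.mul_apply, opF_apply]

lemma commute_opR_opF (h : H) (l : DualAlg k C) : Commute (opR act h) (opF k H C l) :=
  end_ext fun m m' x => by simp [Module.End.mul_apply, opF_apply]

lemma commute_opH_opG (h : H) (l : DualAlg k C) : Commute (opH k H C h) (opG k H C l) :=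
  end_ext fun m m' x => by simp [Module.End.mul_apply, opG_apply]

lemma commute_opL_opG (h : H) (l : DualAlg k C) : Commute (opL act h) (opG k H C l) :=
  end_ext fun m m' x => by simp [Module.End.mul_apply, opG_apply]

variable (H C) in
/-- The comultiplicativity of the action: `C` is an `H`-module coalgebra. -/
structure IsModuleCoalgebra : Prop where
  comul : ∀ h c, comul (act h c) = diag act act h (comul (R := k) c)
  counit : ∀ h c, counit (R := k) (act h c) = counit (R := k) h * counit (R := k) c

lemma straightL_opL (hact : IsModuleCoalgebra H C act) : StraightL act (opF k H C) (opL act).toLinearMap := by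
  intro h l
  refine end_ext fun m m' x => ?_
  simp only [Module.End.mul_apply, opF_apply, opP_tmul, PAlg.tmul_mul, one_mul, opL_tmul,
    LinearMap.sum_apply, AlgHom.toLinearMap_apply]
  rw [dualAct_convMul act _ (antipode k) (fun _ => rfl) comul_antipode hact.comul]
  simp [PAlg.sum_tmul, TensorProduct.sum_tmul]

lemma straightR_opR (hact : IsModuleCoalgebra H C act) :
    StraightR act (opG k H C) (opR act).toLinearMap := by
  intro h l
  refine end_ext fun m m' x => ?_
  simp only [Module.End.mul_apply, opG_apply, opP_tmul, PAlg.tmul_mul, mul_one, opR_tmul,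
    LinearMap.sum_apply, AlgHom.toLinearMap_apply]
  rw [dualAct_convMul act _ (antipodeInv k H) (fun _ => rfl) comul_antipodeInv hact.comul]
  simp [PAlg.tmul_sum, TensorProduct.sum_tmul]

/-- The operator `∑ opH(h⁽¹⁾) opR(h⁽²⁾)`. -/
def opHR : H →ₐ[k] Module.End k (PAlg k C ⊗[k] H) :=
  convAlgHom (opH k H C) (opR act) (commute_opH_opR act)

/-- The operator `∑ opL(h⁽¹⁾) opH(h⁽²⁾)`. -/
def opLH : H →ₐ[k] Module.End k (PAlg k C ⊗[k] H) :=
  convAlgHom (opL act) (opH k H C) (commute_opL_opH act)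

lemma commute_convAlgHom (f g : H →ₐ[k] E) (hc : ∀ h h', Commute (f h) (g h')) (e : E)
    (hf : ∀ h, Commute (f h) e) (hg : ∀ h, Commute (g h) e) (h : H) :
    Commute (convAlgHom f g hc h) e := by
  have : convAlgHom f g hc h = (toConv f.toLinearMap * toConv g.toLinearMap) h :=
    congr($(toConv_convAlgHom f g hc) h)
  rw [this, (ℛ k h).convMul_apply]
  exact Commute.sum_left _ _ _ fun i _ => (hf _).mul_left (hg _)

lemma toConv_opT : toConv (opT act) = toConv (opL act).toLinearMap * toConv (opHR act).toLinearMap := by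
  rw [opHR, toConv_convAlgHom, ← mul_assoc]
  rfl

lemma toConv_opT' : toConv (opT act) = toConv (opLH act).toLinearMap * toConv (opR act).toLinearMap := by
  rw [opLH, toConv_convAlgHom]
  rfl

lemma opT_mul (h h' : H) : opT act (h * h') = opT act h * opT act h' := by
  have key : ∀ h, opT act h =
      (toConv (opL act).toLinearMap * toConv (opHR act).toLinearMap) h := fun h =>
    congr($(toConv_opT act) h)
  rw [key, key, key]
  exact conv_mul_of_commute _ _ (fun h h' => (commute_convAlgHom _ _ _ _
    (fun x => (commute_opL_opH act h x).symm) (fun x => (commute_opL_opR act h x).symm) h').symm)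
    h h'

lemma opT_one : opT act 1 = 1 := by
  refine Eq.trans ?_ (conv_one_of_commute (opL act) (opHR act))
  exact congr($(toConv_opT act) 1)

lemma straightL_opT (hact : IsModuleCoalgebra H C act) : StraightL act (opF k H C) (opT act) := by
  rw [straightL_iff]
  intro l
  have h1 := mulRight_comp_conv (opL act).toLinearMap (opHR act).toLinearMap (opF k H C l)
    (commute_convAlgHom _ _ (commute_opH_opR act) _ (commute_opH_opF · l) (commute_opR_opF act · l))
  have h2 : opT act = (toConv (opL act).toLinearMap * toConv (opHR act).toLinearMap).ofConv :=
    congr(WithConv.ofConv $(toConv_opT act))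
  rw [h2, h1, (straightL_iff act _ _).1 (straightL_opL act hact) l, mul_assoc]

lemma straightR_opT (hact : IsModuleCoalgebra H C act) : StraightR act (opG k H C) (opT act) := by
  rw [straightR_iff]
  intro l
  have hc : ∀ h h', opLH act h * opR act h' = opR act h' * opLH act h := fun h h' =>
    commute_convAlgHom _ _ _ _ (fun x => commute_opL_opR act x h')
      (fun x => commute_opH_opR act x h') h
  have h1 := opl_mulRight_comp_conv (opLH act).toLinearMap (opR act).toLinearMap (opG k H C l) hc
    (commute_convAlgHom _ _ (commute_opL_opH act) _ (commute_opL_opG act · l) (commute_opH_opG · l))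
  have h1' := opl_mulRight_comp_conv (opLH act).toLinearMap (opR act).toLinearMap 1 hc
    (fun h => by simp)
  have h2 : opT act = (toConv (opLH act).toLinearMap * toConv (opR act).toLinearMap).ofConv :=
    congr(WithConv.ofConv $(toConv_opT' act))
  rw [LinearMap.mulRight_one, LinearMap.id_comp, LinearMap.id_comp] at h1'
  rw [h2, h1, (straightR_iff act _ _).1 (straightR_opR act hact) l, h1', mul_assoc]

lemma crossedMul_opP (p : PAlg k C) (x : PAlg k C ⊗[k] H) :
    crossedMul act (opP k H C p x) = opP k H C p * crossedMul act x := by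
  induction x with
  | zero => simp
  | add x y hx hy => simp only [map_add, hx, hy, mul_add]
  | tmul p' h => simp [mul_assoc]

lemma crossedMul_opT (hact : IsModuleCoalgebra H C act) (h : H) (x : PAlg k C ⊗[k] H) :
    crossedMul act (opT act h x) = opT act h * crossedMul act x :=
  opT_intertwine act (crossedMul act) (opF k H C) (opG k H C) (opT act)
    (straightL_opT act hact) (straightR_opT act hact) (opT_one_tmul act hact.counit)
    (fun l x => crossedMul_opP act _ x) (fun l x => crossedMul_opP act _ x)
    (straightL_opT act hact) (straightR_opT act hact)
    (fun h h' => by simp [opT_mul]) h x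

/-- Associativity of the crossed product. -/
lemma crossedMul_mul (hact : IsModuleCoalgebra H C act) (x y : PAlg k C ⊗[k] H) :
    crossedMul act (crossedMul act x y) = crossedMul act x * crossedMul act y := by
  induction x with
  | zero => simp
  | add x x' hx hx' => simp only [map_add, LinearMap.add_apply, hx, hx', add_mul]
  | tmul p h =>
    rw [crossedMul_tmul, Module.End.mul_apply, crossedMul_opP, crossedMul_opT act hact, mul_assoc]

lemma crossedMul_one_left : crossedMul act (1 ⊗ₜ 1) = 1 := by
  rw [crossedMul_tmul, opT_one, map_one, one_mul]

lemma crossedMul_one_right (hact : IsModuleCoalgebra H C act) (x : PAlg k C ⊗[k] H) :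
    crossedMul act x (1 ⊗ₜ 1) = x := by
  induction x with
  | zero => simp
  | add x x' hx hx' => simp only [map_add, LinearMap.add_apply, hx, hx']
  | tmul p h =>
    rw [crossedMul_tmul, Module.End.mul_apply, opT_one_tmul act hact.counit]
    simp

variable {act}

/-- The crossed product algebra `(C^{*op} ⊗ C^*) ⊗ H`, for an `H`-module coalgebra `C`. It contains
`C^{*op} ⊗ C^*` and `H` as subalgebras. -/
def Crossed (_ : IsModuleCoalgebra H C act) : Type _ := PAlg k C ⊗[k] H

instance (hact : IsModuleCoalgebra H C act) : AddCommGroup (Crossed hact) :=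
  inferInstanceAs (AddCommGroup (PAlg k C ⊗[k] H))

instance (hact : IsModuleCoalgebra H C act) : Module k (Crossed hact) :=
  inferInstanceAs (Module k (PAlg k C ⊗[k] H))

/-- The identity `(C^{*op} ⊗ C^*) ⊗ H = Crossed hact`. -/
def Crossed.of (hact : IsModuleCoalgebra H C act) : PAlg k C ⊗[k] H ≃ₗ[k] Crossed hact :=
  LinearEquiv.refl k _

/-- Multiplication of the crossed product. -/
def Crossed.mul (hact : IsModuleCoalgebra H C act) (x y : Crossed hact) : Crossed hact :=
  Crossed.of hact (crossedMul act ((Crossed.of hact).symm x) ((Crossed.of hact).symm y))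

instance (hact : IsModuleCoalgebra H C act) : Ring (Crossed hact) where
  __ := (inferInstance : AddCommGroup (Crossed hact))
  mul := Crossed.mul hact
  one := Crossed.of hact (1 ⊗ₜ 1)
  left_distrib x y z := map_add (crossedMul act x) y z
  right_distrib x y z := congr($(map_add (crossedMul act) x y) z)
  zero_mul x := congr($(map_zero (crossedMul act)) x)
  mul_zero x := map_zero (crossedMul act x)
  mul_assoc x y z := congr($(crossedMul_mul act hact x y) z)
  one_mul x := congr($(crossedMul_one_left (act := act)) x)
  mul_one x := crossedMul_one_right act hact x

lemma Crossed.mul_def (hact : IsModuleCoalgebra H C act) (x y : PAlg k C ⊗[k] H) :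
    Crossed.of hact x * Crossed.of hact y = Crossed.of hact (crossedMul act x y) := rfl

instance (hact : IsModuleCoalgebra H C act) : Algebra k (Crossed hact) :=
  Algebra.ofModule (fun r x y => congr($(map_smul (crossedMul act) r x) y))
    (fun r x y => map_smul (crossedMul act x) r y)

/-- The straightening formula: `(1 ⊗ h) ((l ⊗ l') ⊗ 1)` is the sum of the elements
`(l(S(h⁽¹⁾)·) ⊗ l'(S⁻¹(h⁽³⁾)·)) ⊗ h⁽²⁾`. -/
lemma Crossed.straighten (hact : IsModuleCoalgebra H C act) (h : H) (l l' : DualAlg k C) :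
    Crossed.of hact (1 ⊗ₜ h) * Crossed.of hact (PAlg.tmul l l' ⊗ₜ 1) =
      ∑ i ∈ (ℛ k h).index, ∑ j ∈ (ℛ k ((ℛ k h).left i)).index, Crossed.of hact (PAlg.tmul
        (DualAlg.lin.symm (DualAlg.lin l ∘ₗ act (antipode k ((ℛ k ((ℛ k h).left i)).left j))))
        (DualAlg.lin.symm (DualAlg.lin l' ∘ₗ act (antipodeInv k H ((ℛ k h).right i)))) ⊗ₜ
        ((ℛ k ((ℛ k h).left i)).right j)) := by
  rw [Crossed.mul_def, crossedMul_tmul, map_one, one_mul, opT_apply]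
  simp only [opL_tmul, opH_tmul, opR_tmul, mul_one, map_sum]
  rfl

end Crossed
end GS

namespace GS

open HopfAlgebra WithConv

section XAlg

variable (k A : Type u) [Field k] [Ring A] [HopfAlgebra k A]

/-- Left multiplication of `A` on itself. -/
def lreg : A →ₐ[k] Module.End k A := Algebra.lmul k A

/-- Right multiplication of `A` on itself. -/
def rreg : Aᵐᵒᵖ →ₐ[k] Module.End k A := Algebra.lsmul k k A

variable {A}

@[simp] lemma lreg_apply (a x : A) : lreg k A a x = a * x := rfl

@[simp] lemma rreg_apply (b : Aᵐᵒᵖ) (x : A) : rreg k A b x = x * b.unop := rfl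

lemma comul_lreg (a x : A) : comul (lreg k A a x) = diag (lreg k A) (lreg k A) a (comul (R := k) x) := by
  rw [lreg_apply, Bialgebra.comul_mul, diag_apply _ _ (ℛ k a)]
  conv_lhs => rw [← (ℛ k a).eq]
  generalize comul (R := k) x = y
  rw [Finset.sum_mul, LinearMap.sum_apply]
  refine Finset.sum_congr rfl fun i _ => ?_
  induction y with
  | zero => simp
  | add y z hy hz => simp only [mul_add, map_add, hy, hz]
  | tmul y z => simp

variable {k} in
/-- The comultiplication of `A^{op}` is that of `A`. -/
def opRepr {b : A} {ι : Type*} (r : Coalgebra.Repr k b ι) :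
    Coalgebra.Repr k (MulOpposite.op b) ι where
  index := r.index
  left i := MulOpposite.op (r.left i)
  right i := MulOpposite.op (r.right i)
  eq := by
    rw [MulOpposite.comul_def]
    simp only [LinearMap.comp_apply, LinearEquiv.coe_coe, MulOpposite.coe_opLinearEquiv_symm,
      MulOpposite.unop_op]
    conv_rhs => rw [← r.eq]
    simp

lemma comul_rreg (b : Aᵐᵒᵖ) (x : A) :
    comul (rreg k A b x) = diag (rreg k A) (rreg k A) b (comul (R := k) x) := by
  obtain ⟨b, rfl⟩ := MulOpposite.op_surjective b
  let r := opRepr (ℛ k b)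
  rw [rreg_apply, MulOpposite.unop_op, Bialgebra.comul_mul, diag_apply _ _ r]
  conv_lhs => rw [← (ℛ k b).eq]
  generalize comul (R := k) x = y
  rw [Finset.mul_sum, LinearMap.sum_apply]
  refine Finset.sum_congr rfl fun i _ => ?_
  induction y with
  | zero => simp
  | add y z hy hz => simp only [add_mul, map_add, hy, hz]
  | tmul y z => simp [r, opRepr]

section Bimodule

variable {k} {V W : Type*} [AddCommGroup V] [Module k V] [AddCommGroup W] [Module k W]

/-- The action `(a ⊗ b) v = a v b` of `A ⊗ A^{op}` on an `A`-bimodule. -/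
def biAct (L : A →ₐ[k] Module.End k V) (R : Aᵐᵒᵖ →ₐ[k] Module.End k V)
    (h : ∀ a b, Commute (L a) (R b)) : A ⊗[k] Aᵐᵒᵖ →ₐ[k] Module.End k V :=
  Algebra.TensorProduct.lift L R h

@[simp] lemma biAct_tmul (L : A →ₐ[k] Module.End k V) (R : Aᵐᵒᵖ →ₐ[k] Module.End k V)
    (h : ∀ a b, Commute (L a) (R b)) (a : A) (b : Aᵐᵒᵖ) : biAct L R h (a ⊗ₜ b) = L a * R b := by
  simp [biAct]

lemma diag_biAct (L : A →ₐ[k] Module.End k V) (R : Aᵐᵒᵖ →ₐ[k] Module.End k V)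
    (h : ∀ a b, Commute (L a) (R b)) (L' : A →ₐ[k] Module.End k W)
    (R' : Aᵐᵒᵖ →ₐ[k] Module.End k W) (h' : ∀ a b, Commute (L' a) (R' b)) (a : A) (b : Aᵐᵒᵖ) :
    diag (biAct L R h) (biAct L' R' h') (a ⊗ₜ b) = diag L L' a * diag R R' b := by
  simp only [diag, AlgHom.comp_apply, Bialgebra.comulAlgHom_apply, TensorProduct.comul_tmul]
  generalize comul (R := k) a = x
  generalize comul (R := k) b = y
  induction x with
  | zero => simp
  | add x x' hx hx' => simp only [TensorProduct.add_tmul, map_add, hx, hx', add_mul]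
  | tmul x x' =>
    induction y with
    | zero => simp
    | add y y' hy hy' => simp only [TensorProduct.tmul_add, map_add, hy, hy', mul_add]
    | tmul y y' =>
      refine TensorProduct.ext' fun v w => ?_
      simp [Module.endTensorEndAlgHom_apply]

lemma commute_diag
    {L : A →ₐ[k] Module.End k V} {R : Aᵐᵒᵖ →ₐ[k] Module.End k V}
    (h : ∀ a b, Commute (L a) (R b)) {L' : A →ₐ[k] Module.End k W}
    {R' : Aᵐᵒᵖ →ₐ[k] Module.End k W} (h' : ∀ a b, Commute (L' a) (R' b)) (a : A) (b : Aᵐᵒᵖ) :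
    Commute (diag L L' a) (diag R R' b) := by
  rw [diag_apply _ _ (ℛ k a), diag_apply _ _ (ℛ k b)]
  refine Commute.sum_left _ _ _ fun i _ => Commute.sum_right _ _ _ fun j _ => ?_
  refine TensorProduct.ext' fun v w => ?_
  have h1 := fun a b v => congr($((h a b).eq) v)
  have h2 := fun a b v => congr($((h' a b).eq) v)
  simp only [Module.End.mul_apply] at h1 h2
  simp [h1, h2]

end Bimodule

lemma commute_lreg_rreg (a : A) (b : Aᵐᵒᵖ) : Commute (lreg k A a) (rreg k A b) :=
  LinearMap.ext fun x => by simp [mul_assoc]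

variable (A)

/-- The action `(a ⊗ b) x = a x b` of `A ⊗ A^{op}` on `A`. -/
def regAct : A ⊗[k] Aᵐᵒᵖ →ₐ[k] Module.End k A :=
  biAct (lreg k A) (rreg k A) (commute_lreg_rreg k)

variable [FiniteDimensional k A]

variable {A} in
lemma antipode_env (a b : A) : antipode k (a ⊗ₜ MulOpposite.op b : A ⊗[k] Aᵐᵒᵖ) =
    antipode k a ⊗ₜ MulOpposite.op (antipodeInv k A b) := rfl

variable {A} in
lemma antipodeInv_env (a b : A) : antipodeInv k (A ⊗[k] Aᵐᵒᵖ) (a ⊗ₜ MulOpposite.op b) =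
    antipodeInv k A a ⊗ₜ MulOpposite.op (antipode k b) := by
  apply antipode_injective (k := k)
  rw [antipode_antipodeInv, antipode_env]
  simp

lemma regAct_isModuleCoalgebra : IsModuleCoalgebra (A ⊗[k] Aᵐᵒᵖ) A (regAct k A) where
  comul h c := by
    induction h with
    | zero => simp
    | add x y hx hy => simp only [map_add, LinearMap.add_apply, hx, hy]
    | tmul a b =>
      rw [regAct, diag_biAct, biAct_tmul, Module.End.mul_apply, Module.End.mul_apply, comul_lreg,
        comul_rreg]
  counit h c := by
    induction h with
    | zero => simp
    | add x y hx hy => simp only [map_add, LinearMap.add_apply, hx, hy, add_mul]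
    | tmul a b => simp [regAct, MulOpposite.counit_def]; ring

/-- The algebra `X = (A^{*op} ⊗ A^*) ⊗ (A ⊗ A^{op})`, whose product extends the products of the
two tensorands and satisfies
`[1 ⊗ (a ⊗ b)] [(l ⊗ l') ⊗ 1] = ∑ l(S(a⁽¹⁾) · S⁻¹(b⁽¹⁾)) ⊗ l'(S⁻¹(a⁽³⁾) · S(b⁽³⁾)) ⊗ (a⁽²⁾ ⊗ b⁽²⁾)`. -/
abbrev XAlg : Type u := Crossed (regAct_isModuleCoalgebra k A)

end XAlg
end GS

namespace GS

open HopfAlgebra WithConv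

/-- A Hopf bimodule over a Hopf algebra `A`: an `A`-bimodule which is also an `A`-bicomodule, such
that the two coactions `M → A ⊗ M` and `M → M ⊗ A` are morphisms of bimodules for the diagonal
actions on `A ⊗ M` and `M ⊗ A`. -/
structure HopfBimod (k A : Type u) [Field k] [Ring A] [HopfAlgebra k A] : Type (u + 1) where
  /-- The underlying vector space. -/
  carrier : Type u
  [addCommGroup : AddCommGroup carrier]
  [module : Module k carrier]
  /-- The left action of `A`. -/
  lact : A →ₐ[k] Module.End k carrier
  /-- The right action of `A`. -/
  ract : Aᵐᵒᵖ →ₐ[k] Module.End k carrier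
  act_comm : ∀ a b, Commute (lact a) (ract b)
  /-- The left coaction of `A`. -/
  lcoact : carrier →ₗ[k] A ⊗[k] carrier
  /-- The right coaction of `A`. -/
  rcoact : carrier →ₗ[k] carrier ⊗[k] A
  lcoact_coassoc : TensorProduct.assoc k A A carrier ∘ₗ comul.rTensor carrier ∘ₗ lcoact =
    lcoact.lTensor A ∘ₗ lcoact
  lcoact_counit : TensorProduct.lid k carrier ∘ₗ counit.rTensor carrier ∘ₗ lcoact = LinearMap.id
  rcoact_coassoc : TensorProduct.assoc k carrier A A ∘ₗ rcoact.rTensor A ∘ₗ rcoact =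
    comul.lTensor carrier ∘ₗ rcoact
  rcoact_counit : TensorProduct.rid k carrier ∘ₗ counit.lTensor carrier ∘ₗ rcoact = LinearMap.id
  coact_comm : TensorProduct.assoc k A carrier A ∘ₗ lcoact.rTensor A ∘ₗ rcoact =
    rcoact.lTensor A ∘ₗ lcoact
  lcoact_lact : ∀ a, lcoact ∘ₗ lact a = diag (lreg k A) lact a ∘ₗ lcoact
  lcoact_ract : ∀ b, lcoact ∘ₗ ract b = diag (rreg k A) ract b ∘ₗ lcoact
  rcoact_lact : ∀ a, rcoact ∘ₗ lact a = diag lact (lreg k A) a ∘ₗ rcoact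
  rcoact_ract : ∀ b, rcoact ∘ₗ ract b = diag ract (rreg k A) b ∘ₗ rcoact

section

variable {k A : Type u} [Field k] [Ring A] [HopfAlgebra k A]

instance : CoeSort (HopfBimod k A) (Type u) := ⟨HopfBimod.carrier⟩

attribute [instance] HopfBimod.addCommGroup HopfBimod.module

/-- A morphism of Hopf bimodules is a linear map commuting with the actions and the coactions. -/
@[ext]
structure HopfBimod.Hom (M N : HopfBimod k A) where
  /-- The underlying linear map. -/
  lin : M →ₗ[k] N
  lact : ∀ a, lin ∘ₗ M.lact a = N.lact a ∘ₗ lin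
  ract : ∀ b, lin ∘ₗ M.ract b = N.ract b ∘ₗ lin
  lcoact : N.lcoact ∘ₗ lin = lin.lTensor A ∘ₗ M.lcoact
  rcoact : N.rcoact ∘ₗ lin = lin.rTensor A ∘ₗ M.rcoact

namespace HopfBimod

/-- The category of Hopf bimodules. -/
instance : Category (HopfBimod k A) where
  Hom := Hom
  id M := ⟨LinearMap.id, fun _ => rfl, fun _ => rfl,
    by rw [LinearMap.lTensor_id]; rfl, by rw [LinearMap.rTensor_id]; rfl⟩
  comp f g := ⟨g.lin ∘ₗ f.lin,
    fun a => by rw [LinearMap.comp_assoc, f.lact, ← LinearMap.comp_assoc, g.lact,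
      LinearMap.comp_assoc],
    fun a => by rw [LinearMap.comp_assoc, f.ract, ← LinearMap.comp_assoc, g.ract,
      LinearMap.comp_assoc],
    by rw [← LinearMap.comp_assoc, g.lcoact, LinearMap.comp_assoc, f.lcoact,
      LinearMap.lTensor_comp, LinearMap.comp_assoc],
    by rw [← LinearMap.comp_assoc, g.rcoact, LinearMap.comp_assoc, f.rcoact,
      LinearMap.rTensor_comp, LinearMap.comp_assoc]⟩

@[ext] lemma hom_ext {M N : HopfBimod k A} {f g : M ⟶ N} (h : f.lin = g.lin) : f = g := Hom.ext h

@[simp] lemma id_lin (M : HopfBimod k A) : Hom.lin (𝟙 M) = LinearMap.id := rfl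

@[simp] lemma comp_lin {M N P : HopfBimod k A} (f : M ⟶ N) (g : N ⟶ P) :
    (f ≫ g).lin = g.lin ∘ₗ f.lin := rfl

section Linear

variable {M N : HopfBimod k A}

instance : Add (M ⟶ N) := ⟨fun f g => ⟨f.lin + g.lin,
  fun a => by rw [LinearMap.add_comp, LinearMap.comp_add, f.lact, g.lact],
  fun a => by rw [LinearMap.add_comp, LinearMap.comp_add, f.ract, g.ract],
  by rw [LinearMap.comp_add, LinearMap.lTensor_add, LinearMap.add_comp, f.lcoact, g.lcoact],
  by rw [LinearMap.comp_add, LinearMap.rTensor_add, LinearMap.add_comp, f.rcoact, g.rcoact]⟩⟩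

instance : Zero (M ⟶ N) := ⟨⟨0, fun a => by simp, fun a => by simp, by simp, by simp⟩⟩

instance : Neg (M ⟶ N) := ⟨fun f => ⟨-f.lin,
  fun a => by rw [LinearMap.neg_comp, LinearMap.comp_neg, f.lact],
  fun a => by rw [LinearMap.neg_comp, LinearMap.comp_neg, f.ract],
  by rw [LinearMap.comp_neg, LinearMap.lTensor_neg, LinearMap.neg_comp, f.lcoact],
  by rw [LinearMap.comp_neg, LinearMap.rTensor_neg, LinearMap.neg_comp, f.rcoact]⟩⟩

instance : SMul k (M ⟶ N) := ⟨fun r f => ⟨r • f.lin,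
  fun a => by rw [LinearMap.smul_comp, LinearMap.comp_smul, f.lact],
  fun a => by rw [LinearMap.smul_comp, LinearMap.comp_smul, f.ract],
  by rw [LinearMap.comp_smul, LinearMap.lTensor_smul, LinearMap.smul_comp, f.lcoact],
  by rw [LinearMap.comp_smul, LinearMap.rTensor_smul, LinearMap.smul_comp, f.rcoact]⟩⟩

@[simp] lemma add_lin (f g : M ⟶ N) : (f + g).lin = f.lin + g.lin := rfl
@[simp] lemma zero_lin : Hom.lin (0 : M ⟶ N) = 0 := rfl
@[simp] lemma neg_lin (f : M ⟶ N) : (-f).lin = -f.lin := rfl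
@[simp] lemma smul_lin (r : k) (f : M ⟶ N) : (r • f).lin = r • f.lin := rfl

instance : AddCommGroup (M ⟶ N) where
  add_assoc _ _ _ := hom_ext (add_assoc _ _ _)
  zero_add _ := hom_ext (zero_add _)
  add_zero _ := hom_ext (add_zero _)
  neg_add_cancel _ := hom_ext (neg_add_cancel _)
  add_comm _ _ := hom_ext (add_comm _ _)
  nsmul := nsmulRec
  zsmul := zsmulRec

instance : Module k (M ⟶ N) where
  one_smul _ := hom_ext (one_smul _ _)
  mul_smul _ _ _ := hom_ext (mul_smul _ _ _)
  smul_zero _ := hom_ext (smul_zero _)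
  smul_add _ _ _ := hom_ext (smul_add _ _ _)
  add_smul _ _ _ := hom_ext (add_smul _ _ _)
  zero_smul _ := hom_ext (zero_smul _ _)

@[simp] lemma sub_lin (f g : M ⟶ N) : (f - g).lin = f.lin - g.lin := by
  rw [sub_eq_add_neg, add_lin, neg_lin, sub_eq_add_neg]

end Linear

instance : Preadditive (HopfBimod k A) where
  add_comp _ _ _ _ _ _ := hom_ext (LinearMap.comp_add _ _ _)
  comp_add _ _ _ _ _ _ := hom_ext (LinearMap.add_comp _ _ _)

instance : CategoryTheory.Linear k (HopfBimod k A) where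
  smul_comp _ _ _ _ _ _ := hom_ext (LinearMap.comp_smul _ _ _)
  comp_smul _ _ _ _ _ _ := hom_ext (LinearMap.smul_comp _ _ _)

section regular

variable (k A)

/-- `A` as a Hopf bimodule over itself, with its multiplication and its comultiplication. -/
def regular : HopfBimod k A where
  carrier := A
  lact := lreg k A
  ract := rreg k A
  act_comm := commute_lreg_rreg k
  lcoact := comul
  rcoact := comul
  lcoact_coassoc := Coalgebra.coassoc
  lcoact_counit := by ext a; simp
  rcoact_coassoc := Coalgebra.coassoc
  rcoact_counit := by ext a; simp
  coact_comm := Coalgebra.coassoc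
  lcoact_lact a := LinearMap.ext fun x => comul_lreg k a x
  lcoact_ract a := LinearMap.ext fun x => comul_rreg k a x
  rcoact_lact a := LinearMap.ext fun x => comul_lreg k a x
  rcoact_ract a := LinearMap.ext fun x => comul_rreg k a x

end regular

variable (M : HopfBimod k A)

/-- The action `(a ⊗ b) m = a m b` of `A ⊗ A^{op}`. -/
def envAct : A ⊗[k] Aᵐᵒᵖ →ₐ[k] Module.End k M := biAct M.lact M.ract M.act_comm

/-- The action of a linear form `l` by `m ↦ ∑ l(m₋₁) m₀`. -/
def lslice : DualAlg k A →ₗ[k] Module.End k M where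
  toFun l := (TensorProduct.lid k M).toLinearMap ∘ₗ (DualAlg.lin l).rTensor M ∘ₗ M.lcoact
  map_add' l l' := by simp [LinearMap.rTensor_add, LinearMap.add_comp, LinearMap.comp_add]
  map_smul' r l := by simp [LinearMap.rTensor_smul, LinearMap.smul_comp, LinearMap.comp_smul]

/-- The action of a linear form `l` by `m ↦ ∑ m₀ l(m₁)`. -/
def rslice : DualAlg k A →ₗ[k] Module.End k M where
  toFun l := (TensorProduct.rid k M).toLinearMap ∘ₗ (DualAlg.lin l).lTensor M ∘ₗ M.rcoact
  map_add' l l' := by simp [LinearMap.lTensor_add, LinearMap.add_comp, LinearMap.comp_add]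
  map_smul' r l := by simp [LinearMap.lTensor_smul, LinearMap.smul_comp, LinearMap.comp_smul]

lemma lslice_mul (l l' : DualAlg k A) : M.lslice (l * l') = M.lslice l' * M.lslice l := by
  have h := M.lcoact_coassoc
  refine LinearMap.ext fun m => ?_
  have hm := congr((TensorProduct.lid k M) ((DualAlg.lin l').rTensor M ((TensorProduct.lid k _)
    ((DualAlg.lin l).rTensor (A ⊗[k] M) ($h m)))))
  simp only [LinearMap.comp_apply] at hm
  refine Eq.trans ?_ (hm.trans ?_)
  · change TensorProduct.lid k M ((DualAlg.lin (l * l')).rTensor M (M.lcoact m)) = _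
    generalize M.lcoact m = x
    induction x with
    | zero => simp only [LinearMap.map_zero, LinearEquiv.map_zero, TensorProduct.zero_tmul, TensorProduct.tmul_zero]
    | add x y hx hy => simp only [LinearMap.map_add, LinearEquiv.map_add, hx, hy]
    | tmul a m =>
      simp only [LinearMap.rTensor_tmul, DualAlg.mul_apply]
      generalize comul (R := k) a = y
      induction y with
      | zero => simp only [LinearMap.map_zero, LinearEquiv.map_zero, TensorProduct.zero_tmul, TensorProduct.tmul_zero]
      | add x y hx hy => simp only [LinearMap.map_add, LinearEquiv.map_add, TensorProduct.add_tmul, hx, hy]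
      | tmul a b => simp [mul_smul]
  · rw [Module.End.mul_apply]
    change _ = TensorProduct.lid k M ((DualAlg.lin l').rTensor M (M.lcoact
      (TensorProduct.lid k M ((DualAlg.lin l).rTensor M (M.lcoact m)))))
    generalize M.lcoact m = x
    induction x with
    | zero => simp only [LinearMap.map_zero, LinearEquiv.map_zero, TensorProduct.zero_tmul, TensorProduct.tmul_zero]
    | add x y hx hy => simp only [LinearMap.map_add, LinearEquiv.map_add, hx, hy]
    | tmul a m => simp

lemma rslice_mul (l l' : DualAlg k A) : M.rslice (l * l') = M.rslice l * M.rslice l' := by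
  have h := M.rcoact_coassoc
  refine LinearMap.ext fun m => ?_
  have hm := congr((TensorProduct.rid k M) ((DualAlg.lin l).lTensor M
    ((TensorProduct.rid k _).toLinearMap.lTensor M
      (((DualAlg.lin l').lTensor A).lTensor M ($h m)))))
  simp only [LinearMap.comp_apply] at hm
  refine Eq.trans ?_ (hm.symm.trans ?_)
  · change TensorProduct.rid k M ((DualAlg.lin (l * l')).lTensor M (M.rcoact m)) = _
    generalize M.rcoact m = x
    induction x with
    | zero => simp only [LinearMap.map_zero, LinearEquiv.map_zero, TensorProduct.zero_tmul, TensorProduct.tmul_zero]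
    | add x y hx hy => simp only [LinearMap.map_add, LinearEquiv.map_add, hx, hy]
    | tmul m a =>
      simp only [LinearMap.lTensor_tmul, DualAlg.mul_apply]
      generalize comul (R := k) a = y
      induction y with
      | zero => simp only [LinearMap.map_zero, LinearEquiv.map_zero, TensorProduct.zero_tmul, TensorProduct.tmul_zero]
      | add x y hx hy => simp only [LinearMap.map_add, LinearEquiv.map_add, TensorProduct.tmul_add, hx, hy]
      | tmul a b => simp [mul_comm]
  · rw [Module.End.mul_apply]
    change _ = TensorProduct.rid k M ((DualAlg.lin l).lTensor M (M.rcoact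
      (TensorProduct.rid k M ((DualAlg.lin l').lTensor M (M.rcoact m)))))
    generalize M.rcoact m = x
    induction x with
    | zero => simp only [LinearMap.map_zero, LinearEquiv.map_zero, TensorProduct.zero_tmul, TensorProduct.tmul_zero]
    | add x y hx hy => simp only [LinearMap.map_add, LinearEquiv.map_add, hx, hy]
    | tmul m a =>
      simp only [LinearMap.rTensor_tmul, LinearMap.lTensor_tmul, TensorProduct.rid_tmul, map_smul]
      generalize M.rcoact m = y
      induction y with
      | zero => simp
      | add x y hx hy => simp only [LinearMap.map_add, LinearEquiv.map_add, TensorProduct.add_tmul, hx, hy, smul_add]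
      | tmul a b => simp [smul_smul, mul_comm]

lemma lslice_one : M.lslice 1 = 1 := M.lcoact_counit

lemma rslice_one : M.rslice 1 = 1 := M.rcoact_counit

lemma commute_slice (l l' : DualAlg k A) : Commute (M.lslice l) (M.rslice l') := by
  have h := M.coact_comm
  refine LinearMap.ext fun m => ?_
  have hm := congr((TensorProduct.rid k M) ((DualAlg.lin l').lTensor M
    ((TensorProduct.lid k _) ((DualAlg.lin l).rTensor _ ($h m)))))
  simp only [LinearMap.comp_apply] at hm
  refine Eq.trans ?_ (hm.trans ?_)
  · rw [Module.End.mul_apply]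
    change TensorProduct.lid k M ((DualAlg.lin l).rTensor M (M.lcoact
      (TensorProduct.rid k M ((DualAlg.lin l').lTensor M (M.rcoact m))))) = _
    generalize M.rcoact m = x
    induction x with
    | zero => simp only [LinearMap.map_zero, LinearEquiv.map_zero, TensorProduct.zero_tmul, TensorProduct.tmul_zero]
    | add x y hx hy => simp only [LinearMap.map_add, LinearEquiv.map_add, hx, hy]
    | tmul m a =>
      simp only [LinearMap.rTensor_tmul, LinearMap.lTensor_tmul, TensorProduct.rid_tmul, map_smul]
      generalize M.lcoact m = y
      induction y with
      | zero => simp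
      | add x y hx hy => simp only [LinearMap.map_add, LinearEquiv.map_add, TensorProduct.add_tmul, hx, hy, smul_add]
      | tmul a b => simp [smul_smul, mul_comm]
  · rw [Module.End.mul_apply]
    change _ = TensorProduct.rid k M ((DualAlg.lin l').lTensor M (M.rcoact
      (TensorProduct.lid k M ((DualAlg.lin l).rTensor M (M.lcoact m)))))
    generalize M.lcoact m = x
    induction x with
    | zero => simp only [LinearMap.map_zero, LinearEquiv.map_zero, TensorProduct.zero_tmul, TensorProduct.tmul_zero]
    | add x y hx hy => simp only [LinearMap.map_add, LinearEquiv.map_add, hx, hy]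
    | tmul a m => simp

/-- The action of `A^{*op} ⊗ A^*` on a bicomodule,
`(l ⊗ l') m = ∑ l(m₋₁) l'(m₁) m₀`. -/
def dualActHB : PAlg k A →ₐ[k] Module.End k M :=
  (Algebra.TensorProduct.lift
    (.ofLinearMap (M.lslice ∘ₗ (MulOpposite.opLinearEquiv k).symm.toLinearMap) M.lslice_one
      fun l l' => M.lslice_mul l'.unop l.unop)
    (.ofLinearMap M.rslice M.rslice_one M.rslice_mul)
    fun l l' => M.commute_slice l.unop l').comp (PAlg.of k A).symm.toAlgHom

lemma dualActHB_tmul (l l' : DualAlg k A) :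
    M.dualActHB (PAlg.tmul l l') = M.lslice l * M.rslice l' := by
  exact Algebra.TensorProduct.lift_tmul _ _ (fun l l' => M.commute_slice l.unop l') (MulOpposite.op l) l'

end HopfBimod
end
end GS

namespace GS

open HopfAlgebra WithConv

namespace HopfBimod

variable {k A : Type u} [Field k] [Ring A] [HopfAlgebra k A] (M : HopfBimod k A)

lemma lcoact_envAct (h : A ⊗[k] Aᵐᵒᵖ) :
    M.lcoact ∘ₗ M.envAct h = diag (regAct k A) M.envAct h ∘ₗ M.lcoact := by
  induction h with
  | zero => simp
  | add x y hx hy => simp only [map_add, LinearMap.add_comp, LinearMap.comp_add, hx, hy]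
  | tmul a b =>
    rw [regAct, envAct, diag_biAct, biAct_tmul, Module.End.mul_eq_comp, Module.End.mul_eq_comp,
      ← LinearMap.comp_assoc, M.lcoact_lact, LinearMap.comp_assoc, M.lcoact_ract,
      LinearMap.comp_assoc]

lemma rcoact_envAct (h : A ⊗[k] Aᵐᵒᵖ) :
    M.rcoact ∘ₗ M.envAct h = diag M.envAct (regAct k A) h ∘ₗ M.rcoact := by
  induction h with
  | zero => simp
  | add x y hx hy => simp only [map_add, LinearMap.add_comp, LinearMap.comp_add, hx, hy]
  | tmul a b =>
    rw [regAct, envAct, diag_biAct, biAct_tmul, Module.End.mul_eq_comp, Module.End.mul_eq_comp,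
      ← LinearMap.comp_assoc, M.rcoact_lact, LinearMap.comp_assoc, M.rcoact_ract,
      LinearMap.comp_assoc]

variable [FiniteDimensional k A]

lemma straightL_lslice : StraightL (regAct k A) M.lslice M.envAct.toLinearMap := by
  intro h l
  let Ψ : Module.End k (A ⊗[k] M) →ₗ[k] Module.End k M :=
    { toFun := fun f => (TensorProduct.lid k M).toLinearMap ∘ₗ (DualAlg.lin l).rTensor M ∘ₗ f ∘ₗ
        M.lcoact
      map_add' := fun f g => by simp [LinearMap.add_comp, LinearMap.comp_add]
      map_smul' := fun f g => by simp [LinearMap.smul_comp, LinearMap.comp_smul] }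
  let P : A ⊗[k] Aᵐᵒᵖ →ₐ[k] Module.End k (A ⊗[k] M) :=
    (Module.End.rTensorAlgHom k A M).comp (regAct k A)
  let Q : A ⊗[k] Aᵐᵒᵖ →ₐ[k] Module.End k (A ⊗[k] M) :=
    (Module.End.lTensorAlgHom k M A).comp M.envAct
  have hPQ : toConv (diag (regAct k A) M.envAct).toLinearMap =
      toConv P.toLinearMap * toConv Q.toLinearMap := by
    refine WithConv.ext (LinearMap.ext fun x => ?_)
    rw [(ℛ k x).convMul_apply]
    change diag (regAct k A) M.envAct x = _
    rw [diag_apply _ _ (ℛ k x)]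
    refine Finset.sum_congr rfl fun i _ => TensorProduct.ext' fun a m => ?_
    rfl
  have hQ : toConv Q.toLinearMap = toConv (P.toLinearMap ∘ₗ antipode k) *
      toConv (diag (regAct k A) M.envAct).toLinearMap := by
    have h3 := algHom_comp_antipode_convMul (k := k) (A := A ⊗[k] Aᵐᵒᵖ)
      (E := Module.End k (A ⊗[k] M)) P
    rw [hPQ, ← mul_assoc]
    exact (congr($h3 * toConv Q.toLinearMap).trans (one_mul _)).symm
  have h1 : M.envAct h * M.lslice l = Ψ (Q h) := by
    refine LinearMap.ext fun m => ?_
    change M.envAct h (TensorProduct.lid k M ((DualAlg.lin l).rTensor M (M.lcoact m))) =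
      TensorProduct.lid k M ((DualAlg.lin l).rTensor M ((M.envAct h).lTensor A (M.lcoact m)))
    generalize M.lcoact m = x
    induction x with
    | zero => simp
    | add x y hx hy => simp only [map_add, hx, hy]
    | tmul a m => simp
  have h2 := congr($hQ h)
  rw [(ℛ k h).convMul_apply] at h2
  change Q h = _ at h2
  change M.envAct h * M.lslice l = _
  rw [h1, h2, map_sum]
  refine Finset.sum_congr rfl fun i _ => ?_
  change (TensorProduct.lid k M).toLinearMap ∘ₗ (DualAlg.lin l).rTensor M ∘ₗ
    (P (antipode k ((ℛ k h).left i)) ∘ₗ diag (regAct k A) M.envAct ((ℛ k h).right i)) ∘ₗ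
    M.lcoact = _
  rw [LinearMap.comp_assoc, ← lcoact_envAct]
  refine LinearMap.ext fun m => ?_
  change TensorProduct.lid k M ((DualAlg.lin l).rTensor M
    ((regAct k A (antipode k ((ℛ k h).left i))).rTensor M (M.lcoact
    (M.envAct ((ℛ k h).right i) m)))) = TensorProduct.lid k M ((DualAlg.lin
    (dualAct (regAct k A) (antipodeAlgHomOp k _) ((ℛ k h).left i) l)).rTensor M (M.lcoact
    (M.envAct ((ℛ k h).right i) m)))
  rw [← LinearMap.comp_apply (LinearMap.rTensor _ _), ← LinearMap.rTensor_comp]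
  rfl

lemma op_antipodeInv_conv {H E : Type*} [Ring H] [HopfAlgebra k H] [FiniteDimensional k H]
    [Ring E] [Algebra k E] (φ : H →ₐ[k] E) :
    toConv (opl k E ∘ₗ φ.toLinearMap) * toConv (opl k E ∘ₗ φ.toLinearMap ∘ₗ antipodeInv k H) =
      1 := by
  let g : H →ₐ[k] Eᵐᵒᵖ := (AlgHom.op φ).comp (antipodeInvAlgHomOp k H)
  have h := algHom_comp_antipode_convMul (k := k) g
  refine Eq.trans ?_ h
  congr 1
  refine WithConv.ext (LinearMap.ext fun x => ?_)
  simp [g, antipodeInvAlgHomOp]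

lemma straightR_rslice : StraightR (regAct k A) M.rslice M.envAct.toLinearMap := by
  intro h l
  let Ψ : Module.End k (M ⊗[k] A) →ₗ[k] Module.End k M :=
    { toFun := fun f => (TensorProduct.rid k M).toLinearMap ∘ₗ (DualAlg.lin l).lTensor M ∘ₗ f ∘ₗ
        M.rcoact
      map_add' := fun f g => by simp [LinearMap.add_comp, LinearMap.comp_add]
      map_smul' := fun f g => by simp [LinearMap.smul_comp, LinearMap.comp_smul] }
  let P : A ⊗[k] Aᵐᵒᵖ →ₐ[k] Module.End k (M ⊗[k] A) :=
    (Module.End.lTensorAlgHom k A M).comp (regAct k A)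
  let Q : A ⊗[k] Aᵐᵒᵖ →ₐ[k] Module.End k (M ⊗[k] A) :=
    (Module.End.rTensorAlgHom k M A).comp M.envAct
  have hPQ : toConv (opl k _ ∘ₗ (diag M.envAct (regAct k A)).toLinearMap) =
      toConv (opl k _ ∘ₗ Q.toLinearMap) * toConv (opl k _ ∘ₗ P.toLinearMap) := by
    refine WithConv.ext (LinearMap.ext fun x => ?_)
    rw [(ℛ k x).convMul_apply]
    apply MulOpposite.unop_injective
    change diag M.envAct (regAct k A) x = _
    rw [diag_apply _ _ (ℛ k x)]
    simp only [Finset.unop_sum]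
    refine Finset.sum_congr rfl fun i _ => TensorProduct.ext' fun a m => ?_
    rfl
  have hQ : toConv (opl k _ ∘ₗ Q.toLinearMap) =
      toConv (opl k _ ∘ₗ (diag M.envAct (regAct k A)).toLinearMap) *
        toConv (opl k _ ∘ₗ P.toLinearMap ∘ₗ antipodeInv k _) := by
    have h3 := op_antipodeInv_conv (k := k) P
    rw [hPQ, mul_assoc]
    exact (congr(toConv (opl k _ ∘ₗ Q.toLinearMap) * $h3).trans (mul_one _)).symm
  have h1 : M.envAct h * M.rslice l = Ψ (Q h) := by
    refine LinearMap.ext fun m => ?_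
    change M.envAct h (TensorProduct.rid k M ((DualAlg.lin l).lTensor M (M.rcoact m))) =
      TensorProduct.rid k M ((DualAlg.lin l).lTensor M ((M.envAct h).rTensor A (M.rcoact m)))
    generalize M.rcoact m = x
    induction x with
    | zero => simp
    | add x y hx hy => simp only [map_add, hx, hy]
    | tmul a m => simp
  have h2 := congr(MulOpposite.unop ($hQ h))
  rw [(ℛ k h).convMul_apply, Finset.unop_sum] at h2
  change Q h = _ at h2
  change M.envAct h * M.rslice l = _
  rw [h1, h2, map_sum]
  refine Finset.sum_congr rfl fun i _ => ?_
  change (TensorProduct.rid k M).toLinearMap ∘ₗ (DualAlg.lin l).lTensor M ∘ₗ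
    (P (antipodeInv k _ ((ℛ k h).right i)) ∘ₗ diag M.envAct (regAct k A) ((ℛ k h).left i)) ∘ₗ
    M.rcoact = _
  rw [LinearMap.comp_assoc, ← rcoact_envAct]
  refine LinearMap.ext fun m => ?_
  change TensorProduct.rid k M ((DualAlg.lin l).lTensor M
    ((regAct k A (antipodeInv k _ ((ℛ k h).right i))).lTensor M (M.rcoact
    (M.envAct ((ℛ k h).left i) m)))) = TensorProduct.rid k M ((DualAlg.lin
    (dualAct (regAct k A) (antipodeInvAlgHomOp k _) ((ℛ k h).right i) l)).lTensor M (M.rcoact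
    (M.envAct ((ℛ k h).left i) m)))
  rw [← LinearMap.comp_apply (LinearMap.lTensor _ _), ← LinearMap.lTensor_comp]
  rfl

/-- The linear map underlying the action of `X`. -/
def xActLin : PAlg k A ⊗[k] (A ⊗[k] Aᵐᵒᵖ) →ₗ[k] Module.End k M :=
  TensorProduct.lift ((LinearMap.mul k (Module.End k M)).compl₁₂
    M.dualActHB.toLinearMap M.envAct.toLinearMap)

@[simp] lemma xActLin_tmul (p : PAlg k A) (h : A ⊗[k] Aᵐᵒᵖ) :
    M.xActLin (p ⊗ₜ h) = M.dualActHB p * M.envAct h := rfl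

lemma xActLin_opP (p : PAlg k A) (x : PAlg k A ⊗[k] (A ⊗[k] Aᵐᵒᵖ)) :
    M.xActLin (opP k _ A p x) = M.dualActHB p * M.xActLin x := by
  induction x with
  | zero => simp
  | add x y hx hy => simp only [map_add, hx, hy, mul_add]
  | tmul p' h => simp [mul_assoc]

lemma xActLin_opT (h : A ⊗[k] Aᵐᵒᵖ) (x : PAlg k A ⊗[k] (A ⊗[k] Aᵐᵒᵖ)) :
    M.xActLin (opT (regAct k A) h x) = M.envAct h * M.xActLin x :=
  have hact := regAct_isModuleCoalgebra k A
  opT_intertwine _ M.xActLin M.lslice M.rslice M.envAct.toLinearMap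
    (straightL_opT _ hact) (straightR_opT _ hact) (opT_one_tmul _ hact.counit)
    (fun l x => by rw [opF_apply, xActLin_opP, dualActHB_tmul, rslice_one, mul_one])
    (fun l x => by rw [opG_apply, xActLin_opP, dualActHB_tmul, lslice_one, one_mul])
    M.straightL_lslice M.straightR_rslice (fun h h' => by simp) h x

lemma xActLin_mul (x y : PAlg k A ⊗[k] (A ⊗[k] Aᵐᵒᵖ)) :
    M.xActLin (crossedMul (regAct k A) x y) = M.xActLin x * M.xActLin y := by
  induction x with
  | zero => simp
  | add x x' hx hx' => simp only [map_add, LinearMap.add_apply, hx, hx', add_mul]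
  | tmul p h =>
    rw [crossedMul_tmul, Module.End.mul_apply, xActLin_opP, xActLin_opT, xActLin_tmul, mul_assoc]

/-- The action of `X` on a Hopf bimodule, `[(l ⊗ l') ⊗ (a ⊗ b)] m = (l ⊗ l') (a m b)`, that is
`∑ l(a⁽¹⁾ m₋₁ b⁽¹⁾) l'(a⁽³⁾ m₁ b⁽³⁾) a⁽²⁾ m₀ b⁽²⁾`. -/
def xAct : XAlg k A →ₐ[k] Module.End k M :=
  .ofLinearMap (M.xActLin ∘ₗ (Crossed.of (regAct_isModuleCoalgebra k A)).symm.toLinearMap)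
    (by
      change M.xActLin (1 ⊗ₜ 1) = 1
      simp)
    (fun x y => M.xActLin_mul x y)

lemma xAct_tmul (l l' : DualAlg k A) (a b : A) (m : M) :
    M.xAct (Crossed.of (regAct_isModuleCoalgebra k A)
      (PAlg.tmul l l' ⊗ₜ (a ⊗ₜ MulOpposite.op b))) m =
      M.lslice l (M.rslice l' (M.lact a (M.ract (MulOpposite.op b) m))) := by
  change M.xActLin (PAlg.tmul l l' ⊗ₜ (a ⊗ₜ MulOpposite.op b)) m = _
  rw [xActLin_tmul, dualActHB_tmul, envAct, biAct_tmul]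
  rfl

/-- A Hopf bimodule as an `X`-module. -/
def toX : ModuleCat.{u} (XAlg k A) :=
  letI : Module (XAlg k A) M := Module.compHom M.carrier M.xAct.toRingHom
  ModuleCat.of (XAlg k A) M

end HopfBimod
end GS

namespace GS

open HopfAlgebra WithConv

section Mux

variable {k A : Type*} [Field k] [Ring A] [HopfAlgebra k A]

section

variable {V W : Type*} [AddCommGroup V] [Module k V] [AddCommGroup W] [Module k W]

variable (k A V W) in
/-- `(a ⊗ v) ⊗ (b ⊗ w) ↦ a b ⊗ (v ⊗ w)`. -/
def muxL : (A ⊗[k] V) ⊗[k] (A ⊗[k] W) →ₗ[k] A ⊗[k] (V ⊗[k] W) :=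
  (LinearMap.mul' k A).rTensor (V ⊗[k] W) ∘ₗ
    (TensorProduct.tensorTensorTensorComm k A V A W).toLinearMap

variable (k A V W) in
/-- `(v ⊗ a) ⊗ (w ⊗ b) ↦ (v ⊗ w) ⊗ a b`. -/
def muxR : (V ⊗[k] A) ⊗[k] (W ⊗[k] A) →ₗ[k] (V ⊗[k] W) ⊗[k] A :=
  (LinearMap.mul' k A).lTensor (V ⊗[k] W) ∘ₗ
    (TensorProduct.tensorTensorTensorComm k V A W A).toLinearMap

@[simp] lemma muxL_tmul (a b : A) (v : V) (w : W) :
    muxL k A V W ((a ⊗ₜ v) ⊗ₜ (b ⊗ₜ w)) = (a * b) ⊗ₜ (v ⊗ₜ w) := rfl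

@[simp] lemma muxR_tmul (a b : A) (v : V) (w : W) :
    muxR k A V W ((v ⊗ₜ a) ⊗ₜ (w ⊗ₜ b)) = (v ⊗ₜ w) ⊗ₜ (a * b) := rfl

end

/-- Two linear maps on `(V₁ ⊗ V₂) ⊗ (W₁ ⊗ W₂)` agreeing on pure tensors are equal. -/
lemma ext4 {V₁ V₂ W₁ W₂ Z : Type*} [AddCommGroup V₁] [Module k V₁] [AddCommGroup V₂] [Module k V₂]
    [AddCommGroup W₁] [Module k W₁] [AddCommGroup W₂] [Module k W₂] [AddCommGroup Z] [Module k Z]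
    {f g : (V₁ ⊗[k] V₂) ⊗[k] (W₁ ⊗[k] W₂) →ₗ[k] Z}
    (h : ∀ a v b w, f ((a ⊗ₜ v) ⊗ₜ (b ⊗ₜ w)) = g ((a ⊗ₜ v) ⊗ₜ (b ⊗ₜ w))) : f = g := by
  refine TensorProduct.ext' fun x y => ?_
  induction x with
  | zero => simp only [LinearMap.map_zero, LinearEquiv.map_zero, TensorProduct.zero_tmul, TensorProduct.tmul_zero]
  | add x x' hx hx' => simp only [TensorProduct.add_tmul, LinearMap.map_add, LinearEquiv.map_add, hx, hx']
  | tmul a v =>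
    induction y with
    | zero => simp only [LinearMap.map_zero, LinearEquiv.map_zero, TensorProduct.zero_tmul, TensorProduct.tmul_zero]
    | add y y' hy hy' => simp only [TensorProduct.tmul_add, LinearMap.map_add, LinearEquiv.map_add, hy, hy']
    | tmul b w => exact h a v b w

variable {V W : Type*} [AddCommGroup V] [Module k V] [AddCommGroup W] [Module k W]
  (lV : V →ₗ[k] A ⊗[k] V) (lW : W →ₗ[k] A ⊗[k] W) (rV : V →ₗ[k] V ⊗[k] A) (rW : W →ₗ[k] W ⊗[k] A)

/-- The codiagonal left coaction `v ⊗ w ↦ ∑ v₋₁ w₋₁ ⊗ (v₀ ⊗ w₀)`. -/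
def codiagL : V ⊗[k] W →ₗ[k] A ⊗[k] (V ⊗[k] W) := muxL k A V W ∘ₗ TensorProduct.map lV lW

/-- The codiagonal right coaction `v ⊗ w ↦ ∑ (v₀ ⊗ w₀) ⊗ v₁ w₁`. -/
def codiagR : V ⊗[k] W →ₗ[k] (V ⊗[k] W) ⊗[k] A := muxR k A V W ∘ₗ TensorProduct.map rV rW

variable {lV lW rV rW}

lemma codiagL_coassoc
    (hV : TensorProduct.assoc k A A V ∘ₗ comul.rTensor V ∘ₗ lV = lV.lTensor A ∘ₗ lV)
    (hW : TensorProduct.assoc k A A W ∘ₗ comul.rTensor W ∘ₗ lW = lW.lTensor A ∘ₗ lW) :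
    TensorProduct.assoc k A A (V ⊗[k] W) ∘ₗ comul.rTensor (V ⊗[k] W) ∘ₗ codiagL lV lW =
      (codiagL lV lW).lTensor A ∘ₗ codiagL lV lW := by
  have h1 : (TensorProduct.assoc k A A (V ⊗[k] W)).toLinearMap ∘ₗ comul.rTensor (V ⊗[k] W) ∘ₗ
      muxL k A V W = (muxL k A V W).lTensor A ∘ₗ muxL k A (A ⊗[k] V) (A ⊗[k] W) ∘ₗ
        TensorProduct.map (TensorProduct.assoc k A A V ∘ₗ comul.rTensor V)
          (TensorProduct.assoc k A A W ∘ₗ comul.rTensor W) := by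
    refine ext4 fun a v b w => ?_
    simp only [LinearMap.comp_apply, muxL_tmul, LinearMap.rTensor_tmul, Bialgebra.comul_mul,
      TensorProduct.map_tmul]
    generalize comul (R := k) a = x
    generalize comul (R := k) b = y
    induction x with
    | zero => simp
    | add x x' hx hx' => simp only [TensorProduct.add_tmul, add_mul, LinearMap.map_add, LinearEquiv.map_add, hx, hx']
    | tmul a a' =>
      induction y with
      | zero => simp
      | add y y' hy hy' =>
        simp only [TensorProduct.add_tmul, TensorProduct.tmul_add, mul_add, LinearMap.map_add, LinearEquiv.map_add, hy, hy']
      | tmul b b' => simp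
  have h2 : (codiagL lV lW).lTensor A ∘ₗ muxL k A V W =
      (muxL k A V W).lTensor A ∘ₗ muxL k A (A ⊗[k] V) (A ⊗[k] W) ∘ₗ
        TensorProduct.map (lV.lTensor A) (lW.lTensor A) := by
    refine ext4 fun a v b w => ?_
    simp [codiagL]
  calc _ = ((TensorProduct.assoc k A A (V ⊗[k] W)).toLinearMap ∘ₗ comul.rTensor (V ⊗[k] W) ∘ₗ
      muxL k A V W) ∘ₗ TensorProduct.map lV lW := rfl
    _ = ((muxL k A V W).lTensor A ∘ₗ muxL k A (A ⊗[k] V) (A ⊗[k] W)) ∘ₗ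
        (TensorProduct.map (TensorProduct.assoc k A A V ∘ₗ comul.rTensor V)
          (TensorProduct.assoc k A A W ∘ₗ comul.rTensor W) ∘ₗ TensorProduct.map lV lW) := by
        rw [h1]; rfl
    _ = ((muxL k A V W).lTensor A ∘ₗ muxL k A (A ⊗[k] V) (A ⊗[k] W)) ∘ₗ
        (TensorProduct.map (lV.lTensor A) (lW.lTensor A) ∘ₗ TensorProduct.map lV lW) := by
        rw [← TensorProduct.map_comp, ← TensorProduct.map_comp]
        exact congr(_ ∘ₗ TensorProduct.map $hV $hW)
    _ = ((codiagL lV lW).lTensor A ∘ₗ muxL k A V W) ∘ₗ TensorProduct.map lV lW := by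
        rw [h2]; rfl
    _ = _ := rfl

lemma codiagR_coassoc
    (hV : TensorProduct.assoc k V A A ∘ₗ rV.rTensor A ∘ₗ rV = comul.lTensor V ∘ₗ rV)
    (hW : TensorProduct.assoc k W A A ∘ₗ rW.rTensor A ∘ₗ rW = comul.lTensor W ∘ₗ rW) :
    TensorProduct.assoc k (V ⊗[k] W) A A ∘ₗ (codiagR rV rW).rTensor A ∘ₗ codiagR rV rW =
      comul.lTensor (V ⊗[k] W) ∘ₗ codiagR rV rW := by
  let T : (V ⊗[k] (A ⊗[k] A)) ⊗[k] (W ⊗[k] (A ⊗[k] A)) →ₗ[k] (V ⊗[k] W) ⊗[k] (A ⊗[k] A) :=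
    muxR k (A ⊗[k] A) V W
  have h1 : comul.lTensor (V ⊗[k] W) ∘ₗ muxR k A V W =
      T ∘ₗ TensorProduct.map (comul.lTensor V) (comul.lTensor W) := by
    refine ext4 fun v a w b => ?_
    simp [T, Bialgebra.comul_mul]
  have h2 : (TensorProduct.assoc k (V ⊗[k] W) A A).toLinearMap ∘ₗ (codiagR rV rW).rTensor A ∘ₗ
      muxR k A V W = T ∘ₗ TensorProduct.map (TensorProduct.assoc k V A A ∘ₗ rV.rTensor A)
          (TensorProduct.assoc k W A A ∘ₗ rW.rTensor A) := by
    refine ext4 fun v a w b => ?_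
    simp only [LinearMap.comp_apply, muxR_tmul, LinearMap.rTensor_tmul, TensorProduct.map_tmul,
      codiagR]
    generalize rV v = x
    generalize rW w = y
    induction x with
    | zero => simp only [LinearMap.map_zero, LinearEquiv.map_zero, TensorProduct.zero_tmul, TensorProduct.tmul_zero]
    | add x x' hx hx' => simp only [TensorProduct.add_tmul, LinearMap.map_add, LinearEquiv.map_add, hx, hx']
    | tmul v a' =>
      induction y with
      | zero => simp only [LinearMap.map_zero, LinearEquiv.map_zero, TensorProduct.zero_tmul, TensorProduct.tmul_zero]
      | add y y' hy hy' =>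
        simp only [TensorProduct.add_tmul, TensorProduct.tmul_add, LinearMap.map_add, LinearEquiv.map_add, hy, hy']
      | tmul w b' => simp [T]
  calc _ = ((TensorProduct.assoc k (V ⊗[k] W) A A).toLinearMap ∘ₗ (codiagR rV rW).rTensor A ∘ₗ
      muxR k A V W) ∘ₗ TensorProduct.map rV rW := rfl
    _ = T ∘ₗ (TensorProduct.map (TensorProduct.assoc k V A A ∘ₗ rV.rTensor A)
          (TensorProduct.assoc k W A A ∘ₗ rW.rTensor A) ∘ₗ TensorProduct.map rV rW) := by
        rw [h2]; rfl
    _ = T ∘ₗ (TensorProduct.map (comul.lTensor V) (comul.lTensor W) ∘ₗ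
          TensorProduct.map rV rW) := by
        rw [← TensorProduct.map_comp, ← TensorProduct.map_comp]
        exact congr(_ ∘ₗ TensorProduct.map $hV $hW)
    _ = (comul.lTensor (V ⊗[k] W) ∘ₗ muxR k A V W) ∘ₗ TensorProduct.map rV rW := by
        rw [h1]; rfl
    _ = _ := rfl

lemma codiagL_counit (hV : TensorProduct.lid k V ∘ₗ counit.rTensor V ∘ₗ lV = LinearMap.id)
    (hW : TensorProduct.lid k W ∘ₗ counit.rTensor W ∘ₗ lW = LinearMap.id) :
    TensorProduct.lid k (V ⊗[k] W) ∘ₗ counit.rTensor (V ⊗[k] W) ∘ₗ codiagL lV lW =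
      LinearMap.id := by
  have h1 : (TensorProduct.lid k (V ⊗[k] W)).toLinearMap ∘ₗ counit.rTensor (V ⊗[k] W) ∘ₗ
      muxL k A V W = TensorProduct.map (TensorProduct.lid k V ∘ₗ counit.rTensor V)
        (TensorProduct.lid k W ∘ₗ counit.rTensor W) := by
    refine ext4 fun a v b w => ?_
    simp [TensorProduct.smul_tmul', smul_smul, mul_comm]
  calc _ = ((TensorProduct.lid k (V ⊗[k] W)).toLinearMap ∘ₗ counit.rTensor (V ⊗[k] W) ∘ₗ
      muxL k A V W) ∘ₗ TensorProduct.map lV lW := rfl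
    _ = LinearMap.id := by
      rw [h1, ← TensorProduct.map_comp, LinearMap.comp_assoc, hV, LinearMap.comp_assoc, hW,
        TensorProduct.map_id]

lemma codiagR_counit (hV : TensorProduct.rid k V ∘ₗ counit.lTensor V ∘ₗ rV = LinearMap.id)
    (hW : TensorProduct.rid k W ∘ₗ counit.lTensor W ∘ₗ rW = LinearMap.id) :
    TensorProduct.rid k (V ⊗[k] W) ∘ₗ counit.lTensor (V ⊗[k] W) ∘ₗ codiagR rV rW =
      LinearMap.id := by
  have h1 : (TensorProduct.rid k (V ⊗[k] W)).toLinearMap ∘ₗ counit.lTensor (V ⊗[k] W) ∘ₗ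
      muxR k A V W = TensorProduct.map (TensorProduct.rid k V ∘ₗ counit.lTensor V)
        (TensorProduct.rid k W ∘ₗ counit.lTensor W) := by
    refine ext4 fun a v b w => ?_
    simp [TensorProduct.smul_tmul', smul_smul, mul_comm]
  calc _ = ((TensorProduct.rid k (V ⊗[k] W)).toLinearMap ∘ₗ counit.lTensor (V ⊗[k] W) ∘ₗ
      muxR k A V W) ∘ₗ TensorProduct.map rV rW := rfl
    _ = LinearMap.id := by
      rw [h1, ← TensorProduct.map_comp, LinearMap.comp_assoc, hV, LinearMap.comp_assoc, hW,
        TensorProduct.map_id]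

lemma codiag_comm
    (hV : TensorProduct.assoc k A V A ∘ₗ lV.rTensor A ∘ₗ rV = rV.lTensor A ∘ₗ lV)
    (hW : TensorProduct.assoc k A W A ∘ₗ lW.rTensor A ∘ₗ rW = rW.lTensor A ∘ₗ lW) :
    TensorProduct.assoc k A (V ⊗[k] W) A ∘ₗ (codiagL lV lW).rTensor A ∘ₗ codiagR rV rW =
      (codiagR rV rW).lTensor A ∘ₗ codiagL lV lW := by
  let T := (muxR k A V W).lTensor A ∘ₗ muxL k A (V ⊗[k] A) (W ⊗[k] A)
  have h1 : (TensorProduct.assoc k A (V ⊗[k] W) A).toLinearMap ∘ₗ (codiagL lV lW).rTensor A ∘ₗ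
      muxR k A V W = T ∘ₗ TensorProduct.map (TensorProduct.assoc k A V A ∘ₗ lV.rTensor A)
          (TensorProduct.assoc k A W A ∘ₗ lW.rTensor A) := by
    refine ext4 fun v a w b => ?_
    simp only [LinearMap.comp_apply, muxR_tmul, LinearMap.rTensor_tmul, TensorProduct.map_tmul,
      codiagL]
    generalize lV v = x
    generalize lW w = y
    induction x with
    | zero => simp only [LinearMap.map_zero, LinearEquiv.map_zero, TensorProduct.zero_tmul, TensorProduct.tmul_zero]
    | add x x' hx hx' => simp only [TensorProduct.add_tmul, LinearMap.map_add, LinearEquiv.map_add, hx, hx']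
    | tmul a' v =>
      induction y with
      | zero => simp only [LinearMap.map_zero, LinearEquiv.map_zero, TensorProduct.zero_tmul, TensorProduct.tmul_zero]
      | add y y' hy hy' =>
        simp only [TensorProduct.add_tmul, TensorProduct.tmul_add, LinearMap.map_add, LinearEquiv.map_add, hy, hy']
      | tmul b' w => simp [T]
  have h2 : (codiagR rV rW).lTensor A ∘ₗ muxL k A V W =
      T ∘ₗ TensorProduct.map (rV.lTensor A) (rW.lTensor A) := by
    refine ext4 fun a v b w => ?_
    simp [codiagR, T]
  calc _ = ((TensorProduct.assoc k A (V ⊗[k] W) A).toLinearMap ∘ₗ (codiagL lV lW).rTensor A ∘ₗ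
      muxR k A V W) ∘ₗ TensorProduct.map rV rW := rfl
    _ = T ∘ₗ (TensorProduct.map (TensorProduct.assoc k A V A ∘ₗ lV.rTensor A)
          (TensorProduct.assoc k A W A ∘ₗ lW.rTensor A) ∘ₗ TensorProduct.map rV rW) := by
        rw [h1]; rfl
    _ = T ∘ₗ (TensorProduct.map (rV.lTensor A) (rW.lTensor A) ∘ₗ TensorProduct.map lV lW) := by
        rw [← TensorProduct.map_comp, ← TensorProduct.map_comp]
        exact congr(_ ∘ₗ TensorProduct.map $hV $hW)
    _ = ((codiagR rV rW).lTensor A ∘ₗ muxL k A V W) ∘ₗ TensorProduct.map lV lW := by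
        rw [h2]; rfl
    _ = _ := rfl

end Mux
end GS

namespace GS

open HopfAlgebra WithConv

section Mux

variable {k A : Type u} [Field k] [Ring A] [HopfAlgebra k A]

variable {B V W V' W' : Type*} [Ring B] [Bialgebra k B]
  [AddCommGroup V] [Module k V] [AddCommGroup W] [Module k W]
  [AddCommGroup V'] [Module k V'] [AddCommGroup W'] [Module k W']

/-- The action on the first tensorand. -/
def actFst (ρ : B →ₐ[k] Module.End k V) (W : Type*) [AddCommGroup W] [Module k W] :
    B →ₐ[k] Module.End k (V ⊗[k] W) := (Module.End.rTensorAlgHom k V W).comp ρ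

/-- The action on the second tensorand. -/
def actSnd (V : Type*) [AddCommGroup V] [Module k V] (σ : B →ₐ[k] Module.End k W) :
    B →ₐ[k] Module.End k (V ⊗[k] W) := (Module.End.lTensorAlgHom k W V).comp σ

@[simp] lemma actFst_tmul (ρ : B →ₐ[k] Module.End k V) (b : B) (v : V) (w : W) :
    actFst ρ W b (v ⊗ₜ w) = ρ b v ⊗ₜ w := rfl

@[simp] lemma actSnd_tmul (σ : B →ₐ[k] Module.End k W) (b : B) (v : V) (w : W) :
    actSnd V σ b (v ⊗ₜ w) = v ⊗ₜ σ b w := rfl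

lemma commute_actFst_actSnd {B' : Type*} [Ring B'] [Bialgebra k B'] (ρ : B →ₐ[k] Module.End k V)
    (σ : B' →ₐ[k] Module.End k W) (b : B) (b' : B') : Commute (actFst ρ W b) (actSnd V σ b') :=
  TensorProduct.ext' fun v w => by simp [Module.End.mul_apply]

lemma codiagL_actFst {lV : V →ₗ[k] A ⊗[k] V} (lW : W →ₗ[k] A ⊗[k] W)
    {ρ : A →ₐ[k] Module.End k V} (h : ∀ a, lV ∘ₗ ρ a = diag (lreg k A) ρ a ∘ₗ lV) (a : A) :
    codiagL lV lW ∘ₗ actFst ρ W a = diag (lreg k A) (actFst ρ W) a ∘ₗ codiagL lV lW := by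
  refine TensorProduct.ext' fun v w => ?_
  have hv := congr($(h a) v)
  simp only [LinearMap.comp_apply] at hv
  simp only [codiagL, LinearMap.comp_apply, TensorProduct.map_tmul, actFst_tmul, hv,
    diag_apply _ _ (ℛ k a), LinearMap.sum_apply, TensorProduct.sum_tmul, map_sum]
  refine Finset.sum_congr rfl fun i _ => ?_
  generalize lV v = x
  generalize lW w = y
  induction x with
  | zero => simp only [LinearMap.map_zero, LinearEquiv.map_zero, TensorProduct.zero_tmul, TensorProduct.tmul_zero]
  | add x x' hx hx' => simp only [TensorProduct.add_tmul, LinearMap.map_add, LinearEquiv.map_add, hx, hx']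
  | tmul v a' =>
    induction y with
    | zero => simp only [LinearMap.map_zero, LinearEquiv.map_zero, TensorProduct.zero_tmul, TensorProduct.tmul_zero]
    | add y y' hy hy' => simp only [TensorProduct.tmul_add, LinearMap.map_add, LinearEquiv.map_add, hy, hy']
    | tmul w b' => simp [mul_assoc]

lemma codiagL_actSnd (lV : V →ₗ[k] A ⊗[k] V) {lW : W →ₗ[k] A ⊗[k] W}
    {σ : Aᵐᵒᵖ →ₐ[k] Module.End k W} (h : ∀ b, lW ∘ₗ σ b = diag (rreg k A) σ b ∘ₗ lW) (b : Aᵐᵒᵖ) :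
    codiagL lV lW ∘ₗ actSnd V σ b = diag (rreg k A) (actSnd V σ) b ∘ₗ codiagL lV lW := by
  refine TensorProduct.ext' fun v w => ?_
  have hw := congr($(h b) w)
  simp only [LinearMap.comp_apply] at hw
  simp only [codiagL, LinearMap.comp_apply, TensorProduct.map_tmul, actSnd_tmul, hw,
    diag_apply _ _ (ℛ k b), LinearMap.sum_apply, TensorProduct.tmul_sum, map_sum]
  refine Finset.sum_congr rfl fun i _ => ?_
  generalize lV v = x
  generalize lW w = y
  induction x with
  | zero => simp only [LinearMap.map_zero, LinearEquiv.map_zero, TensorProduct.zero_tmul, TensorProduct.tmul_zero]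
  | add x x' hx hx' => simp only [TensorProduct.add_tmul, LinearMap.map_add, LinearEquiv.map_add, hx, hx']
  | tmul v a' =>
    induction y with
    | zero => simp only [LinearMap.map_zero, LinearEquiv.map_zero, TensorProduct.zero_tmul, TensorProduct.tmul_zero]
    | add y y' hy hy' => simp only [TensorProduct.tmul_add, LinearMap.map_add, LinearEquiv.map_add, hy, hy']
    | tmul w b' => simp [mul_assoc]

lemma codiagR_actFst {rV : V →ₗ[k] V ⊗[k] A} (rW : W →ₗ[k] W ⊗[k] A)
    {ρ : A →ₐ[k] Module.End k V} (h : ∀ a, rV ∘ₗ ρ a = diag ρ (lreg k A) a ∘ₗ rV) (a : A) :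
    codiagR rV rW ∘ₗ actFst ρ W a = diag (actFst ρ W) (lreg k A) a ∘ₗ codiagR rV rW := by
  refine TensorProduct.ext' fun v w => ?_
  have hv := congr($(h a) v)
  simp only [LinearMap.comp_apply] at hv
  simp only [codiagR, LinearMap.comp_apply, TensorProduct.map_tmul, actFst_tmul, hv,
    diag_apply _ _ (ℛ k a), LinearMap.sum_apply, TensorProduct.sum_tmul, map_sum]
  refine Finset.sum_congr rfl fun i _ => ?_
  generalize rV v = x
  generalize rW w = y
  induction x with
  | zero => simp only [LinearMap.map_zero, LinearEquiv.map_zero, TensorProduct.zero_tmul, TensorProduct.tmul_zero]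
  | add x x' hx hx' => simp only [TensorProduct.add_tmul, LinearMap.map_add, LinearEquiv.map_add, hx, hx']
  | tmul v a' =>
    induction y with
    | zero => simp only [LinearMap.map_zero, LinearEquiv.map_zero, TensorProduct.zero_tmul, TensorProduct.tmul_zero]
    | add y y' hy hy' => simp only [TensorProduct.tmul_add, LinearMap.map_add, LinearEquiv.map_add, hy, hy']
    | tmul w b' => simp [mul_assoc]

lemma codiagR_actSnd (rV : V →ₗ[k] V ⊗[k] A) {rW : W →ₗ[k] W ⊗[k] A}
    {σ : Aᵐᵒᵖ →ₐ[k] Module.End k W} (h : ∀ b, rW ∘ₗ σ b = diag σ (rreg k A) b ∘ₗ rW) (b : Aᵐᵒᵖ) :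
    codiagR rV rW ∘ₗ actSnd V σ b = diag (actSnd V σ) (rreg k A) b ∘ₗ codiagR rV rW := by
  refine TensorProduct.ext' fun v w => ?_
  have hw := congr($(h b) w)
  simp only [LinearMap.comp_apply] at hw
  simp only [codiagR, LinearMap.comp_apply, TensorProduct.map_tmul, actSnd_tmul, hw,
    diag_apply _ _ (ℛ k b), LinearMap.sum_apply, TensorProduct.tmul_sum, map_sum]
  refine Finset.sum_congr rfl fun i _ => ?_
  generalize rV v = x
  generalize rW w = y
  induction x with
  | zero => simp only [LinearMap.map_zero, LinearEquiv.map_zero, TensorProduct.zero_tmul, TensorProduct.tmul_zero]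
  | add x x' hx hx' => simp only [TensorProduct.add_tmul, LinearMap.map_add, LinearEquiv.map_add, hx, hx']
  | tmul v a' =>
    induction y with
    | zero => simp only [LinearMap.map_zero, LinearEquiv.map_zero, TensorProduct.zero_tmul, TensorProduct.tmul_zero]
    | add y y' hy hy' => simp only [TensorProduct.tmul_add, LinearMap.map_add, LinearEquiv.map_add, hy, hy']
    | tmul w b' => simp [mul_assoc]

/-- The left coaction of the first tensorand. -/
def coactFst (lV : V →ₗ[k] A ⊗[k] V) (W : Type*) [AddCommGroup W] [Module k W] :
    V ⊗[k] W →ₗ[k] A ⊗[k] (V ⊗[k] W) :=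
  (TensorProduct.assoc k A V W).toLinearMap ∘ₗ lV.rTensor W

/-- The right coaction of the second tensorand. -/
def coactSnd (V : Type*) [AddCommGroup V] [Module k V] (rW : W →ₗ[k] W ⊗[k] A) :
    V ⊗[k] W →ₗ[k] (V ⊗[k] W) ⊗[k] A :=
  (TensorProduct.assoc k V W A).symm.toLinearMap ∘ₗ rW.lTensor V

lemma coactFst_coassoc {lV : V →ₗ[k] A ⊗[k] V}
    (hV : TensorProduct.assoc k A A V ∘ₗ comul.rTensor V ∘ₗ lV = lV.lTensor A ∘ₗ lV) :
    TensorProduct.assoc k A A (V ⊗[k] W) ∘ₗ comul.rTensor (V ⊗[k] W) ∘ₗ coactFst lV W =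
      (coactFst lV W).lTensor A ∘ₗ coactFst lV W := by
  refine TensorProduct.ext' fun v w => ?_
  have hv := congr((TensorProduct.assoc k A V W).toLinearMap.lTensor A
    (TensorProduct.assoc k A (A ⊗[k] V) W ($hV v ⊗ₜ w)))
  refine Eq.trans ?_ (hv.trans ?_)
  · simp only [coactFst, LinearMap.comp_apply, LinearMap.rTensor_tmul]
    generalize lV v = x
    induction x with
    | zero => simp only [LinearMap.map_zero, LinearEquiv.map_zero, TensorProduct.zero_tmul, TensorProduct.tmul_zero]
    | add x x' hx hx' => simp only [TensorProduct.add_tmul, LinearMap.map_add, LinearEquiv.map_add, hx, hx']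
    | tmul a v =>
      simp only [LinearMap.rTensor_tmul, LinearEquiv.coe_coe, TensorProduct.assoc_tmul]
      generalize comul (R := k) a = y
      induction y with
      | zero => simp only [LinearMap.map_zero, LinearEquiv.map_zero, TensorProduct.zero_tmul, TensorProduct.tmul_zero]
      | add x x' hx hx' => simp only [TensorProduct.add_tmul, LinearMap.map_add, LinearEquiv.map_add, hx, hx']
      | tmul a b => simp
  · simp only [coactFst, LinearMap.comp_apply, LinearMap.rTensor_tmul]
    generalize lV v = x
    induction x with
    | zero => simp only [LinearMap.map_zero, LinearEquiv.map_zero, TensorProduct.zero_tmul, TensorProduct.tmul_zero]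
    | add x x' hx hx' => simp only [TensorProduct.add_tmul, LinearMap.map_add, LinearEquiv.map_add, hx, hx']
    | tmul a v => simp

lemma coactSnd_coassoc {rW : W →ₗ[k] W ⊗[k] A}
    (hW : TensorProduct.assoc k W A A ∘ₗ rW.rTensor A ∘ₗ rW = comul.lTensor W ∘ₗ rW) :
    TensorProduct.assoc k (V ⊗[k] W) A A ∘ₗ (coactSnd V rW).rTensor A ∘ₗ coactSnd V rW =
      comul.lTensor (V ⊗[k] W) ∘ₗ coactSnd V rW := by
  refine TensorProduct.ext' fun v w => ?_
  have hv := congr((TensorProduct.assoc k V W (A ⊗[k] A)).symm (v ⊗ₜ ($hW w)))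
  refine Eq.trans ?_ (hv.trans ?_)
  · simp only [coactSnd, LinearMap.comp_apply, LinearMap.lTensor_tmul]
    generalize rW w = x
    induction x with
    | zero => simp only [LinearMap.map_zero, LinearEquiv.map_zero, TensorProduct.zero_tmul, TensorProduct.tmul_zero]
    | add x x' hx hx' => simp only [TensorProduct.tmul_add, LinearMap.map_add, LinearEquiv.map_add, hx, hx']
    | tmul w a =>
      simp only [LinearMap.rTensor_tmul, LinearEquiv.coe_coe, TensorProduct.assoc_symm_tmul,
        LinearMap.comp_apply, LinearMap.lTensor_tmul]
      generalize rW w = y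
      induction y with
      | zero => simp only [LinearMap.map_zero, LinearEquiv.map_zero, TensorProduct.zero_tmul, TensorProduct.tmul_zero]
      | add x x' hx hx' =>
        simp only [TensorProduct.tmul_add, TensorProduct.add_tmul, LinearMap.map_add, LinearEquiv.map_add, hx, hx']
      | tmul a b => simp
  · simp only [coactSnd, LinearMap.comp_apply, LinearMap.lTensor_tmul]
    generalize rW w = x
    induction x with
    | zero => simp only [LinearMap.map_zero, LinearEquiv.map_zero, TensorProduct.zero_tmul, TensorProduct.tmul_zero]
    | add x x' hx hx' => simp only [TensorProduct.tmul_add, LinearMap.map_add, LinearEquiv.map_add, hx, hx']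
    | tmul a v => simp

lemma coactFst_counit {lV : V →ₗ[k] A ⊗[k] V}
    (hV : TensorProduct.lid k V ∘ₗ counit.rTensor V ∘ₗ lV = LinearMap.id) :
    TensorProduct.lid k (V ⊗[k] W) ∘ₗ counit.rTensor (V ⊗[k] W) ∘ₗ coactFst lV W =
      LinearMap.id := by
  refine TensorProduct.ext' fun v w => ?_
  refine Eq.trans ?_ congr($hV v ⊗ₜ w)
  simp only [coactFst, LinearMap.comp_apply, LinearMap.rTensor_tmul]
  generalize lV v = x
  induction x with
  | zero => simp only [LinearMap.map_zero, LinearEquiv.map_zero, TensorProduct.zero_tmul, TensorProduct.tmul_zero]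
  | add x x' hx hx' => simp only [TensorProduct.add_tmul, LinearMap.map_add, LinearEquiv.map_add, hx, hx']
  | tmul a v => simp [TensorProduct.smul_tmul']

lemma coactSnd_counit {rW : W →ₗ[k] W ⊗[k] A}
    (hW : TensorProduct.rid k W ∘ₗ counit.lTensor W ∘ₗ rW = LinearMap.id) :
    TensorProduct.rid k (V ⊗[k] W) ∘ₗ counit.lTensor (V ⊗[k] W) ∘ₗ coactSnd V rW =
      LinearMap.id := by
  refine TensorProduct.ext' fun v w => ?_
  refine Eq.trans ?_ congr(v ⊗ₜ $hW w)
  simp only [coactSnd, LinearMap.comp_apply, LinearMap.lTensor_tmul]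
  generalize rW w = x
  induction x with
  | zero => simp only [LinearMap.map_zero, LinearEquiv.map_zero, TensorProduct.zero_tmul, TensorProduct.tmul_zero]
  | add x x' hx hx' => simp only [TensorProduct.tmul_add, LinearMap.map_add, LinearEquiv.map_add, hx, hx']
  | tmul a v => simp

lemma coactFst_comm_coactSnd (lV : V →ₗ[k] A ⊗[k] V) (rW : W →ₗ[k] W ⊗[k] A) :
    TensorProduct.assoc k A (V ⊗[k] W) A ∘ₗ (coactFst lV W).rTensor A ∘ₗ coactSnd V rW =
      (coactSnd V rW).lTensor A ∘ₗ coactFst lV W := by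
  refine TensorProduct.ext' fun v w => ?_
  simp only [coactSnd, coactFst, LinearMap.comp_apply, LinearMap.lTensor_tmul,
    LinearMap.rTensor_tmul]
  have h : ∀ (x : A ⊗[k] V) (w : W) (a : A), TensorProduct.assoc k A (V ⊗[k] W) A
      (TensorProduct.assoc k A V W (x ⊗ₜ w) ⊗ₜ a) =
      (TensorProduct.assoc k V W A).symm.toLinearMap.lTensor A
        (TensorProduct.assoc k A V (W ⊗[k] A) (x ⊗ₜ (w ⊗ₜ a))) := by
    intro x w a
    induction x with
    | zero => simp only [LinearMap.map_zero, LinearEquiv.map_zero, TensorProduct.zero_tmul, TensorProduct.tmul_zero]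
    | add x x' hx hx' => simp only [TensorProduct.add_tmul, LinearMap.map_add, LinearEquiv.map_add, hx, hx']
    | tmul b v => simp
  have h1 : ∀ y : W ⊗[k] A, TensorProduct.assoc k A (V ⊗[k] W) A
      ((((TensorProduct.assoc k A V W).toLinearMap ∘ₗ lV.rTensor W)).rTensor A
        ((TensorProduct.assoc k V W A).symm (v ⊗ₜ y))) =
      (TensorProduct.assoc k V W A).symm.toLinearMap.lTensor A
        (TensorProduct.assoc k A V (W ⊗[k] A) (lV v ⊗ₜ y)) := by
    intro y
    induction y with
    | zero => simp only [LinearMap.map_zero, LinearEquiv.map_zero, TensorProduct.zero_tmul, TensorProduct.tmul_zero]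
    | add x x' hx hx' => simp only [TensorProduct.tmul_add, LinearMap.map_add, LinearEquiv.map_add, hx, hx']
    | tmul w a => simpa using h (lV v) w a
  refine (h1 (rW w)).trans ?_
  generalize lV v = x
  induction x with
  | zero => simp only [LinearMap.map_zero, LinearEquiv.map_zero, TensorProduct.zero_tmul, TensorProduct.tmul_zero]
  | add x x' hx hx' => simp only [TensorProduct.add_tmul, LinearMap.map_add, LinearEquiv.map_add, hx, hx']
  | tmul b v => simp

lemma diag_assoc {U : Type*} [AddCommGroup U] [Module k U] (μ : B →ₐ[k] Module.End k U)
    (ρ : B →ₐ[k] Module.End k V) (σ : B →ₐ[k] Module.End k W) (b : B) (x : (U ⊗[k] V) ⊗[k] W) :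
    TensorProduct.assoc k U V W (diag (diag μ ρ) σ b x) =
      diag μ (diag ρ σ) b (TensorProduct.assoc k U V W x) := by
  have key : (TensorProduct.assoc k U V W).toLinearMap ∘ₗ diag (diag μ ρ) σ b =
      diag μ (diag ρ σ) b ∘ₗ (TensorProduct.assoc k U V W).toLinearMap := by
    refine TensorProduct.ext_threefold fun u v w => ?_
    have h := congr(TensorProduct.map (μ.toLinearMap.flip u) (TensorProduct.map
      (ρ.toLinearMap.flip v) (σ.toLinearMap.flip w))
      $(Coalgebra.sum_tmul_tmul_eq (ℛ k b) (fun i => ℛ k ((ℛ k b).left i))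
        (fun i => ℛ k ((ℛ k b).right i))))
    simp only [map_sum, TensorProduct.map_tmul, LinearMap.flip_apply,
      AlgHom.toLinearMap_apply] at h
    simp only [LinearMap.comp_apply, LinearEquiv.coe_coe, TensorProduct.assoc_tmul]
    rw [diag_apply _ _ (ℛ k b), diag_apply _ _ (ℛ k b)]
    simp only [LinearMap.sum_apply, TensorProduct.map_tmul, map_sum]
    simp only [diag_apply _ _ (ℛ k ((ℛ k b).left _)), diag_apply _ _ (ℛ k ((ℛ k b).right _)),
      LinearMap.sum_apply, TensorProduct.map_tmul, map_sum, TensorProduct.sum_tmul,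
      TensorProduct.tmul_sum, TensorProduct.assoc_tmul]
    exact h
  exact congr($key x)

lemma coactFst_diag {lV : V →ₗ[k] A ⊗[k] V} (μ : B →ₐ[k] Module.End k A)
    {ρ : B →ₐ[k] Module.End k V} (σ : B →ₐ[k] Module.End k W)
    (h : ∀ b, lV ∘ₗ ρ b = diag μ ρ b ∘ₗ lV) (b : B) :
    coactFst lV W ∘ₗ diag ρ σ b = diag μ (diag ρ σ) b ∘ₗ coactFst lV W := by
  refine TensorProduct.ext' fun v w => ?_
  have h' := fun b v => congr($(h b) v)
  simp only [LinearMap.comp_apply] at h'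
  refine Eq.trans ?_ (diag_assoc μ ρ σ b (lV v ⊗ₜ w))
  rw [diag_apply _ _ (ℛ k b), diag_apply _ _ (ℛ k b)]
  simp [coactFst, h']

lemma coactSnd_diag {rW : W →ₗ[k] W ⊗[k] A} (μ : B →ₐ[k] Module.End k A)
    (ρ : B →ₐ[k] Module.End k V) {σ : B →ₐ[k] Module.End k W}
    (h : ∀ b, rW ∘ₗ σ b = diag σ μ b ∘ₗ rW) (b : B) :
    coactSnd V rW ∘ₗ diag ρ σ b = diag (diag ρ σ) μ b ∘ₗ coactSnd V rW := by
  refine TensorProduct.ext' fun v w => ?_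
  have h' := fun b v => congr($(h b) v)
  simp only [LinearMap.comp_apply] at h'
  apply (TensorProduct.assoc k V W A).injective
  simp only [coactSnd, LinearMap.comp_apply, LinearMap.lTensor_tmul, LinearEquiv.coe_coe,
    diag_assoc, LinearEquiv.apply_symm_apply]
  rw [diag_apply _ _ (ℛ k b), diag_apply _ _ (ℛ k b)]
  simp [h']

end Mux
end GS

namespace GS

open HopfAlgebra WithConv

namespace HopfBimod

variable {k A : Type u} [Field k] [Ring A] [HopfAlgebra k A]

/-- The Hopf bimodule `V ⊗ W` with standard actions (`A` acts on the left on `V` and on the right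
on `W`) and codiagonal coactions. -/
def hTensor (V W : HopfBimod k A) : HopfBimod k A where
  carrier := V ⊗[k] W
  lact := actFst V.lact W
  ract := actSnd V W.ract
  act_comm := commute_actFst_actSnd _ _
  lcoact := codiagL V.lcoact W.lcoact
  rcoact := codiagR V.rcoact W.rcoact
  lcoact_coassoc := codiagL_coassoc V.lcoact_coassoc W.lcoact_coassoc
  lcoact_counit := codiagL_counit V.lcoact_counit W.lcoact_counit
  rcoact_coassoc := codiagR_coassoc V.rcoact_coassoc W.rcoact_coassoc
  rcoact_counit := codiagR_counit V.rcoact_counit W.rcoact_counit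
  coact_comm := codiag_comm V.coact_comm W.coact_comm
  lcoact_lact := codiagL_actFst _ V.lcoact_lact
  lcoact_ract := codiagL_actSnd _ W.lcoact_ract
  rcoact_lact := codiagR_actFst _ V.rcoact_lact
  rcoact_ract := codiagR_actSnd _ W.rcoact_ract

/-- The Hopf bimodule `V ⊗ W` with standard coactions (`A` coacts on the left through `V` and on
the right through `W`) and diagonal actions. -/
def cTensor (V W : HopfBimod k A) : HopfBimod k A where
  carrier := V ⊗[k] W
  lact := diag V.lact W.lact
  ract := diag V.ract W.ract
  act_comm := commute_diag V.act_comm W.act_comm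
  lcoact := coactFst V.lcoact W
  rcoact := coactSnd V W.rcoact
  lcoact_coassoc := coactFst_coassoc V.lcoact_coassoc
  lcoact_counit := coactFst_counit V.lcoact_counit
  rcoact_coassoc := coactSnd_coassoc W.rcoact_coassoc
  rcoact_counit := coactSnd_counit W.rcoact_counit
  coact_comm := coactFst_comm_coactSnd _ _
  lcoact_lact := coactFst_diag _ _ V.lcoact_lact
  lcoact_ract := coactFst_diag _ _ V.lcoact_ract
  rcoact_lact := coactSnd_diag _ _ W.rcoact_lact
  rcoact_ract := coactSnd_diag _ _ W.rcoact_ract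

variable {V V' W W' : HopfBimod k A}

lemma diag_natural {B : Type*} [Ring B] [Bialgebra k B] {X X' Y Y' : Type*} [AddCommGroup X]
    [Module k X] [AddCommGroup X'] [Module k X'] [AddCommGroup Y] [Module k Y] [AddCommGroup Y']
    [Module k Y'] {ρ : B →ₐ[k] Module.End k X} {ρ' : B →ₐ[k] Module.End k X'}
    {σ : B →ₐ[k] Module.End k Y} {σ' : B →ₐ[k] Module.End k Y'} {f : X →ₗ[k] X'} {g : Y →ₗ[k] Y'}
    (hf : ∀ b, f ∘ₗ ρ b = ρ' b ∘ₗ f) (hg : ∀ b, g ∘ₗ σ b = σ' b ∘ₗ g) (b : B) :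
    TensorProduct.map f g ∘ₗ diag ρ σ b = diag ρ' σ' b ∘ₗ TensorProduct.map f g := by
  rw [diag_apply _ _ (ℛ k b), diag_apply _ _ (ℛ k b)]
  have hf' := fun b v => congr($(hf b) v)
  have hg' := fun b v => congr($(hg b) v)
  simp only [LinearMap.comp_apply] at hf' hg'
  refine TensorProduct.ext' fun v w => ?_
  simp [hf', hg']

lemma muxL_natural {X X' Y Y' : Type*} [AddCommGroup X]
    [Module k X] [AddCommGroup X'] [Module k X'] [AddCommGroup Y] [Module k Y] [AddCommGroup Y']
    [Module k Y'] (f : X →ₗ[k] X') (g : Y →ₗ[k] Y') :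
    muxL k A X' Y' ∘ₗ TensorProduct.map (f.lTensor A) (g.lTensor A) =
      (TensorProduct.map f g).lTensor A ∘ₗ muxL k A X Y :=
  ext4 fun a v b w => by simp

lemma muxR_natural {X X' Y Y' : Type*} [AddCommGroup X]
    [Module k X] [AddCommGroup X'] [Module k X'] [AddCommGroup Y] [Module k Y] [AddCommGroup Y']
    [Module k Y'] (f : X →ₗ[k] X') (g : Y →ₗ[k] Y') :
    muxR k A X' Y' ∘ₗ TensorProduct.map (f.rTensor A) (g.rTensor A) =
      (TensorProduct.map f g).rTensor A ∘ₗ muxR k A X Y :=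
  ext4 fun a v b w => by simp

/-- The tensor product of two morphisms. -/
def hTensorMap (f : V ⟶ V') (g : W ⟶ W') : hTensor V W ⟶ hTensor V' W' where
  lin := TensorProduct.map f.lin g.lin
  lact a := TensorProduct.ext' fun v w => congr($(f.lact a) v ⊗ₜ g.lin w)
  ract b := TensorProduct.ext' fun v w => congr(f.lin v ⊗ₜ $(g.ract b) w)
  lcoact := by
    change (muxL k A V' W' ∘ₗ TensorProduct.map V'.lcoact W'.lcoact) ∘ₗ _ =
      _ ∘ₗ (muxL k A V W ∘ₗ TensorProduct.map V.lcoact W.lcoact)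
    rw [LinearMap.comp_assoc, ← TensorProduct.map_comp, f.lcoact, g.lcoact,
      TensorProduct.map_comp, ← LinearMap.comp_assoc, muxL_natural]
    rfl
  rcoact := by
    change (muxR k A V' W' ∘ₗ TensorProduct.map V'.rcoact W'.rcoact) ∘ₗ _ =
      _ ∘ₗ (muxR k A V W ∘ₗ TensorProduct.map V.rcoact W.rcoact)
    rw [LinearMap.comp_assoc, ← TensorProduct.map_comp, f.rcoact, g.rcoact,
      TensorProduct.map_comp, ← LinearMap.comp_assoc, muxR_natural]
    rfl

/-- The tensor product of two morphisms. -/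
def cTensorMap (f : V ⟶ V') (g : W ⟶ W') : cTensor V W ⟶ cTensor V' W' where
  lin := TensorProduct.map f.lin g.lin
  lact a := diag_natural f.lact g.lact a
  ract b := diag_natural f.ract g.ract b
  lcoact := by
    refine TensorProduct.ext' fun v w => ?_
    have h := congr(TensorProduct.assoc k A V' W' ($(f.lcoact) v ⊗ₜ g.lin w))
    refine h.trans ?_
    change TensorProduct.assoc k A V' W' (f.lin.lTensor A (V.lcoact v) ⊗ₜ g.lin w) =
      (TensorProduct.map f.lin g.lin).lTensor A (TensorProduct.assoc k A V W (V.lcoact v ⊗ₜ w))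
    generalize V.lcoact v = x
    induction x with
    | zero => simp only [LinearMap.map_zero, LinearEquiv.map_zero, TensorProduct.zero_tmul, TensorProduct.tmul_zero]
    | add x x' hx hx' => simp only [TensorProduct.add_tmul, LinearMap.map_add, LinearEquiv.map_add, hx, hx']
    | tmul a v => simp
  rcoact := by
    refine TensorProduct.ext' fun v w => ?_
    have h := congr((TensorProduct.assoc k V' W' A).symm (f.lin v ⊗ₜ $(g.rcoact) w))
    refine h.trans ?_
    change (TensorProduct.assoc k V' W' A).symm (f.lin v ⊗ₜ g.lin.rTensor A (W.rcoact w)) =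
      (TensorProduct.map f.lin g.lin).rTensor A
        ((TensorProduct.assoc k V W A).symm (v ⊗ₜ W.rcoact w))
    generalize W.rcoact w = x
    induction x with
    | zero => simp only [LinearMap.map_zero, LinearEquiv.map_zero, TensorProduct.zero_tmul, TensorProduct.tmul_zero]
    | add x x' hx hx' => simp only [TensorProduct.tmul_add, LinearMap.map_add, LinearEquiv.map_add, hx, hx']
    | tmul a v => simp

variable (k A)

/-- The functor `M ↦ A ⊗ M`, with standard actions and codiagonal coactions. -/
def indL : HopfBimod k A ⥤ HopfBimod k A where
  obj M := hTensor (regular k A) M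
  map f := hTensorMap (𝟙 _) f
  map_id _ := hom_ext (TensorProduct.map_id)
  map_comp _ _ := hom_ext (TensorProduct.ext' fun _ _ => rfl)

/-- The functor `M ↦ M ⊗ A`, with standard actions and codiagonal coactions. -/
def indR : HopfBimod k A ⥤ HopfBimod k A where
  obj M := hTensor M (regular k A)
  map f := hTensorMap f (𝟙 _)
  map_id _ := hom_ext (TensorProduct.map_id)
  map_comp _ _ := hom_ext (TensorProduct.ext' fun _ _ => rfl)

/-- The functor `N ↦ A ⊗ N`, with standard coactions and diagonal actions. -/
def coindL : HopfBimod k A ⥤ HopfBimod k A where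
  obj M := cTensor (regular k A) M
  map f := cTensorMap (𝟙 _) f
  map_id _ := hom_ext (TensorProduct.map_id)
  map_comp _ _ := hom_ext (TensorProduct.ext' fun _ _ => rfl)

/-- The functor `N ↦ N ⊗ A`, with standard coactions and diagonal actions. -/
def coindR : HopfBimod k A ⥤ HopfBimod k A where
  obj M := cTensor M (regular k A)
  map f := cTensorMap f (𝟙 _)
  map_id _ := hom_ext (TensorProduct.map_id)
  map_comp _ _ := hom_ext (TensorProduct.ext' fun _ _ => rfl)

instance : (indL k A).Additive where
  map_add := hom_ext (TensorProduct.map_add_right _ _ _)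

instance : (indR k A).Additive where
  map_add := hom_ext (TensorProduct.map_add_left _ _ _)

instance : (coindL k A).Additive where
  map_add := hom_ext (TensorProduct.map_add_right _ _ _)

instance : (coindR k A).Additive where
  map_add := hom_ext (TensorProduct.map_add_left _ _ _)

/-- The linear map `a ⊗ m ↦ a m`. -/
def actLLin (M : HopfBimod k A) : A ⊗[k] M →ₗ[k] M := TensorProduct.lift M.lact.toLinearMap

/-- The linear map `m ⊗ a ↦ m a`. -/
def actRLin (M : HopfBimod k A) : M ⊗[k] A →ₗ[k] M :=
  TensorProduct.lift (M.ract.toLinearMap ∘ₗ (MulOpposite.opLinearEquiv k).toLinearMap).flip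

variable {k A} in
@[simp] lemma actLLin_tmul (M : HopfBimod k A) (a : A) (m : M) :
    actLLin k A M (a ⊗ₜ m) = M.lact a m := rfl

variable {k A} in
@[simp] lemma actRLin_tmul (M : HopfBimod k A) (a : A) (m : M) :
    actRLin k A M (m ⊗ₜ a) = M.ract (MulOpposite.op a) m := rfl

variable {k A} in
lemma lcoact_actLLin (M : HopfBimod k A) : M.lcoact ∘ₗ actLLin k A M =
    (actLLin k A M).lTensor A ∘ₗ codiagL comul M.lcoact := by
  refine TensorProduct.ext' fun a m => ?_
  refine congr($(M.lcoact_lact a) m).trans ?_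
  change diag (lreg k A) M.lact a (M.lcoact m) =
    (actLLin k A M).lTensor A (muxL k A A M (comul a ⊗ₜ M.lcoact m))
  rw [diag_apply _ _ (ℛ k a)]
  conv_rhs => rw [← (ℛ k a).eq]
  rw [TensorProduct.sum_tmul, map_sum, map_sum, LinearMap.sum_apply]
  refine Finset.sum_congr rfl fun i _ => ?_
  generalize M.lcoact m = x
  induction x with
  | zero => simp only [LinearMap.map_zero, LinearEquiv.map_zero, TensorProduct.zero_tmul, TensorProduct.tmul_zero]
  | add x y hx hy => simp only [TensorProduct.tmul_add, LinearMap.map_add, LinearEquiv.map_add, hx, hy]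
  | tmul b m => simp

variable {k A} in
lemma rcoact_actLLin (M : HopfBimod k A) : M.rcoact ∘ₗ actLLin k A M =
    (actLLin k A M).rTensor A ∘ₗ codiagR comul M.rcoact := by
  refine TensorProduct.ext' fun a m => ?_
  refine congr($(M.rcoact_lact a) m).trans ?_
  change diag M.lact (lreg k A) a (M.rcoact m) =
    (actLLin k A M).rTensor A (muxR k A A M (comul a ⊗ₜ M.rcoact m))
  rw [diag_apply _ _ (ℛ k a)]
  conv_rhs => rw [← (ℛ k a).eq]
  rw [TensorProduct.sum_tmul, map_sum, map_sum, LinearMap.sum_apply]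
  refine Finset.sum_congr rfl fun i _ => ?_
  generalize M.rcoact m = x
  induction x with
  | zero => simp only [LinearMap.map_zero, LinearEquiv.map_zero, TensorProduct.zero_tmul, TensorProduct.tmul_zero]
  | add x y hx hy => simp only [TensorProduct.tmul_add, LinearMap.map_add, LinearEquiv.map_add, hx, hy]
  | tmul b m => simp

variable {k A} in
lemma lcoact_actRLin (M : HopfBimod k A) : M.lcoact ∘ₗ actRLin k A M =
    (actRLin k A M).lTensor A ∘ₗ codiagL M.lcoact comul := by
  refine TensorProduct.ext' fun m a => ?_
  refine congr($(M.lcoact_ract (MulOpposite.op a)) m).trans ?_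
  change diag (rreg k A) M.ract (MulOpposite.op a) (M.lcoact m) =
    (actRLin k A M).lTensor A (muxL k A M A (M.lcoact m ⊗ₜ comul a))
  rw [diag_apply _ _ (opRepr (ℛ k a))]
  conv_rhs => rw [← (ℛ k a).eq]
  rw [TensorProduct.tmul_sum, map_sum, map_sum, LinearMap.sum_apply]
  refine Finset.sum_congr rfl fun i _ => ?_
  generalize M.lcoact m = x
  induction x with
  | zero => simp only [LinearMap.map_zero, LinearEquiv.map_zero, TensorProduct.zero_tmul, TensorProduct.tmul_zero]
  | add x y hx hy => simp only [TensorProduct.add_tmul, LinearMap.map_add, LinearEquiv.map_add, hx, hy]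
  | tmul b m => simp [opRepr]

variable {k A} in
lemma rcoact_actRLin (M : HopfBimod k A) : M.rcoact ∘ₗ actRLin k A M =
    (actRLin k A M).rTensor A ∘ₗ codiagR M.rcoact comul := by
  refine TensorProduct.ext' fun m a => ?_
  refine congr($(M.rcoact_ract (MulOpposite.op a)) m).trans ?_
  change diag M.ract (rreg k A) (MulOpposite.op a) (M.rcoact m) =
    (actRLin k A M).rTensor A (muxR k A M A (M.rcoact m ⊗ₜ comul a))
  rw [diag_apply _ _ (opRepr (ℛ k a))]
  conv_rhs => rw [← (ℛ k a).eq]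
  rw [TensorProduct.tmul_sum, map_sum, map_sum, LinearMap.sum_apply]
  refine Finset.sum_congr rfl fun i _ => ?_
  generalize M.rcoact m = x
  induction x with
  | zero => simp only [LinearMap.map_zero, LinearEquiv.map_zero, TensorProduct.zero_tmul, TensorProduct.tmul_zero]
  | add x y hx hy => simp only [TensorProduct.add_tmul, LinearMap.map_add, LinearEquiv.map_add, hx, hy]
  | tmul b m => simp [opRepr]

/-- The left action `A ⊗ M → M`. -/
def actL : indL k A ⟶ 𝟭 (HopfBimod k A) where
  app M :=
    { lin := actLLin k A M
      lact := fun a => TensorProduct.ext' fun x m => congr($(map_mul M.lact a x) m)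
      ract := fun b => TensorProduct.ext' fun x m => congr($((M.act_comm x b).eq) m)
      lcoact := lcoact_actLLin M
      rcoact := rcoact_actLLin M }
  naturality _ _ f := hom_ext <| TensorProduct.ext' fun a m => congr($((f.lact a).symm) m)

/-- The right action `M ⊗ A → M`. -/
def actR : indR k A ⟶ 𝟭 (HopfBimod k A) where
  app M :=
    { lin := actRLin k A M
      lact := fun a => TensorProduct.ext' fun m x =>
        congr($((M.act_comm a (MulOpposite.op x)).eq.symm) m)
      ract := fun b => TensorProduct.ext' fun m x =>
        congr($(map_mul M.ract b (MulOpposite.op x)) m)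
      lcoact := lcoact_actRLin M
      rcoact := rcoact_actRLin M }
  naturality _ _ f := hom_ext <| TensorProduct.ext' fun m a =>
    congr($((f.ract (MulOpposite.op a)).symm) m)

/-- The left coaction `N → A ⊗ N`. -/
def coactL : 𝟭 (HopfBimod k A) ⟶ coindL k A where
  app N :=
    { lin := N.lcoact
      lact := fun a => N.lcoact_lact a
      ract := fun b => N.lcoact_ract b
      lcoact := N.lcoact_coassoc
      rcoact := by
        refine LinearMap.ext fun n => (TensorProduct.assoc k A N A).injective ?_
        refine Eq.trans ?_ congr($(N.coact_comm.symm) n)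
        exact (TensorProduct.assoc k A N A).apply_symm_apply _ }
  naturality _ _ f := hom_ext f.lcoact

/-- The right coaction `N → N ⊗ A`. -/
def coactR : 𝟭 (HopfBimod k A) ⟶ coindR k A where
  app N :=
    { lin := N.rcoact
      lact := fun a => N.rcoact_lact a
      ract := fun b => N.rcoact_ract b
      lcoact := N.coact_comm
      rcoact := by
        refine LinearMap.ext fun n => (TensorProduct.assoc k N A A).injective ?_
        refine Eq.trans ?_ congr($(N.rcoact_coassoc.symm) n)
        exact (TensorProduct.assoc k N A A).apply_symm_apply _ }
  naturality _ _ f := hom_ext f.rcoact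

end HopfBimod
end GS

namespace GS

section Complexes

variable {C : Type*} [Category C] [Preadditive C]

/-- The objects of the augmented bar complex attached to `F`: the object in degree `n - 1` is
`Fⁿ M`. -/
def barX (F : C ⥤ C) (M : C) : ℕ → C
  | 0 => M
  | n + 1 => F.obj (barX F M n)

/-- The component `F X ⟶ X` of `ε : F ⟶ 𝟭 C`. -/
abbrev counitApp {F : C ⥤ C} (ε : F ⟶ 𝟭 C) (X : C) : F.obj X ⟶ X := ε.app X

/-- The component `X ⟶ G X` of `η : 𝟭 C ⟶ G`. -/
abbrev unitApp {G : C ⥤ C} (η : 𝟭 C ⟶ G) (X : C) : X ⟶ G.obj X := η.app X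

lemma counitApp_natural {F : C ⥤ C} (ε : F ⟶ 𝟭 C) {X Y : C} (f : X ⟶ Y) :
    F.map f ≫ counitApp ε Y = counitApp ε X ≫ f := ε.naturality f

lemma unitApp_natural {G : C ⥤ C} (η : 𝟭 C ⟶ G) {X Y : C} (f : X ⟶ Y) :
    f ≫ unitApp η Y = unitApp η X ≫ G.map f := η.naturality f

/-- For `f : F X ⟶ X`, the morphism `ε - F(f)` from `F (F X)` to `F X`. -/
def barSucc {F : C ⥤ C} (ε : F ⟶ 𝟭 C) {X : C} (f : F.obj X ⟶ X) : F.obj (F.obj X) ⟶ F.obj X :=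
  counitApp ε (F.obj X) - F.map f

/-- For `f : X ⟶ G X`, the morphism `η - G(f)` from `G X` to `G (G X)`. -/
def cobarSucc {G : C ⥤ C} (η : 𝟭 C ⟶ G) {X : C} (f : X ⟶ G.obj X) : G.obj X ⟶ G.obj (G.obj X) :=
  unitApp η (G.obj X) - G.map f

lemma barSucc_comp {F : C ⥤ C} [F.Additive] (ε : F ⟶ 𝟭 C) {X : C} (f : F.obj X ⟶ X)
    (hf : barSucc ε f ≫ f = 0) : barSucc ε (barSucc ε f) ≫ barSucc ε f = 0 := by
  have h1 : F.map (barSucc ε f) ≫ barSucc ε f = F.map (barSucc ε f) ≫ counitApp ε (F.obj X) := by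
    conv_lhs => arg 2; unfold barSucc
    rw [Preadditive.comp_sub, ← F.map_comp, hf, F.map_zero, sub_zero]
  have h2 : barSucc ε (barSucc ε f) =
      counitApp ε (F.obj (F.obj X)) - F.map (barSucc ε f) := rfl
  rw [h2, Preadditive.sub_comp, h1, counitApp_natural, sub_self]

lemma cobarSucc_comp {G : C ⥤ C} [G.Additive] (η : 𝟭 C ⟶ G) {X : C} (f : X ⟶ G.obj X)
    (hf : f ≫ cobarSucc η f = 0) : cobarSucc η f ≫ cobarSucc η (cobarSucc η f) = 0 := by
  have h1 : cobarSucc η f ≫ G.map (cobarSucc η f) =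
      unitApp η (G.obj X) ≫ G.map (cobarSucc η f) := by
    conv_lhs => arg 1; unfold cobarSucc
    rw [Preadditive.sub_comp, ← G.map_comp, hf, G.map_zero, sub_zero]
  have h2 : cobarSucc η (cobarSucc η f) =
      unitApp η (G.obj (G.obj X)) - G.map (cobarSucc η f) := rfl
  rw [h2, Preadditive.comp_sub, h1, unitApp_natural, sub_self]

/-- The differentials `∂ₙ : Bₙ ⟶ Bₙ₋₁` (with `Bₙ = Fⁿ⁺¹ M`) of the augmented bar complex attached to
`ε : F ⟶ 𝟭 C`, defined by `∂₀ = ε` and `∂ₙ₊₁ = ε - F(∂ₙ)`. -/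
def barD {F : C ⥤ C} (ε : F ⟶ 𝟭 C) (M : C) : ∀ n : ℕ, barX F M (n + 1) ⟶ barX F M n
  | 0 => counitApp ε M
  | n + 1 => barSucc ε (barD ε M n)

lemma barD_comp {F : C ⥤ C} [F.Additive] (ε : F ⟶ 𝟭 C) (M : C) :
    ∀ n : ℕ, barD ε M (n + 1) ≫ barD ε M n = 0
  | 0 => by
    change (counitApp ε (F.obj M) - F.map (counitApp ε M)) ≫ counitApp ε M = 0
    rw [Preadditive.sub_comp, counitApp_natural, sub_self]
  | n + 1 => barSucc_comp ε (barD ε M n) (barD_comp ε M n)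

/-- The objects of the augmented cobar complex attached to `G`: the object in degree `n - 1` is
`Gⁿ N`. -/
def cobarX (G : C ⥤ C) (N : C) : ℕ → C
  | 0 => N
  | n + 1 => G.obj (cobarX G N n)

/-- The differentials of the augmented cobar complex attached to `η : 𝟭 C ⟶ G`: the morphism with
index `n` is `∂ⁿ⁻¹ : Cⁿ⁻¹ ⟶ Cⁿ` (with `Cⁿ = Gⁿ⁺¹ N`), and `∂⁻¹ = η`, `∂ⁿ = η - G(∂ⁿ⁻¹)`. -/
def cobarD {G : C ⥤ C} (η : 𝟭 C ⟶ G) (N : C) : ∀ n : ℕ, cobarX G N n ⟶ cobarX G N (n + 1)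
  | 0 => unitApp η N
  | n + 1 => cobarSucc η (cobarD η N n)

lemma cobarD_comp {G : C ⥤ C} [G.Additive] (η : 𝟭 C ⟶ G) (N : C) :
    ∀ n : ℕ, cobarD η N n ≫ cobarD η N (n + 1) = 0
  | 0 => by
    change unitApp η N ≫ (unitApp η (G.obj N) - G.map (unitApp η N)) = 0
    rw [Preadditive.comp_sub, unitApp_natural, sub_self]
  | n + 1 => cobarSucc_comp η (cobarD η N n) (cobarD_comp η N n)

end Complexes

/-- The signs in the total complex of a double cochain complex indexed by natural numbers. -/
instance tensorSignsUp : (ComplexShape.up ℕ).TensorSigns where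
  ε' := MonoidHom.mk' (fun (i : ℕ) => (-1 : ℤˣ) ^ i) (pow_add (-1 : ℤˣ))
  rel_add p q r (hpq : p + 1 = q) := by change p + r + 1 = q + r; lia
  add_rel p q r (hpq : p + 1 = q) := by change r + p + 1 = r + q; lia
  ε'_succ := by
    rintro p _ rfl
    change (-1 : ℤˣ) ^ (p + 1) = - (-1) ^ p
    rw [pow_add, pow_one, mul_neg, mul_one]

section DoubleComplex

variable {k : Type u} [Field k] {C : Type (u + 1)} [Category.{u} C] [Preadditive C]
  [CategoryTheory.Linear k C]

variable (k) in
/-- The linear map `α ↦ f ∘ α`. -/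
def postComp (X : C) {Y Z : C} (f : Y ⟶ Z) :
    ModuleCat.of k (X ⟶ Y) ⟶ ModuleCat.of k (X ⟶ Z) :=
  ModuleCat.ofHom (CategoryTheory.Linear.rightComp k X f)

variable (k) in
/-- The linear map `α ↦ α ∘ f`. -/
def preComp {X Y : C} (f : X ⟶ Y) (Z : C) :
    ModuleCat.of k (Y ⟶ Z) ⟶ ModuleCat.of k (X ⟶ Z) :=
  ModuleCat.ofHom (CategoryTheory.Linear.leftComp k Z f)

lemma postComp_comp (X : C) {Y Z W : C} {f : Y ⟶ Z} {g : Z ⟶ W} (h : f ≫ g = 0) :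
    postComp k X f ≫ postComp k X g = 0 :=
  ModuleCat.hom_ext <| LinearMap.ext fun α => by
    change (α ≫ f) ≫ g = 0
    rw [Category.assoc, h, Limits.comp_zero]

lemma preComp_comp {X Y Z : C} {f : X ⟶ Y} {g : Y ⟶ Z} (W : C) (h : f ≫ g = 0) :
    preComp k g W ≫ preComp k f W = 0 :=
  ModuleCat.hom_ext <| LinearMap.ext fun α => by
    change f ≫ g ≫ α = 0
    rw [← Category.assoc, h, Limits.zero_comp]

lemma preComp_postComp {X Y Z W : C} (f : X ⟶ Y) (g : Z ⟶ W) :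
    preComp k f Z ≫ postComp k X g = postComp k Y g ≫ preComp k f W :=
  ModuleCat.hom_ext <| LinearMap.ext fun _ => Category.assoc _ _ _

variable (k) in
/-- The complex `Hom (X, C^p)`, for `p ≥ 0`, where `C^p = Gᵖ⁺¹ N`. -/
def homCobar {G : C ⥤ C} [G.Additive] (η : 𝟭 C ⟶ G) (N X : C) :
    CochainComplex (ModuleCat.{u} k) ℕ :=
  CochainComplex.of (fun p => ModuleCat.of k (X ⟶ cobarX G N (p + 1)))
    (fun p => postComp k X (cobarD η N (p + 1))) (fun p => postComp_comp X (cobarD_comp η N (p + 1)))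

variable (k) in
/-- The morphism of complexes `α ↦ α ∘ f`. -/
def homCobarMap {G : C ⥤ C} [G.Additive] (η : 𝟭 C ⟶ G) (N : C) {X Y : C} (f : X ⟶ Y) :
    homCobar k η N Y ⟶ homCobar k η N X :=
  CochainComplex.ofHom (fun p => preComp k f (cobarX G N (p + 1))) (fun p => by
    have h (Z : C) : (homCobar k η N Z).d p (p + 1) = postComp k Z (cobarD η N (p + 1)) :=
      CochainComplex.of_d (fun p => ModuleCat.of k (Z ⟶ cobarX G N (p + 1)))
        (fun p => postComp k Z (cobarD η N (p + 1))) p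
    rw [h, h]
    exact preComp_postComp _ _)

variable (k) in
/-- The double complex whose term of bidegree `(q, p)`, for `q, p ≥ 0`, is `Hom (B_q, C^p)`, where
`B_q = Fᵠ⁺¹ M` and `C^p = Gᵖ⁺¹ N`, with the commuting differentials `α ↦ α ∘ ∂_{q+1}` and
`α ↦ ∂^p ∘ α`. In its total complex, the sign `(-1)^q` is put on the second differential. -/
def homDoubleComplex {F G : C ⥤ C} [F.Additive] [G.Additive] (ε : F ⟶ 𝟭 C) (η : 𝟭 C ⟶ G)
    (M N : C) : HomologicalComplex₂ (ModuleCat.{u} k) (ComplexShape.up ℕ) (ComplexShape.up ℕ) :=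
  CochainComplex.of (fun q => homCobar k η N (barX F M (q + 1)))
    (fun q => homCobarMap k η N (barD ε M (q + 1)))
    (fun q => HomologicalComplex.hom_ext _ _ fun _ => preComp_comp _ (barD_comp ε M (q + 1)))

variable (k) in
/-- The cohomology of the total complex of `Hom (B_q, C^p)`. -/
def homTotalCohomology {F G : C ⥤ C} [F.Additive] [G.Additive] (ε : F ⟶ 𝟭 C) (η : 𝟭 C ⟶ G)
    (M N : C) (n : ℕ) : ModuleCat.{u} k :=
  ((homDoubleComplex k ε η M N).total (ComplexShape.up ℕ)).homology n

end DoubleComplex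

end GS

namespace GS

namespace HopfBimod

variable (k A : Type u) [Field k] [Ring A] [HopfAlgebra k A]

/-- The functor `M ↦ (A ⊗ M) ⊗ A`, with standard actions and codiagonal coactions. -/
def indLR : HopfBimod k A ⥤ HopfBimod k A := indL k A ⋙ indR k A

/-- The functor `N ↦ (A ⊗ N) ⊗ A`, with standard coactions and diagonal actions. -/
def coindLR : HopfBimod k A ⥤ HopfBimod k A := coindL k A ⋙ coindR k A

instance : (indLR k A).Additive := inferInstanceAs (indL k A ⋙ indR k A).Additive

instance : (coindLR k A).Additive := inferInstanceAs (coindL k A ⋙ coindR k A).Additive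

/-- The action `(a ⊗ m) ⊗ b ↦ a m b`. -/
def actLR : indLR k A ⟶ 𝟭 (HopfBimod k A) where
  app M := (actR k A).app ((indL k A).obj M) ≫ (actL k A).app M
  naturality _ _ f := by
    have h1 := (actR k A).naturality ((indL k A).map f)
    have h2 := (actL k A).naturality f
    simp only [Functor.id_map] at h1 h2
    change (indR k A).map ((indL k A).map f) ≫ _ ≫ _ = _ ≫ f
    rw [← Category.assoc, h1, Category.assoc, h2]
    exact (Category.assoc ((actR k A).app _) ((actL k A).app _) f).symm

/-- The coaction `n ↦ ∑ (n₋₁ ⊗ n₀) ⊗ n₁`. -/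
def coactLR : 𝟭 (HopfBimod k A) ⟶ coindLR k A where
  app N := (coactL k A).app N ≫ (coactR k A).app ((coindL k A).obj N)
  naturality _ _ f := by
    have h1 := (coactR k A).naturality ((coindL k A).map f)
    have h2 := (coactL k A).naturality f
    simp only [Functor.id_map] at h1 h2
    change f ≫ _ ≫ _ = _ ≫ (coindR k A).map ((coindL k A).map f)
    rw [← Category.assoc, h2, Category.assoc, h1]
    exact (Category.assoc ((coactL k A).app _) ((coactR k A).app _) _).symm

/-- The element `a ⊗ m ⊗ b` of `indLR M`. -/
def indTmul {M : HopfBimod k A} (a : A) (m : M) (b : A) : (indLR k A).obj M :=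
  show (A ⊗[k] M) ⊗[k] A from (a ⊗ₜ m) ⊗ₜ b

/-- The element `a ⊗ m ⊗ b` of `coindLR M`. -/
def coindTmul {M : HopfBimod k A} (a : A) (m : M) (b : A) : (coindLR k A).obj M :=
  show (A ⊗[k] M) ⊗[k] A from (a ⊗ₜ m) ⊗ₜ b

/-- The differential `∂₀` of the bar resolution: `a ⊗ m ⊗ b ↦ a m b`. -/
lemma barD_zero_apply (M : HopfBimod k A) (a : A) (m : M) (b : A) :
    (barD (actLR k A) M 0).lin (indTmul k A a m b) =
      M.lact a (M.ract (MulOpposite.op b) m) := rfl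

/-- The differentials `∂ₙ₊₁` of the bar resolution:
`a ⊗ (a' ⊗ x ⊗ b') ⊗ b ↦ a a' ⊗ x ⊗ b' b - a ⊗ ∂ₙ(a' ⊗ x ⊗ b') ⊗ b`, so that
`∂ₙ(a₀ ⊗ ⋯ ⊗ aₙ ⊗ m ⊗ bₙ ⊗ ⋯ ⊗ b₀)` is the alternating sum, for `i < n`, of the
`(-1)ⁱ a₀ ⊗ ⋯ ⊗ aᵢ aᵢ₊₁ ⊗ ⋯ ⊗ m ⊗ ⋯ ⊗ bᵢ₊₁ bᵢ ⊗ ⋯ ⊗ b₀`, plus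
`(-1)ⁿ a₀ ⊗ ⋯ ⊗ aₙ m bₙ ⊗ ⋯ ⊗ b₀`. -/
lemma barD_succ_apply (M : HopfBimod k A) (n : ℕ) (a a' b b' : A)
    (x : (barX (indLR k A) M n).carrier) :
    (barD (actLR k A) M (n + 1)).lin (indTmul k A a (indTmul k A a' x b') b) =
      indTmul k A (a * a') x (b' * b) -
        indTmul k A a ((barD (actLR k A) M n).lin (indTmul k A a' x b')) b := rfl

/-- The differential `∂⁻¹` of the cobar resolution: `n ↦ ∑ n₋₁ ⊗ n₀ ⊗ n₁`. -/
lemma cobarD_zero_apply (N : HopfBimod k A) (n : N) : (cobarD (coactLR k A) N 0).lin n =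
    (show (coindLR k A).obj N from
      (TensorProduct.assoc k A N A).symm (N.rcoact.lTensor A (N.lcoact n))) := rfl

lemma coactLR_app_tmul {X : HopfBimod k A} (a b : A) (x : X) :
    Hom.lin ((coactLR k A).app ((coindLR k A).obj X)) (coindTmul k A a x b) =
      (show (coindLR k A).obj ((coindLR k A).obj X) from
        ∑ i ∈ (ℛ k a).index, ∑ j ∈ (ℛ k b).index,
          coindTmul k A ((ℛ k a).left i)
            (coindTmul k A ((ℛ k a).right i) x ((ℛ k b).left j)) ((ℛ k b).right j)) := by
  change coactSnd A (coactSnd (A ⊗[k] X) (comul (R := k) (A := A)))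
    (coactFst (coactFst (comul (R := k) (A := A)) X) A ((a ⊗ₜ x) ⊗ₜ b)) =
    ∑ i ∈ (ℛ k a).index, ∑ j ∈ (ℛ k b).index,
      ((ℛ k a).left i ⊗ₜ[k] (((ℛ k a).right i ⊗ₜ[k] x) ⊗ₜ[k] (ℛ k b).left j)) ⊗ₜ[k]
        (ℛ k b).right j
  simp only [coactSnd, coactFst, LinearMap.comp_apply, LinearMap.rTensor_tmul]
  conv_lhs => rw [← (ℛ k a).eq]
  simp only [TensorProduct.sum_tmul, map_sum, LinearMap.comp_apply, LinearMap.lTensor_tmul,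
    LinearEquiv.coe_coe, TensorProduct.assoc_tmul]
  refine Finset.sum_congr rfl fun i _ => ?_
  conv_lhs => rw [← (ℛ k b).eq]
  simp only [TensorProduct.tmul_sum, map_sum, TensorProduct.assoc_symm_tmul]

/-- The differentials `∂ⁿ : C^n(N) → C^{n+1}(N)` of the cobar resolution, for `n ≥ 0`:
`a ⊗ x ⊗ b ↦ ∑ a⁽¹⁾ ⊗ (a⁽²⁾ ⊗ x ⊗ b⁽¹⁾) ⊗ b⁽²⁾ - a ⊗ ∂ⁿ⁻¹(x) ⊗ b`, so that
`∂ᵖ(a₀ ⊗ ⋯ ⊗ aₚ ⊗ n ⊗ bₚ ⊗ ⋯ ⊗ b₀)` is the alternating sum, for `i ≤ p`, of the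
`(-1)ⁱ a₀ ⊗ ⋯ ⊗ Δ(aᵢ) ⊗ ⋯ ⊗ n ⊗ ⋯ ⊗ Δ(bᵢ) ⊗ ⋯ ⊗ b₀`, plus
`(-1)ᵖ⁺¹ ∑ a₀ ⊗ ⋯ ⊗ aₚ ⊗ n₋₁ ⊗ n₀ ⊗ n₁ ⊗ bₚ ⊗ ⋯ ⊗ b₀`. -/
lemma cobarD_succ_apply (N : HopfBimod k A) (n : ℕ) (a b : A)
    (x : (cobarX (coindLR k A) N n).carrier) :
    (cobarD (coactLR k A) N (n + 1)).lin (coindTmul k A a x b) =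
      (show (coindLR k A).obj ((coindLR k A).obj (cobarX (coindLR k A) N n)) from
        ∑ i ∈ (ℛ k a).index, ∑ j ∈ (ℛ k b).index,
          coindTmul k A ((ℛ k a).left i)
            (coindTmul k A ((ℛ k a).right i) x ((ℛ k b).left j)) ((ℛ k b).right j)) -
      coindTmul k A (M := (coindLR k A).obj (cobarX (coindLR k A) N n)) a
        ((cobarD (coactLR k A) N n).lin x) b :=
  congr($(coactLR_app_tmul k A a b x) - coindTmul k A (M := (coindLR k A).obj (cobarX (coindLR k A) N n)) a
        ((cobarD (coactLR k A) N n).lin x) b)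

end HopfBimod

open HopfBimod

section

variable {k A : Type u} [Field k] [Ring A] [HopfAlgebra k A]

/-- The Gerstenhaber-Schack cohomology `H_GS^n(M, N)` of Hopf bimodules: the cohomology of the
total complex of the double complex `Hom_{A4} (B_q(M), C^p(N))`, for `p, q ≥ 0`, where `B(M)` is the
bar resolution of `M`, with `B_q(M) = A^{⊗ q+1} ⊗ M ⊗ A^{⊗ q+1}`, and `C(N)` is the cobar resolution
of `N`, with `C^p(N) = A^{⊗ p+1} ⊗ N ⊗ A^{⊗ p+1}`. -/
def HGS (M N : HopfBimod k A) (n : ℕ) : ModuleCat.{u} k :=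
  homTotalCohomology k (actLR k A) (coactLR k A) M N n

variable (k A) in
/-- The Gerstenhaber-Schack cohomology `H_b^n(A, A)` of a Hopf algebra: the cohomology of the
total complex of the double complex `Hom_{A4} (Bar_q(A), Cob^p(A))`, for `p, q ≥ 0`, where `Bar(A)`
is the bar resolution of `A`, with `Bar_q(A) = A^{⊗ q+2}`, and `Cob(A)` is its cobar resolution,
with `Cob^p(A) = A^{⊗ p+2}`. -/
def Hb (n : ℕ) : ModuleCat.{u} k :=
  homTotalCohomology k (actL k A) (coactL k A) (regular k A) (regular k A) n

end

end GS

end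

/-! Fix N and regard both sides as contravariant functors of M.

Since A is finite-dimensional, a coaction is the same thing as an action of A^* by contraction
(`sliceL_ext`, `coactOfL`), and the commutation rule of X is the compatibility of actions with
coactions, solved for the other order of the factors with the help of S and S⁻¹ (`unstraightenL`,
`unstraightenR`). Hence Hopf bimodules are the X-modules: `toXFunctor` is fully faithful and every
X-module is isomorphic to a value of it (`toXOfX`). In particular every M is the end of an exact
sequence 0 → K → P → M → 0 of Hopf bimodules with P projective over X (`exists_isSES`).

Three properties of the double complex Hom(B_q(M), C^p(N)) then give the theorem by dimension
shifting. In degree 0 its total cohomology is Hom(M, N), because B_1 → B_0 → M → 0 and 0 → N → C^0 →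
C^1 are exact (`IsAdmissible.zeroEquiv`). A short exact sequence in M gives a short exact sequence
of double complexes (`IsAdmissible.isShortExact`). If P is projective, the cohomology vanishes in
positive degrees (`IsAdmissible.isZero_of_projective`): the augmented bar complex of P is
contractible by morphisms of Hopf bimodules, so that only Hom(P, C^•) remains, and this is exact in
positive degrees because the cobar resolution is exact. Consequently both theories in degree n + 1
at M are the cokernel of the map from degree n at P to degree n at K (`DoubleCx.homologyShift`,
`extShift`), and induction on n concludes.

The point with real content is the second property, namely that a morphism A ⊗ K → A ⊗ Y extends
along an injection K → P (`exists_extension_indL`). The left action on A ⊗ K is free and the left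
coaction on A ⊗ Y is cofree, so such a morphism amounts to a linear map K → Y respecting the right
action and the right coaction. By the fundamental theorem, a right Hopf module V is V^{co A} ⊗ A, so
such maps are given by arbitrary linear maps between coinvariants and extend along injections;
`average` performs the extension directly.

The two cohomologies of the statement differ only in the functors M ↦ A ⊗ M ⊗ A and M ↦ A ⊗ M on
which the complexes are built. `IsAdmissible` collects what the argument needs of these functors,
and the two-sided case reduces to the one-sided one by moving parentheses. -/

noncomputable section

/-! ### Double complexes of vector spaces and their total complexes -/

namespace GS

/-- A first quadrant double cochain complex of vector spaces, with commuting differentials. -/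
structure DoubleCx (k : Type u) [Field k] where
  /-- The terms. -/
  X : ℕ → ℕ → Type u
  [addCommGroup : ∀ q p, AddCommGroup (X q p)]
  [module : ∀ q p, Module k (X q p)]
  /-- The horizontal differential. -/
  dh : ∀ q p, X q p →ₗ[k] X (q + 1) p
  /-- The vertical differential. -/
  dv : ∀ q p, X q p →ₗ[k] X q (p + 1)
  dh_dh : ∀ q p x, dh (q + 1) p (dh q p x) = 0
  dv_dv : ∀ q p x, dv q (p + 1) (dv q p x) = 0
  dh_dv : ∀ q p x, dh q (p + 1) (dv q p x) = dv (q + 1) p (dh q p x)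

attribute [instance] DoubleCx.addCommGroup DoubleCx.module

namespace DoubleCx

variable {k : Type u} [Field k] (D E : DoubleCx k)

/-- The cochains of degree `n` of the total complex. -/
abbrev Cochain (n : ℕ) : Type u := ∀ i : {i : ℕ × ℕ // i.1 + i.2 = n}, D.X i.1.1 i.1.2

/-- The component of bidegree `(q, p)` of a cochain. -/
abbrev comp {n : ℕ} (q p : ℕ) (h : q + p = n) : D.Cochain n →ₗ[k] D.X q p :=
  LinearMap.proj (⟨(q, p), h⟩ : {i : ℕ × ℕ // i.1 + i.2 = n})

/-- The horizontal part of the total differential. -/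
def hPart (n : ℕ) : ∀ q p : ℕ, q + p = n + 1 → (D.Cochain n →ₗ[k] D.X q p)
  | 0, _, _ => 0
  | q + 1, p, h => D.dh q p ∘ₗ D.comp q p (by omega)

/-- The vertical part of the total differential. -/
def vPart (n : ℕ) : ∀ q p : ℕ, q + p = n + 1 → (D.Cochain n →ₗ[k] D.X q p)
  | _, 0, _ => 0
  | q, p + 1, h => (-1 : k) ^ q • (D.dv q p ∘ₗ D.comp q p (by omega))

/-- The total differential. -/
def totD (n : ℕ) : D.Cochain n →ₗ[k] D.Cochain (n + 1) :=
  LinearMap.pi fun i => D.hPart n i.1.1 i.1.2 i.2 + D.vPart n i.1.1 i.1.2 i.2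

lemma totD_apply {n : ℕ} (x : D.Cochain n) (q p : ℕ) (h : q + p = n + 1) :
    D.totD n x ⟨(q, p), h⟩ = D.hPart n q p h x + D.vPart n q p h x := rfl

@[simp] lemma hPart_zero (n p : ℕ) (h : 0 + p = n + 1) (x : D.Cochain n) :
    D.hPart n 0 p h x = 0 := rfl

@[simp] lemma hPart_succ (n q p : ℕ) (h : q + 1 + p = n + 1) (x : D.Cochain n) :
    D.hPart n (q + 1) p h x = D.dh q p (x ⟨(q, p), by omega⟩) := rfl

@[simp] lemma vPart_zero (n q : ℕ) (h : q + 0 = n + 1) (x : D.Cochain n) :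
    D.vPart n q 0 h x = 0 := by cases q <;> rfl

@[simp] lemma vPart_succ (n q p : ℕ) (h : q + (p + 1) = n + 1) (x : D.Cochain n) :
    D.vPart n q (p + 1) h x = (-1 : k) ^ q • D.dv q p (x ⟨(q, p), by omega⟩) := by
  cases q <;> rfl

lemma totD_totD (n : ℕ) (x : D.Cochain n) : D.totD (n + 1) (D.totD n x) = 0 := by
  funext ⟨⟨q, p⟩, h⟩
  change q + p = n + 1 + 1 at h
  rw [totD_apply]
  rcases q with _ | q <;> rcases p with _ | p
  · omega
  · simp only [hPart_zero, vPart_succ, totD_apply]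
    rcases p with _ | p
    · omega
    · simp [D.dv_dv]
  · simp only [hPart_succ, vPart_zero, totD_apply]
    rcases q with _ | q
    · omega
    · simp [D.dh_dh]
  · simp only [hPart_succ, vPart_succ, totD_apply, map_add]
    -- The two pure terms vanish. The mixed ones cancel because the vertical sign changes from
    -- (-1)^q to (-1)^(q+1) after a horizontal step.
    have h1 : D.dh q (p + 1) (D.hPart n q (p + 1) (by omega) x) = 0 := by
      rcases q with _ | q
      · simp
      · simp [D.dh_dh]
    have h2 : D.dv (q + 1) p (D.vPart n (q + 1) p (by omega) x) = 0 := by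
      rcases p with _ | p
      · simp
      · simp [D.dv_dv]
    rw [h1, h2]
    simp [D.dh_dv, pow_succ]

/-- The total complex. -/
def tot : CochainComplex (ModuleCat.{u} k) ℕ :=
  CochainComplex.of (fun n => ModuleCat.of k (D.Cochain n)) (fun n => ModuleCat.ofHom (D.totD n))
    (fun n => ModuleCat.hom_ext (LinearMap.ext fun x => D.totD_totD n x))

lemma tot_d (n : ℕ) : D.tot.d n (n + 1) = ModuleCat.ofHom (D.totD n) :=
  CochainComplex.of_d (fun n => ModuleCat.of k (D.Cochain n)) (fun n => ModuleCat.ofHom (D.totD n)) n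

/-- Morphisms of double complexes. -/
structure Hom where
  /-- The components. -/
  f : ∀ q p, D.X q p →ₗ[k] E.X q p
  comm_h : ∀ q p x, f (q + 1) p (D.dh q p x) = E.dh q p (f q p x)
  comm_v : ∀ q p x, f q (p + 1) (D.dv q p x) = E.dv q p (f q p x)

variable {D E}

/-- The map on cochains induced by a morphism of double complexes. -/
def Hom.cochain (φ : Hom D E) (n : ℕ) : D.Cochain n →ₗ[k] E.Cochain n :=
  LinearMap.pi fun i => φ.f i.1.1 i.1.2 ∘ₗ LinearMap.proj i

lemma Hom.cochain_apply (φ : Hom D E) (n : ℕ) (x : D.Cochain n) (q p : ℕ) (h : q + p = n) :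
    φ.cochain n x ⟨(q, p), h⟩ = φ.f q p (x ⟨(q, p), h⟩) := rfl

lemma Hom.cochain_totD (φ : Hom D E) (n : ℕ) (x : D.Cochain n) :
    E.totD n (φ.cochain n x) = φ.cochain (n + 1) (D.totD n x) := by
  funext ⟨⟨q, p⟩, h⟩
  change q + p = n + 1 at h
  rw [totD_apply, φ.cochain_apply, totD_apply, map_add]
  congr 1
  · rcases q with _ | q
    · simp
    · simp [φ.cochain_apply, φ.comm_h]
  · rcases p with _ | p
    · simp
    · simp [φ.cochain_apply, φ.comm_v]

/-- The morphism of total complexes induced by a morphism of double complexes. -/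
def Hom.tot (φ : Hom D E) : D.tot ⟶ E.tot :=
  CochainComplex.ofHom (fun n => ModuleCat.ofHom (φ.cochain n)) (fun n => by
    rw [tot_d, tot_d]
    exact ModuleCat.hom_ext (LinearMap.ext fun x => φ.cochain_totD n x))

/-! ### Short exact sequences of double complexes and dimension shifting -/

/-- A short exact sequence of double complexes. -/
structure IsShortExact {D₁ D₂ D₃ : DoubleCx k} (φ : Hom D₁ D₂) (ψ : Hom D₂ D₃) : Prop where
  injective : ∀ q p, Function.Injective (φ.f q p)
  exact : ∀ q p, Function.Exact (φ.f q p) (ψ.f q p)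
  surjective : ∀ q p, Function.Surjective (ψ.f q p)

section ShortExact

variable {D₁ D₂ D₃ : DoubleCx k} {φ : Hom D₁ D₂} {ψ : Hom D₂ D₃} (h : IsShortExact φ ψ)

include h in
lemma IsShortExact.tot_comp : φ.tot ≫ ψ.tot = 0 :=
  HomologicalComplex.hom_ext _ _ fun n => ModuleCat.hom_ext <| LinearMap.ext fun x => by
    funext ⟨⟨q, p⟩, hqp⟩
    exact (h.exact q p).apply_apply_eq_zero (x ⟨(q, p), hqp⟩)

/-- The short complex of total complexes. -/
def totShortComplex (h : IsShortExact φ ψ) : ShortComplex (CochainComplex (ModuleCat.{u} k) ℕ) :=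
  ShortComplex.mk φ.tot ψ.tot h.tot_comp

lemma totShortComplex_shortExact : (totShortComplex h).ShortExact := by
  apply HomologicalComplex.shortExact_of_degreewise_shortExact
  intro n
  refine ModuleCat.shortComplex_shortExact _ ?_ ?_ ?_
  · intro y
    constructor
    · intro hy
      choose x hx using fun i : {i : ℕ × ℕ // i.1 + i.2 = n} =>
        (h.exact i.1.1 i.1.2 (y i)).1 (congrFun hy i)
      exact ⟨x, funext hx⟩
    · rintro ⟨x, rfl⟩
      exact funext fun i => (h.exact i.1.1 i.1.2).apply_apply_eq_zero (x i)
  · intro x y hxy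
    exact funext fun i => h.injective i.1.1 i.1.2 (congrFun hxy i)
  · intro y
    choose x hx using fun i : {i : ℕ × ℕ // i.1 + i.2 = n} => h.surjective i.1.1 i.1.2 (y i)
    exact ⟨x, funext hx⟩

/-- Dimension shifting in the long exact cohomology sequence. -/
def homologyShift (n : ℕ) (h0 : Limits.IsZero (D₂.tot.homology (n + 1))) :
    (D₃.tot.homology n ⧸ LinearMap.range (HomologicalComplex.homologyMap ψ.tot n).hom) ≃ₗ[k]
      D₁.tot.homology (n + 1) := by
  have hS := totShortComplex_shortExact h
  have hij : (ComplexShape.up ℕ).Rel n (n + 1) := rfl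
  -- The connecting map is onto because the next term of the long exact sequence is zero, and its
  -- kernel is the image of the cohomology of `D₂`.
  have hex := hS.homology_exact₃ n (n + 1) hij
  have hepi : Epi (hS.δ n (n + 1) hij) := hS.epi_δ n (n + 1) hij h0
  refine (Submodule.quotEquivOfEq _ _ ?_).trans
    ((hS.δ n (n + 1) hij).hom.quotKerEquivOfSurjective
      ((ModuleCat.epi_iff_surjective _).1 hepi))
  exact hex.moduleCat_range_eq_ker

end ShortExact

/-! ### Acyclicity of total complexes with exact rows -/

section Acyclic

variable (D) in
/-- The solution of the equations `dy = x` in bidegrees `(q + 1, p)`, given solutions `s` of the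
equations in each row. -/
def chase {n : ℕ} (s : ∀ q p, D.X (q + 1) p → D.X q p) (x : D.Cochain (n + 1)) :
    ∀ p q : ℕ, q + p = n → D.X q p
  | 0, q, h => s q 0 (x ⟨(q + 1, 0), by omega⟩)
  | p + 1, q, h => s q (p + 1) (x ⟨(q + 1, p + 1), by omega⟩ -
      (-1 : k) ^ (q + 1) • D.dv (q + 1) p (chase s x p (q + 1) (by omega)))

/-- It is enough that the argument given to `s` is a horizontal cocycle. This follows from the
component of dx = 0 in bidegree (q + 2, p), combined with the equation already solved one step lower
in p and one step higher in q, and with the commutation of the two differentials. As a result, x and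
the total differential of the family `chase` agree in every bidegree with positive first index. -/
lemma dh_chase {n : ℕ} (s : ∀ q p, D.X (q + 1) p → D.X q p)
    (hs : ∀ q p z, D.dh (q + 1) p z = 0 → D.dh q p (s q p z) = z) (x : D.Cochain (n + 1))
    (hx : D.totD (n + 1) x = 0) : ∀ (p q : ℕ) (h : q + p = n),
    D.dh q p (D.chase s x p q h) = x ⟨(q + 1, p), by omega⟩ -
      D.vPart n (q + 1) p (by omega) fun i => D.chase s x i.1.2 i.1.1 i.2
  | 0, q, h => by
    have h0 := congrFun hx ⟨(q + 2, 0), by omega⟩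
    rw [totD_apply, hPart_succ, vPart_zero] at h0
    rw [chase, vPart_zero, sub_zero, hs]
    exact (add_zero _).symm.trans h0
  | p + 1, q, h => by
    have h0 := congrFun hx ⟨(q + 2, p + 1), by omega⟩
    rw [totD_apply, hPart_succ, vPart_succ] at h0
    have ih := dh_chase s hs x hx p (q + 1) (by omega)
    have h1 : ∀ q' h', D.dv q' p (D.vPart n q' p h' fun i => D.chase s x i.1.2 i.1.1 i.2) = 0 := by
      intro q' h'
      rcases p with _ | p
      · simp
      · simp [D.dv_dv]
    rw [chase, vPart_succ, hs]
    rw [map_sub, map_smul, D.dh_dv, ih, map_sub, h1, sub_zero, sub_eq_zero]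
    rw [eq_neg_of_add_eq_zero_left h0, pow_succ _ (q + 1)]
    simp

/-- If the rows are exact in positive degrees, and the complex of the kernels of the first
differentials of the rows is exact in positive degrees, then the total complex is exact in positive
degrees. -/
lemma exists_totD_eq
    (hrow : ∀ q p (z : D.X (q + 1) p), D.dh (q + 1) p z = 0 → ∃ y, D.dh q p y = z)
    (hcol : ∀ p (z : D.X 0 (p + 1)), D.dh 0 (p + 1) z = 0 → D.dv 0 (p + 1) z = 0 →
      ∃ w, D.dh 0 p w = 0 ∧ D.dv 0 p w = z)
    (n : ℕ) (x : D.Cochain (n + 1)) (hx : D.totD (n + 1) x = 0) : ∃ y, D.totD n y = x := by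
  -- The cocycle condition is moved inside the existential so that `choose` yields a function
  -- defined on all elements, as `chase` requires; the value 0 off the cocycles plays no role.
  have : ∀ q p (z : D.X (q + 1) p), ∃ y, D.dh (q + 1) p z = 0 → D.dh q p y = z := by
    intro q p z
    by_cases hz : D.dh (q + 1) p z = 0
    · obtain ⟨y, hy⟩ := hrow q p z hz
      exact ⟨y, fun _ => hy⟩
    · exact ⟨0, fun h => absurd h hz⟩
  choose s hs using this
  let y : D.Cochain n := fun i => D.chase s x i.1.2 i.1.1 i.2
  -- Subtracting dy leaves a cocycle concentrated in bidegree (0, n + 1). Its entry there is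
  -- therefore killed by both differentials, which is the situation of `hcol`.
  obtain ⟨x', hx'⟩ : ∃ x', x' = x - D.totD n y := ⟨_, rfl⟩
  have hd : D.totD (n + 1) x' = 0 := by rw [hx', map_sub, hx, totD_totD, sub_zero]
  have hz : ∀ q p h, x' ⟨(q + 1, p), h⟩ = 0 := by
    intro q p h
    change q + 1 + p = n + 1 at h
    rw [hx', Pi.sub_apply, totD_apply, hPart_succ]
    change _ - (D.dh q p (D.chase s x p q _) + _) = 0
    rw [dh_chase s hs x hx p q (by omega)]
    simp [y]
  have h1 : D.dh 0 (n + 1) (x' ⟨(0, n + 1), by omega⟩) = 0 := by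
    have := congrFun hd ⟨(1, n + 1), by omega⟩
    rw [totD_apply, hPart_succ, vPart_succ, hz] at this
    simpa using this
  have h2 : D.dv 0 (n + 1) (x' ⟨(0, n + 1), by omega⟩) = 0 := by
    have := congrFun hd ⟨(0, n + 2), by omega⟩
    rw [totD_apply, hPart_zero, vPart_succ] at this
    simpa using this
  obtain ⟨w, hw, hw'⟩ := hcol n _ h1 h2
  -- As w is a horizontal cocycle, placing it in bidegree (0, n) adds nothing outside the column q =
  -- 0.
  refine ⟨y + Pi.single ⟨(0, n), by omega⟩ w, ?_⟩
  rw [map_add, ← eq_sub_iff_add_eq', ← hx']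
  funext ⟨⟨q, p⟩, h⟩
  change q + p = n + 1 at h
  rw [totD_apply]
  rcases q with _ | q
  · obtain rfl : p = n + 1 := by omega
    rw [hPart_zero, vPart_succ, Pi.single_eq_same, hw']
    simp
  · rw [hPart_succ, hz]
    have hv : D.vPart n (q + 1) p h (Pi.single ⟨(0, n), by omega⟩ w) = 0 := by
      rcases p with _ | p
      · simp
      · rw [vPart_succ, Pi.single_eq_of_ne (by simp)]
        simp
    rw [hv, add_zero]
    rcases q with _ | q
    · obtain rfl : p = n := by omega
      rw [Pi.single_eq_same, hw]
    · rw [Pi.single_eq_of_ne (by simp), map_zero]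

variable (D) in
lemma tot_homology_isZero (n : ℕ)
    (h : ∀ x : D.Cochain (n + 1), D.totD (n + 1) x = 0 → ∃ y, D.totD n y = x) :
    Limits.IsZero (D.tot.homology (n + 1)) := by
  rw [← HomologicalComplex.exactAt_iff_isZero_homology,
    HomologicalComplex.exactAt_iff' _ n (n + 1) (n + 2) (by simp) (by simp),
    ShortComplex.moduleCat_exact_iff]
  intro x hx
  change D.Cochain (n + 1) at x
  change (D.tot.d (n + 1) (n + 1 + 1)).hom x = 0 at hx
  change ∃ y, (D.tot.d n (n + 1)).hom y = x
  rw [tot_d] at hx ⊢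
  exact h x hx

end Acyclic

/-! ### Cohomology in degree 0 -/

section HomologyZero

variable {V W : Type u} [AddCommGroup V] [Module k V] [AddCommGroup W] [Module k W]

/-- An augmentation of a double complex, as a map to the cochains of degree `0`. -/
def augCochain (a : V →ₗ[k] D.X 0 0) : V →ₗ[k] D.Cochain 0 :=
  LinearMap.pi fun i => match i with
    | ⟨(0, 0), _⟩ => a
    | ⟨(_ + 1, _), h⟩ => absurd h (by omega)
    | ⟨(_, _ + 1), h⟩ => absurd h (by omega)

lemma totD_zero_eq_zero_iff (x : D.Cochain 0) : D.totD 0 x = 0 ↔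
    D.dh 0 0 (x ⟨(0, 0), rfl⟩) = 0 ∧ D.dv 0 0 (x ⟨(0, 0), rfl⟩) = 0 := by
  have h1 : D.totD 0 x ⟨(1, 0), rfl⟩ = D.dh 0 0 (x ⟨(0, 0), rfl⟩) := by
    rw [totD_apply, hPart_succ, vPart_zero]
    exact add_zero _
  have h2 : D.totD 0 x ⟨(0, 1), rfl⟩ = D.dv 0 0 (x ⟨(0, 0), rfl⟩) := by
    rw [totD_apply, hPart_zero, vPart_succ, pow_zero, one_smul]
    exact zero_add _
  rw [← h1, ← h2]
  constructor
  · intro h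
    simp [h]
  · rintro ⟨h, h'⟩
    funext ⟨⟨q, p⟩, hqp⟩
    change q + p = 1 at hqp
    obtain ⟨rfl, rfl⟩ | ⟨rfl, rfl⟩ : (q = 1 ∧ p = 0) ∨ (q = 0 ∧ p = 1) := by omega
    · exact h
    · exact h'

/-- An augmentation of a double complex, as a morphism to the total complex. -/
def augHom (a : V →ₗ[k] D.X 0 0) : ModuleCat.of k V ⟶ D.tot.X 0 := ModuleCat.ofHom (augCochain a)

/-- An augmentation of a double complex, as a map to the cocycles of degree `0`. -/
def augCycles (a : V →ₗ[k] D.X 0 0) (h : ∀ v, D.dh 0 0 (a v) = 0 ∧ D.dv 0 0 (a v) = 0) :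
    ModuleCat.of k V ⟶ D.tot.cycles 0 :=
  D.tot.liftCycles (augHom a) 1 (by simp) (by
    rw [tot_d]
    exact ModuleCat.hom_ext (LinearMap.ext fun v => (totD_zero_eq_zero_iff _).2 (h v)))

lemma augCycles_i (a : V →ₗ[k] D.X 0 0) (h : ∀ v, D.dh 0 0 (a v) = 0 ∧ D.dv 0 0 (a v) = 0) :
    augCycles a h ≫ D.tot.iCycles 0 = augHom a := D.tot.liftCycles_i _ _ _ _

/-- An augmentation of a double complex, as a map to the cohomology in degree `0`. -/
def augHomology (a : V →ₗ[k] D.X 0 0) (h : ∀ v, D.dh 0 0 (a v) = 0 ∧ D.dv 0 0 (a v) = 0) :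
    ModuleCat.of k V ⟶ D.tot.homology 0 :=
  augCycles a h ≫ D.tot.homologyπ 0

/-- No differential enters degree 0, so the cohomology there is the space of cocycles. These are the
elements of bidegree (0, 0) killed by both differentials, and `ha'` says that the augmentation
reaches all of them. -/
lemma augHomology_bijective (a : V →ₗ[k] D.X 0 0)
    (h : ∀ v, D.dh 0 0 (a v) = 0 ∧ D.dv 0 0 (a v) = 0) (ha : Function.Injective a)
    (ha' : ∀ x, D.dh 0 0 x = 0 → D.dv 0 0 x = 0 → ∃ v, a v = x) :
    Function.Bijective (augHomology a h).hom := by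
  have h1 : IsIso (D.tot.homologyπ 0) := D.tot.isIso_homologyπ _ 0 rfl (by
    apply HomologicalComplex.shape
    simp)
  have h2 : Function.Bijective (D.tot.homologyπ 0).hom :=
    (ConcreteCategory.isIso_iff_bijective _).1 h1
  have h3 : Function.Injective (D.tot.iCycles 0).hom :=
    (ModuleCat.mono_iff_injective _).1 inferInstance
  have h4 : ∀ v, (D.tot.iCycles 0).hom ((augCycles a h).hom v) = augCochain a v := fun v =>
    congr(($(augCycles_i a h)).hom v)
  refine h2.comp ⟨fun v w hvw => ha ?_, fun z => ?_⟩
  · have := (h4 v).symm.trans ((congrArg (D.tot.iCycles 0).hom hvw).trans (h4 w))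
    exact congrFun this ⟨(0, 0), rfl⟩
  · have hz : (D.tot.d 0 (0 + 1)).hom ((D.tot.iCycles 0).hom z) = 0 :=
      congr(($(D.tot.iCycles_d 0 1)).hom z)
    rw [tot_d] at hz
    obtain ⟨hz1, hz2⟩ := (totD_zero_eq_zero_iff _).1 hz
    obtain ⟨v, hv⟩ := ha' _ hz1 hz2
    refine ⟨v, h3 ((h4 v).trans ?_)⟩
    funext ⟨⟨q, p⟩, hqp⟩
    change q + p = 0 at hqp
    obtain ⟨rfl, rfl⟩ : q = 0 ∧ p = 0 := by omega
    exact hv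

lemma augHomology_naturality (φ : Hom D E) (a : V →ₗ[k] D.X 0 0)
    (h : ∀ v, D.dh 0 0 (a v) = 0 ∧ D.dv 0 0 (a v) = 0) (b : W →ₗ[k] E.X 0 0)
    (h' : ∀ v, E.dh 0 0 (b v) = 0 ∧ E.dv 0 0 (b v) = 0) (f : V →ₗ[k] W)
    (hf : ∀ v, φ.f 0 0 (a v) = b (f v)) :
    augHomology a h ≫ HomologicalComplex.homologyMap φ.tot 0 =
      ModuleCat.ofHom f ≫ augHomology b h' := by
  rw [augHomology, augHomology, Category.assoc, HomologicalComplex.homologyπ_naturality,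
    ← Category.assoc, ← Category.assoc]
  congr 1
  rw [← cancel_mono (E.tot.iCycles 0), Category.assoc, Category.assoc, augCycles_i,
    HomologicalComplex.cyclesMap_i, ← Category.assoc, augCycles_i]
  refine ModuleCat.hom_ext (LinearMap.ext fun v => ?_)
  funext ⟨⟨q, p⟩, hqp⟩
  change q + p = 0 at hqp
  obtain ⟨rfl, rfl⟩ : q = 0 ∧ p = 0 := by omega
  exact hf v

end HomologyZero

/-! ### Comparison with the total complex of a bicomplex -/

section Bicomplex

variable (D)

instance fintypeAntidiagonal (n : ℕ) : Fintype {i : ℕ × ℕ // i.1 + i.2 = n} :=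
  Fintype.subtype (Finset.HasAntidiagonal.antidiagonal n) fun _ => Finset.HasAntidiagonal.mem_antidiagonal

/-- Maps out of a categorical total complex are determined on the individual summands, so the
comparison needs the differential of an element concentrated in one bidegree. -/
lemma totD_single (n q p : ℕ) (h : q + p = n) (x : D.X q p) :
    D.totD n (Pi.single ⟨(q, p), h⟩ x) =
      Pi.single ⟨(q + 1, p), by omega⟩ (D.dh q p x) +
        Pi.single ⟨(q, p + 1), by omega⟩ ((-1 : k) ^ q • D.dv q p x) := by
  funext ⟨⟨q', p'⟩, h'⟩
  change q' + p' = n + 1 at h'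
  rw [totD_apply, Pi.add_apply]
  congr 1
  · rcases q' with _ | q'
    · rw [hPart_zero, Pi.single_eq_of_ne (by simp)]
    · rw [hPart_succ]
      by_cases hq : q' = q
      · obtain rfl := hq
        obtain rfl : p' = p := by omega
        rw [Pi.single_eq_same, Pi.single_eq_same]
      · rw [Pi.single_eq_of_ne (by simp [hq]), Pi.single_eq_of_ne (by simp [hq]), map_zero]
  · rcases p' with _ | p'
    · rw [vPart_zero, Pi.single_eq_of_ne (by simp)]
    · rw [vPart_succ]
      by_cases hq : p' = p
      · obtain rfl := hq
        obtain rfl : q' = q := by omega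
        rw [Pi.single_eq_same, Pi.single_eq_same]
      · rw [Pi.single_eq_of_ne (by simp [hq]), Pi.single_eq_of_ne (by simp [hq]), map_zero,
          smul_zero]

variable (K : HomologicalComplex₂ (ModuleCat.{u} k) (ComplexShape.up ℕ) (ComplexShape.up ℕ))
  (e : ∀ q p, (K.X q).X p ≅ ModuleCat.of k (D.X q p))

/-- The inclusion of a term in the total complex. -/
def ιTot (n q p : ℕ) (h : q + p = n) : ModuleCat.of k (D.X q p) ⟶ D.tot.X n :=
  ModuleCat.ofHom (LinearMap.single k (fun i : {i : ℕ × ℕ // i.1 + i.2 = n} => D.X i.1.1 i.1.2)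
    ⟨(q, p), h⟩)

/-- The projection from the total complex to a term. -/
def πTot (n q p : ℕ) (h : q + p = n) : D.tot.X n ⟶ ModuleCat.of k (D.X q p) :=
  ModuleCat.ofHom (D.comp q p h)

lemma ιTot_πTot (n q p : ℕ) (h : q + p = n) : D.ιTot n q p h ≫ D.πTot n q p h = 𝟙 _ :=
  ModuleCat.hom_ext (LinearMap.ext fun x => Pi.single_eq_same
    (M := fun i : {i : ℕ × ℕ // i.1 + i.2 = n} => D.X i.1.1 i.1.2) ⟨(q, p), h⟩ x)

lemma ιTot_πTot_of_ne (n q p q' p' : ℕ) (h : q + p = n) (h' : q' + p' = n)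
    (hne : (q', p') ≠ (q, p)) : D.ιTot n q p h ≫ D.πTot n q' p' h' = 0 :=
  ModuleCat.hom_ext (LinearMap.ext fun x => Pi.single_eq_of_ne
    (M := fun i : {i : ℕ × ℕ // i.1 + i.2 = n} => D.X i.1.1 i.1.2) (i := ⟨(q, p), h⟩)
    (i' := ⟨(q', p'), h'⟩) (by simpa using hne) x)

lemma ιTot_d (n q p : ℕ) (h : q + p = n) : D.ιTot n q p h ≫ D.tot.d n (n + 1) =
    ModuleCat.ofHom (D.dh q p) ≫ D.ιTot (n + 1) (q + 1) p (by omega) +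
      (-1 : k) ^ q • (ModuleCat.ofHom (D.dv q p) ≫ D.ιTot (n + 1) q (p + 1) (by omega)) := by
  rw [tot_d]
  refine ModuleCat.hom_ext (LinearMap.ext fun x => (D.totD_single n q p h x).trans ?_)
  rw [Pi.single_smul]
  rfl

lemma sum_πTot_ιTot (n : ℕ) :
    ∑ i : {i : ℕ × ℕ // i.1 + i.2 = n}, D.πTot n i.1.1 i.1.2 i.2 ≫ D.ιTot n i.1.1 i.1.2 i.2 =
      𝟙 _ := by
  refine ModuleCat.hom_ext (LinearMap.ext fun x => ?_)
  rw [ModuleCat.hom_sum, LinearMap.sum_apply]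
  exact Finset.univ_sum_single x

/-- The isomorphism in each degree between the total complex of a bicomplex of vector spaces
and the total complex given by families of elements. -/
def totalXIso (n : ℕ) : (K.total (ComplexShape.up ℕ)).X n ≅ D.tot.X n where
  hom := K.totalDesc fun q p h => (e q p).hom ≫ D.ιTot n q p h
  inv := ∑ i : {i : ℕ × ℕ // i.1 + i.2 = n}, D.πTot n i.1.1 i.1.2 i.2 ≫ (e i.1.1 i.1.2).inv ≫
    K.ιTotal (ComplexShape.up ℕ) i.1.1 i.1.2 n i.2
  hom_inv_id := by
    apply HomologicalComplex₂.total.hom_ext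
    intro q p h
    change q + p = n at h
    rw [K.ι_totalDesc_assoc, Category.assoc, Preadditive.comp_sum,
      Finset.sum_eq_single ⟨(q, p), h⟩]
    · rw [← Category.assoc (D.ιTot _ _ _ _), ιTot_πTot]
      simp
    · rintro ⟨⟨q', p'⟩, h'⟩ _ hne
      rw [← Category.assoc (D.ιTot _ _ _ _), ιTot_πTot_of_ne _ _ _ _ _ _ _ _ (by simpa using hne)]
      simp
    · simp
  inv_hom_id := by
    rw [Preadditive.sum_comp, ← sum_πTot_ιTot]
    refine Finset.sum_congr rfl fun i _ => ?_
    simp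

/-- The total complex of a bicomplex of vector spaces, in terms of families of elements. -/
def totalIso
    (hh : ∀ q p, (K.d q (q + 1)).f p ≫ (e (q + 1) p).hom = (e q p).hom ≫ ModuleCat.ofHom (D.dh q p))
    (hv : ∀ q p, (K.X q).d p (p + 1) ≫ (e q (p + 1)).hom = (e q p).hom ≫ ModuleCat.ofHom (D.dv q p)) :
    K.total (ComplexShape.up ℕ) ≅ D.tot :=
  HomologicalComplex.Hom.isoOfComponents (D.totalXIso K e) (by
    rintro n _ rfl
    apply HomologicalComplex₂.total.hom_ext
    intro q p h
    change q + p = n at h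
    -- The signs come from `tensorSignsUp`: none on the horizontal differential, (-1)^q on the
    -- vertical one, exactly as in `totD`.
    have h1 : ComplexShape.ε₁ (ComplexShape.up ℕ) (ComplexShape.up ℕ) (ComplexShape.up ℕ) (q, p) = 1 := rfl
    have h2 : ComplexShape.ε₂ (ComplexShape.up ℕ) (ComplexShape.up ℕ) (ComplexShape.up ℕ) (q, p) =
      (-1 : ℤˣ) ^ q := rfl
    change _ ≫ (K.totalDesc fun q p h => (e q p).hom ≫ D.ιTot n q p h) ≫ _ =
      _ ≫ _ ≫ (K.totalDesc fun q p h => (e q p).hom ≫ D.ιTot (n + 1) q p h)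
    rw [K.ι_totalDesc_assoc, Category.assoc, ιTot_d, HomologicalComplex₂.total_d,
      Preadditive.add_comp, Preadditive.comp_add, Preadditive.comp_add, K.ι_D₁_assoc, K.ι_D₂_assoc,
      K.d₁_eq (ComplexShape.up ℕ) (i₁' := q + 1) rfl p (n + 1) (by change q + 1 + p = n + 1; omega),
      K.d₂_eq (ComplexShape.up ℕ) q (i₂' := p + 1) rfl (n + 1) (by change q + (p + 1) = n + 1; omega),
      h1, h2]
    simp only [one_smul, Category.assoc, Linear.units_smul_comp, K.ι_totalDesc]
    rw [← Category.assoc ((K.d _ _).f _), hh, ← Category.assoc ((K.X q).d _ _), hv]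
    simp only [Category.assoc]
    congr 1
    -- On one side (-1)^q is a unit of ℤ and on the other a scalar of k; splitting by parity makes
    -- them comparable.
    rcases Nat.even_or_odd q with hq | hq
    · simp [hq.neg_one_pow]
    · simp [hq.neg_one_pow])

end Bicomplex

end DoubleCx
end GS

/-! ### The subalgebras of the crossed product and their commutation relations -/

namespace GS

open HopfAlgebra WithConv

section Inclusions

variable {k H C : Type*} [Field k] [Ring H] [HopfAlgebra k H] [FiniteDimensional k H]
  [AddCommGroup C] [Module k C] [Coalgebra k C] {act : H →ₐ[k] Module.End k C}
  (hact : IsModuleCoalgebra H C act)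

/-- The subalgebra `H` of the crossed product. -/
def Crossed.inclH : H →ₐ[k] Crossed hact :=
  .ofLinearMap ((Crossed.of hact).toLinearMap ∘ₗ TensorProduct.mk k (PAlg k C) H 1) rfl
    (fun h h' => by
      simp only [LinearMap.comp_apply, LinearEquiv.coe_coe, TensorProduct.mk_apply,
        Crossed.mul_def, crossedMul_tmul, map_one, one_mul, opT_one_tmul act hact.counit])

/-- The subalgebra `C^{*op} ⊗ C^*` of the crossed product. -/
def Crossed.inclP : PAlg k C →ₐ[k] Crossed hact :=
  .ofLinearMap ((Crossed.of hact).toLinearMap ∘ₗ (TensorProduct.mk k (PAlg k C) H).flip 1) rfl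
    (fun p p' => by
      simp only [LinearMap.comp_apply, LinearEquiv.coe_coe, TensorProduct.mk_apply,
        LinearMap.flip_apply, Crossed.mul_def, crossedMul_tmul, opT_one, mul_one, opP_tmul])

lemma Crossed.inclH_apply (h : H) : Crossed.inclH hact h = Crossed.of hact (1 ⊗ₜ h) := rfl

lemma Crossed.inclP_apply (p : PAlg k C) : Crossed.inclP hact p = Crossed.of hact (p ⊗ₜ 1) := rfl

lemma Crossed.of_tmul (p : PAlg k C) (h : H) :
    Crossed.of hact (p ⊗ₜ h) = Crossed.inclP hact p * Crossed.inclH hact h := by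
  rw [inclP_apply, inclH_apply, mul_def, crossedMul_tmul, opT_one, mul_one, opP_tmul, mul_one]

lemma Crossed.inclH_mul (h : H) (x : PAlg k C ⊗[k] H) :
    Crossed.inclH hact h * Crossed.of hact x = Crossed.of hact (opT act h x) := by
  rw [inclH_apply, mul_def, crossedMul_tmul, map_one, one_mul]

lemma Crossed.inclP_mul (p : PAlg k C) (x : PAlg k C ⊗[k] H) :
    Crossed.inclP hact p * Crossed.of hact x = Crossed.of hact (opP k H C p x) := by
  rw [inclP_apply, mul_def, crossedMul_tmul, opT_one, mul_one]

/-- The tensorand `C^{*op}` of the crossed product. -/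
def Crossed.inclL : DualAlg k C →ₗ[k] Crossed hact :=
  (Crossed.inclP hact).toLinearMap ∘ₗ (PAlg.of k C).toLinearMap ∘ₗ
    (Algebra.TensorProduct.includeLeft : (DualAlg k C)ᵐᵒᵖ →ₐ[k] _).toLinearMap ∘ₗ
    (MulOpposite.opLinearEquiv k).toLinearMap

/-- The tensorand `C^*` of the crossed product. -/
def Crossed.inclR : DualAlg k C →ₗ[k] Crossed hact :=
  (Crossed.inclP hact).toLinearMap ∘ₗ (PAlg.of k C).toLinearMap ∘ₗ
    (Algebra.TensorProduct.includeRight : DualAlg k C →ₐ[k] _).toLinearMap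

lemma Crossed.inclL_apply (l : DualAlg k C) :
    Crossed.inclL hact l = Crossed.inclP hact (PAlg.tmul l 1) := rfl

lemma Crossed.inclR_apply (l : DualAlg k C) :
    Crossed.inclR hact l = Crossed.inclP hact (PAlg.tmul 1 l) := rfl

lemma Crossed.inclL_mul (l l' : DualAlg k C) :
    Crossed.inclL hact (l * l') = Crossed.inclL hact l' * Crossed.inclL hact l := by
  simp only [inclL_apply, ← map_mul, PAlg.tmul_mul, mul_one]

lemma Crossed.inclR_mul (l l' : DualAlg k C) :
    Crossed.inclR hact (l * l') = Crossed.inclR hact l * Crossed.inclR hact l' := by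
  simp only [inclR_apply, ← map_mul, PAlg.tmul_mul, mul_one]

lemma Crossed.inclP_tmul (l l' : DualAlg k C) :
    Crossed.inclP hact (PAlg.tmul l l') = Crossed.inclL hact l * Crossed.inclR hact l' := by
  simp only [inclL_apply, inclR_apply, ← map_mul, PAlg.tmul_mul, mul_one, one_mul]

lemma Crossed.commute_inclL_inclR (l l' : DualAlg k C) :
    Commute (Crossed.inclL hact l) (Crossed.inclR hact l') := by
  simp only [Commute, SemiconjBy, inclL_apply, inclR_apply, ← map_mul, PAlg.tmul_mul, mul_one,
    one_mul]

/-- Left multiplication by h is the operator `opT act h`, and left multiplication by l is `opF k H C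
l`. The operator identity `straightL_opT`, evaluated at 1 ⊗ 1, is thus a relation between elements
of the algebra, and any representation inherits it. -/
lemma Crossed.straightL : StraightL act (Crossed.inclL hact) (Crossed.inclH hact).toLinearMap := by
  intro h l
  have key : ∀ (l : DualAlg k C) (h : H),
      Crossed.inclL hact l * Crossed.inclH hact h = Crossed.of hact (opF k H C l (1 ⊗ₜ h)) :=
    fun l h => Crossed.inclP_mul hact _ _
  have h1 : Crossed.inclL hact l = Crossed.of hact (opF k H C l (1 ⊗ₜ 1)) := by
    rw [← key, map_one, mul_one]
  rw [AlgHom.toLinearMap_apply, h1, Crossed.inclH_mul, ← Module.End.mul_apply,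
    straightL_opT act hact, LinearMap.sum_apply, map_sum]
  refine Finset.sum_congr rfl fun i _ => ?_
  rw [Module.End.mul_apply, opT_one_tmul act hact.counit, mul_one]
  exact (key _ _).symm

lemma Crossed.straightR : StraightR act (Crossed.inclR hact) (Crossed.inclH hact).toLinearMap := by
  intro h l
  have key : ∀ (l : DualAlg k C) (h : H),
      Crossed.inclR hact l * Crossed.inclH hact h = Crossed.of hact (opG k H C l (1 ⊗ₜ h)) :=
    fun l h => Crossed.inclP_mul hact _ _
  have h1 : Crossed.inclR hact l = Crossed.of hact (opG k H C l (1 ⊗ₜ 1)) := by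
    rw [← key, map_one, mul_one]
  rw [AlgHom.toLinearMap_apply, h1, Crossed.inclH_mul, ← Module.End.mul_apply,
    straightR_opT act hact, LinearMap.sum_apply, map_sum]
  refine Finset.sum_congr rfl fun i _ => ?_
  rw [Module.End.mul_apply, opT_one_tmul act hact.counit, mul_one]
  exact (key _ _).symm

end Inclusions

/-! ### From straightening rules to compatibility of coactions with actions -/

section Unstraighten

variable {k H V W : Type*} [Field k] [Ring H] [HopfAlgebra k H] [AddCommGroup V] [Module k V]
  [AddCommGroup W] [Module k W]

/-- Substituting the hypothesis gives ∑ P(h⁽¹⁾ S(h⁽²⁾)) c τ(h⁽³⁾), and the antipode axiom collapses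
this to c τ(h). It will be used with c a left coaction V → A ⊗ V, P the action on A and Q the action
on V: the hypothesis is then the straightening rule, and the conclusion says that the coaction is
linear for the diagonal action. -/
lemma unstraightenL (P : H →ₐ[k] Module.End k W) (Q : H →ₗ[k] Module.End k W)
    (τ : H →ₗ[k] Module.End k V) (c : V →ₗ[k] W)
    (hQ : ∀ h, Q h ∘ₗ c = ∑ i ∈ (ℛ k h).index,
      P (antipode k ((ℛ k h).left i)) ∘ₗ c ∘ₗ τ ((ℛ k h).right i)) (h : H) :
    ∑ i ∈ (ℛ k h).index, P ((ℛ k h).left i) ∘ₗ Q ((ℛ k h).right i) ∘ₗ c = c ∘ₗ τ h := by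
  refine LinearMap.ext fun v => ?_
  -- `T` sends h⁽¹⁾ ⊗ h⁽²⁾ ⊗ h⁽³⁾ to the summand above. Applying it to the coassociativity identity
  -- changes which factor has been comultiplied twice, so that h⁽¹⁾ S(h⁽²⁾) can be summed first.
  let T : H ⊗[k] (H ⊗[k] H) →ₗ[k] W := TensorProduct.lift (P.toLinearMap.compl₂
    (TensorProduct.lift ((P.toLinearMap ∘ₗ antipode k).compl₂ (c ∘ₗ τ.flip v))))
  have hT : ∀ a b d, T (a ⊗ₜ (b ⊗ₜ d)) = P (a * antipode k b) (c (τ d v)) := fun a b d => by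
    rw [map_mul]
    rfl
  have h1 := congr(T $(Coalgebra.sum_tmul_tmul_eq (ℛ k h) (fun i => ℛ k ((ℛ k h).left i))
        (fun i => ℛ k ((ℛ k h).right i))))
  simp only [map_sum, hT] at h1
  simp only [← LinearMap.sum_apply, ← map_sum, sum_mul_antipode_eq_smul] at h1
  simp only [map_smul, map_one, LinearMap.smul_apply, Module.End.one_apply] at h1
  have h2 := congr(c (τ $(sum_counit_smul (ℛ k h)) v))
  simp only [map_sum, map_smul, LinearMap.sum_apply, LinearMap.smul_apply] at h2
  rw [LinearMap.comp_apply, ← h2, h1]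
  simp only [hQ, LinearMap.sum_apply, LinearMap.comp_apply, map_sum, map_mul, Module.End.mul_apply]

variable [FiniteDimensional k H]

/-- Applying S, which reverses products, turns this into the usual axiom ∑ h⁽¹⁾ S(h⁽²⁾) = ε(h). -/
lemma sum_mul_antipodeInv (h : H) :
    ∑ i ∈ (ℛ k h).index, (ℛ k h).right i * antipodeInv k H ((ℛ k h).left i) =
      counit (R := k) h • (1 : H) := by
  apply antipode_injective (k := k)
  simp only [map_sum, antipode_mul_antidistrib, antipode_antipodeInv, map_smul, antipode_one]
  exact sum_mul_antipode_eq_smul (ℛ k h)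

/-- The mirror image of `unstraightenL`: here ∑ P(h⁽³⁾ S⁻¹(h⁽²⁾)) c τ(h⁽¹⁾) collapses. The inverse
antipode is forced because the A-tensorand now stands on the right and receives the last factor of
the comultiplication. -/
lemma unstraightenR (P : H →ₐ[k] Module.End k W) (Q : H →ₗ[k] Module.End k W)
    (τ : H →ₗ[k] Module.End k V) (c : V →ₗ[k] W)
    (hQ : ∀ h, Q h ∘ₗ c = ∑ i ∈ (ℛ k h).index,
      P (antipodeInv k H ((ℛ k h).right i)) ∘ₗ c ∘ₗ τ ((ℛ k h).left i)) (h : H) :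
    ∑ i ∈ (ℛ k h).index, P ((ℛ k h).right i) ∘ₗ Q ((ℛ k h).left i) ∘ₗ c = c ∘ₗ τ h := by
  refine LinearMap.ext fun v => ?_
  let T : H ⊗[k] (H ⊗[k] H) →ₗ[k] W := TensorProduct.lift (LinearMap.flip
    (TensorProduct.lift (((LinearMap.mul k (Module.End k W)).flip.compl₁₂
      (P.toLinearMap ∘ₗ antipodeInv k H) P.toLinearMap)) ∘ₗ LinearMap.id |>.compl₂ (c ∘ₗ τ.flip v)))
  have hT : ∀ a b d, T (a ⊗ₜ (b ⊗ₜ d)) = P (d * antipodeInv k H b) (c (τ a v)) := fun a b d => by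
    rw [map_mul]
    rfl
  have h1 := congr(T $(Coalgebra.sum_tmul_tmul_eq (ℛ k h) (fun i => ℛ k ((ℛ k h).left i))
        (fun i => ℛ k ((ℛ k h).right i))))
  simp only [map_sum, hT] at h1
  simp only [← LinearMap.sum_apply, ← map_sum, sum_mul_antipodeInv] at h1
  simp only [map_smul, map_one, LinearMap.smul_apply, Module.End.one_apply] at h1
  have h2 := congr(c (τ $(sum_smul_counit (ℛ k h)) v))
  simp only [map_sum, map_smul, LinearMap.sum_apply, LinearMap.smul_apply] at h2
  rw [LinearMap.comp_apply, ← h2, ← h1]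
  simp only [hQ, LinearMap.sum_apply, LinearMap.comp_apply, map_sum, map_mul, Module.End.mul_apply]

end Unstraighten

/-! ### Coactions of a finite-dimensional coalgebra as actions of its dual -/

section Slices

variable {k A V : Type*} [Field k] [Ring A] [HopfAlgebra k A] [FiniteDimensional k A]
  [AddCommGroup V] [Module k V]

variable (k A V) in
/-- Contraction of the first tensorand with a linear form. -/
def sliceL (l : DualAlg k A) : A ⊗[k] V →ₗ[k] V :=
  (TensorProduct.lid k V).toLinearMap ∘ₗ (DualAlg.lin l).rTensor V

variable (k A V) in
/-- Contraction of the second tensorand with a linear form. -/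
def sliceR (l : DualAlg k A) : V ⊗[k] A →ₗ[k] V :=
  (TensorProduct.rid k V).toLinearMap ∘ₗ (DualAlg.lin l).lTensor V

@[simp] lemma sliceL_tmul (l : DualAlg k A) (a : A) (v : V) :
    sliceL k A V l (a ⊗ₜ v) = DualAlg.lin l a • v := by simp [sliceL]

@[simp] lemma sliceR_tmul (l : DualAlg k A) (a : A) (v : V) :
    sliceR k A V l (v ⊗ₜ a) = DualAlg.lin l a • v := by simp [sliceR]

variable (k A) in
/-- The linear forms dual to a basis of `A`. -/
def dualBasis (i : Module.Free.ChooseBasisIndex k A) : DualAlg k A :=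
  DualAlg.lin.symm ((Module.Free.chooseBasis k A).coord i)

lemma lin_dualBasis (i : Module.Free.ChooseBasisIndex k A) (a : A) :
    DualAlg.lin (dualBasis k A i) a = (Module.Free.chooseBasis k A).repr a i := rfl

lemma sum_lin_smul_dualBasis (l : DualAlg k A) :
    ∑ i, DualAlg.lin l (Module.Free.chooseBasis k A i) • dualBasis k A i = l := by
  apply DualAlg.lin.injective
  rw [map_sum]
  refine (Module.Free.chooseBasis k A).ext fun j => ?_
  simp [lin_dualBasis, Finsupp.single_apply]

lemma sum_tmul_sliceL (x : A ⊗[k] V) :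
    ∑ i, Module.Free.chooseBasis k A i ⊗ₜ sliceL k A V (dualBasis k A i) x = x := by
  induction x with
  | zero => simp
  | add x y hx hy => simp only [map_add, TensorProduct.tmul_add, Finset.sum_add_distrib, hx, hy]
  | tmul a v =>
    conv_rhs => rw [← (Module.Free.chooseBasis k A).sum_repr a, TensorProduct.sum_tmul]
    simp [lin_dualBasis, TensorProduct.smul_tmul]

lemma sum_sliceR_tmul (x : V ⊗[k] A) :
    ∑ i, sliceR k A V (dualBasis k A i) x ⊗ₜ Module.Free.chooseBasis k A i = x := by
  induction x with
  | zero => simp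
  | add x y hx hy => simp only [map_add, TensorProduct.add_tmul, Finset.sum_add_distrib, hx, hy]
  | tmul v a =>
    conv_rhs => rw [← (Module.Free.chooseBasis k A).sum_repr a, TensorProduct.tmul_sum]
    simp [lin_dualBasis, TensorProduct.smul_tmul]

/-- A tensor is recovered from its contractions with a dual basis, which is finite because A is
finite-dimensional. Every identity between coactions can therefore be tested after contraction with
linear forms. -/
lemma sliceL_ext {x y : A ⊗[k] V} (h : ∀ l, sliceL k A V l x = sliceL k A V l y) : x = y := by
  rw [← sum_tmul_sliceL x, ← sum_tmul_sliceL y]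
  simp only [h]

lemma sliceR_ext {x y : V ⊗[k] A} (h : ∀ l, sliceR k A V l x = sliceR k A V l y) : x = y := by
  rw [← sum_sliceR_tmul x, ← sum_sliceR_tmul y]
  simp only [h]

lemma sliceL_lTensor {W : Type*} [AddCommGroup W] [Module k W] (l : DualAlg k A) (f : V →ₗ[k] W)
    (x : A ⊗[k] V) : sliceL k A W l (f.lTensor A x) = f (sliceL k A V l x) := by
  induction x with
  | zero => simp
  | add x y hx hy => simp only [map_add, hx, hy]
  | tmul a v => simp

lemma sliceR_rTensor {W : Type*} [AddCommGroup W] [Module k W] (l : DualAlg k A) (f : V →ₗ[k] W)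
    (x : V ⊗[k] A) : sliceR k A W l (f.rTensor A x) = f (sliceR k A V l x) := by
  induction x with
  | zero => simp
  | add x y hx hy => simp only [map_add, hx, hy]
  | tmul a v => simp

/-- This translates coassociativity into multiplicativity for convolution. The form l meets the
outer tensorand first and l' acts afterwards, which is why a left coaction gives an action of the
opposite algebra A^{*op}; on the right the order is the natural one. -/
lemma sliceL_rTensor_comul (l l' : DualAlg k A) (x : A ⊗[k] V) :
    sliceL k A V l' (sliceL k A _ l (TensorProduct.assoc k A A V (comul.rTensor V x))) =
      sliceL k A V (l * l') x := by
  induction x with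
  | zero => simp
  | add x y hx hy => simp only [map_add, hx, hy]
  | tmul a v =>
    rw [LinearMap.rTensor_tmul, sliceL_tmul, DualAlg.mul_apply]
    generalize comul (R := k) a = y
    induction y with
    | zero => simp
    | add x y hx hy => simp only [map_add, TensorProduct.add_tmul, hx, hy, add_smul]
    | tmul a b => simp [mul_smul]

lemma sliceR_lTensor_comul (l l' : DualAlg k A) (x : V ⊗[k] A) :
    sliceR k A V l (sliceR k A _ l' ((TensorProduct.assoc k V A A).symm (comul.lTensor V x))) =
      sliceR k A V (l * l') x := by
  induction x with
  | zero => simp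
  | add x y hx hy => simp only [map_add, hx, hy]
  | tmul v a =>
    rw [LinearMap.lTensor_tmul, sliceR_tmul, DualAlg.mul_apply]
    generalize comul (R := k) a = y
    induction y with
    | zero => simp
    | add x y hx hy => simp only [map_add, TensorProduct.tmul_add, hx, hy, add_smul]
    | tmul a b => simp [smul_smul, mul_comm]

lemma sliceR_sliceL (l l' : DualAlg k A) (x : A ⊗[k] (V ⊗[k] A)) :
    sliceR k A V l' (sliceL k A _ l x) =
      sliceL k A V l (sliceR k A _ l' ((TensorProduct.assoc k A V A).symm x)) := by
  induction x with
  | zero => simp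
  | add x y hx hy => simp only [map_add, hx, hy]
  | tmul a x =>
    induction x with
    | zero => simp
    | add x y hx hy => simp only [map_add, TensorProduct.tmul_add, hx, hy]
    | tmul v b => simp [smul_smul, mul_comm]

/-- The left coaction for which linear forms act by `F`. -/
def coactOfL (F : DualAlg k A →ₗ[k] Module.End k V) : V →ₗ[k] A ⊗[k] V :=
  ∑ i, TensorProduct.mk k A V (Module.Free.chooseBasis k A i) ∘ₗ F (dualBasis k A i)

/-- The right coaction for which linear forms act by `F`. -/
def coactOfR (F : DualAlg k A →ₗ[k] Module.End k V) : V →ₗ[k] V ⊗[k] A :=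
  ∑ i, (TensorProduct.mk k V A).flip (Module.Free.chooseBasis k A i) ∘ₗ F (dualBasis k A i)

@[simp] lemma sliceL_coactOfL (F : DualAlg k A →ₗ[k] Module.End k V) (l : DualAlg k A) (v : V) :
    sliceL k A V l (coactOfL F v) = F l v := by
  conv_rhs => rw [← sum_lin_smul_dualBasis l]
  simp [coactOfL]

@[simp] lemma sliceR_coactOfR (F : DualAlg k A →ₗ[k] Module.End k V) (l : DualAlg k A) (v : V) :
    sliceR k A V l (coactOfR F v) = F l v := by
  conv_rhs => rw [← sum_lin_smul_dualBasis l]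
  simp [coactOfR]

/-- Contracting with a linear form turns the hypothesis of `unstraightenL`, with H acting on one
tensorand of A ⊗ V at a time, into the straightening rule `hF`. -/
lemma coactOfL_straight {H : Type*} [Ring H] [HopfAlgebra k H] (act : H →ₐ[k] Module.End k A)
    (F : DualAlg k A →ₗ[k] Module.End k V) (τ : H →ₐ[k] Module.End k V)
    (hF : StraightL act F τ.toLinearMap) (h : H) :
    coactOfL F ∘ₗ τ h = diag act τ h ∘ₗ coactOfL F := by
  have key := unstraightenL ((Module.End.rTensorAlgHom k A V).comp act)
    ((Module.End.lTensorAlgHom k V A).comp τ).toLinearMap τ.toLinearMap (coactOfL F) ?_ h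
  · refine key.symm.trans ?_
    rw [diag_apply _ _ (ℛ k h)]
    refine LinearMap.ext fun v => ?_
    simp only [LinearMap.sum_apply, LinearMap.comp_apply]
    refine Finset.sum_congr rfl fun i _ => ?_
    generalize coactOfL F v = x
    induction x with
    | zero => simp
    | add x y hx hy => simp only [map_add, hx, hy]
    | tmul a v => rfl
  · intro h
    refine LinearMap.ext fun v => sliceL_ext fun l => ?_
    have h1 := congr($(hF h l) v)
    simp only [LinearMap.sum_apply, map_sum, LinearMap.comp_apply]
    refine (sliceL_lTensor l (τ h) (coactOfL F v)).trans ?_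
    rw [sliceL_coactOfL]
    refine h1.trans ?_
    rw [LinearMap.sum_apply]
    refine Finset.sum_congr rfl fun i _ => ?_
    rw [Module.End.mul_apply, ← sliceL_coactOfL]
    change _ = sliceL k A V l ((act (antipode k ((ℛ k h).left i))).rTensor V _)
    generalize coactOfL F _ = x
    induction x with
    | zero => simp
    | add x y hx hy => simp only [map_add, hx, hy]
    | tmul a v => simp

lemma coactOfR_straight {H : Type*} [Ring H] [HopfAlgebra k H] [FiniteDimensional k H]
    (act : H →ₐ[k] Module.End k A)
    (F : DualAlg k A →ₗ[k] Module.End k V) (τ : H →ₐ[k] Module.End k V)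
    (hF : StraightR act F τ.toLinearMap) (h : H) :
    coactOfR F ∘ₗ τ h = diag τ act h ∘ₗ coactOfR F := by
  have key := unstraightenR ((Module.End.lTensorAlgHom k A V).comp act)
    ((Module.End.rTensorAlgHom k V A).comp τ).toLinearMap τ.toLinearMap (coactOfR F) ?_ h
  · refine key.symm.trans ?_
    rw [diag_apply _ _ (ℛ k h)]
    refine LinearMap.ext fun v => ?_
    simp only [LinearMap.sum_apply, LinearMap.comp_apply]
    refine Finset.sum_congr rfl fun i _ => ?_
    generalize coactOfR F v = x
    induction x with
    | zero => simp
    | add x y hx hy => simp only [map_add, hx, hy]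
    | tmul a v => rfl
  · intro h
    refine LinearMap.ext fun v => sliceR_ext fun l => ?_
    have h1 := congr($(hF h l) v)
    simp only [LinearMap.sum_apply, map_sum, LinearMap.comp_apply]
    refine (sliceR_rTensor l (τ h) (coactOfR F v)).trans ?_
    rw [sliceR_coactOfR]
    refine h1.trans ?_
    rw [LinearMap.sum_apply]
    refine Finset.sum_congr rfl fun i _ => ?_
    rw [Module.End.mul_apply, ← sliceR_coactOfR]
    change _ = sliceR k A V l ((act (antipodeInv k H ((ℛ k h).right i))).lTensor V _)
    generalize coactOfR F _ = x
    induction x with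
    | zero => simp
    | add x y hx hy => simp only [map_add, hx, hy]
    | tmul a v => simp [antipodeInvAlgHomOp]

end Slices

end GS

/-! ### The Hopf bimodule of an X-module -/

namespace GS

open HopfAlgebra WithConv

section Rep

variable {k A : Type u} [Field k] [Ring A] [HopfAlgebra k A] [FiniteDimensional k A]
  {V : Type u} [AddCommGroup V] [Module k V] (ρ : XAlg k A →ₐ[k] Module.End k V)

/-- The action of `A ⊗ A^{op}` on an `X`-module. -/
def repH : A ⊗[k] Aᵐᵒᵖ →ₐ[k] Module.End k V :=
  ρ.comp (Crossed.inclH (regAct_isModuleCoalgebra k A))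

/-- The action of the tensorand `A^{*op}` on an `X`-module. -/
def repL : DualAlg k A →ₗ[k] Module.End k V :=
  ρ.toLinearMap ∘ₗ Crossed.inclL (regAct_isModuleCoalgebra k A)

/-- The action of the tensorand `A^*` on an `X`-module. -/
def repR : DualAlg k A →ₗ[k] Module.End k V :=
  ρ.toLinearMap ∘ₗ Crossed.inclR (regAct_isModuleCoalgebra k A)

lemma repL_mul (l l' : DualAlg k A) : repL ρ (l * l') = repL ρ l' * repL ρ l :=
  (congrArg ρ (Crossed.inclL_mul _ l l')).trans (map_mul ρ _ _)

lemma repR_mul (l l' : DualAlg k A) : repR ρ (l * l') = repR ρ l * repR ρ l' :=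
  (congrArg ρ (Crossed.inclR_mul _ l l')).trans (map_mul ρ _ _)

lemma repL_one : repL ρ 1 = 1 := map_one ρ

lemma repR_one : repR ρ 1 = 1 := map_one ρ

lemma commute_repL_repR (l l' : DualAlg k A) : Commute (repL ρ l) (repR ρ l') :=
  (Crossed.commute_inclL_inclR (regAct_isModuleCoalgebra k A) l l').map ρ

lemma straightL_rep : StraightL (regAct k A) (repL ρ) (repH ρ).toLinearMap := fun h l =>
  (map_mul ρ _ _).symm.trans <| (congrArg ρ (Crossed.straightL
    (regAct_isModuleCoalgebra k A) h l)).trans <| (map_sum ρ _ _).trans <|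
    Finset.sum_congr rfl fun _ _ => map_mul ρ _ _

lemma straightR_rep : StraightR (regAct k A) (repR ρ) (repH ρ).toLinearMap := fun h l =>
  (map_mul ρ _ _).symm.trans <| (congrArg ρ (Crossed.straightR
    (regAct_isModuleCoalgebra k A) h l)).trans <| (map_sum ρ _ _).trans <|
    Finset.sum_congr rfl fun _ _ => map_mul ρ _ _

/-- The left action of `A` on an `X`-module. -/
def repActL : A →ₐ[k] Module.End k V := (repH ρ).comp Algebra.TensorProduct.includeLeft

/-- The right action of `A` on an `X`-module. -/
def repActR : Aᵐᵒᵖ →ₐ[k] Module.End k V := (repH ρ).comp Algebra.TensorProduct.includeRight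

lemma commute_repActL_repActR (a : A) (b : Aᵐᵒᵖ) : Commute (repActL ρ a) (repActR ρ b) := by
  refine Commute.map (f := repH ρ) ?_
  simp [Commute, SemiconjBy]

lemma repH_eq_biAct : repH ρ = biAct (repActL ρ) (repActR ρ) (commute_repActL_repActR ρ) := by
  refine Algebra.TensorProduct.ext' fun a b => ?_
  rw [biAct_tmul, repActL, repActR, AlgHom.comp_apply, AlgHom.comp_apply, ← map_mul]
  simp

/-- The straightening rules concern A ⊗ A^{op} as a whole; specialising to a ⊗ 1 and to 1 ⊗ b
separates the axioms for the left action from those for the right action. -/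
lemma diag_left_repH (a : A) : diag (regAct k A) (repH ρ) (a ⊗ₜ 1) = diag (lreg k A) (repActL ρ) a := by
  rw [repH_eq_biAct, regAct, diag_biAct, map_one, mul_one]

lemma diag_left_repH' (b : Aᵐᵒᵖ) :
    diag (regAct k A) (repH ρ) (1 ⊗ₜ b) = diag (rreg k A) (repActR ρ) b := by
  rw [repH_eq_biAct, regAct, diag_biAct, map_one, one_mul]

lemma diag_right_repH (a : A) :
    diag (repH ρ) (regAct k A) (a ⊗ₜ 1) = diag (repActL ρ) (lreg k A) a := by
  rw [repH_eq_biAct, regAct, diag_biAct, map_one, mul_one]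

lemma diag_right_repH' (b : Aᵐᵒᵖ) :
    diag (repH ρ) (regAct k A) (1 ⊗ₜ b) = diag (repActR ρ) (rreg k A) b := by
  rw [repH_eq_biAct, regAct, diag_biAct, map_one, one_mul]

/-- The Hopf bimodule given by an `X`-module. -/
def HopfBimod.ofRep : HopfBimod k A where
  carrier := V
  lact := repActL ρ
  ract := repActR ρ
  act_comm := commute_repActL_repActR ρ
  lcoact := coactOfL (repL ρ)
  rcoact := coactOfR (repR ρ)
  -- After contraction the axioms of a bicomodule become statements about linear forms:
  -- coassociativity is the multiplicativity of `repL ρ` and `repR ρ`, the counit axioms say that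
  -- the unit ε of A^* acts as the identity, and the two coactions commute because the two
  -- tensorands of A^{*op} ⊗ A^* do.
  lcoact_coassoc := LinearMap.ext fun v => sliceL_ext fun l => sliceL_ext fun l' => by
    simp only [LinearMap.comp_apply, LinearEquiv.coe_coe]
    rw [sliceL_rTensor_comul, sliceL_lTensor]
    simp [repL_mul]
  lcoact_counit := LinearMap.ext fun v =>
    (sliceL_coactOfL (repL ρ) 1 v).trans congr($(repL_one ρ) v)
  rcoact_coassoc := LinearMap.ext fun v => (TensorProduct.assoc k V A A).symm.injective <|
      sliceR_ext fun l => sliceR_ext fun l' => by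
    simp only [LinearMap.comp_apply, LinearEquiv.coe_coe, LinearEquiv.symm_apply_apply]
    rw [sliceR_lTensor_comul, sliceR_rTensor]
    simp [repR_mul]
  rcoact_counit := LinearMap.ext fun v =>
    (sliceR_coactOfR (repR ρ) 1 v).trans congr($(repR_one ρ) v)
  coact_comm := LinearMap.ext fun v => sliceL_ext fun l => sliceR_ext fun l' => by
    rw [sliceR_sliceL]
    simp only [LinearMap.comp_apply, LinearEquiv.coe_coe, LinearEquiv.symm_apply_apply]
    rw [sliceR_rTensor, sliceL_lTensor]
    simp only [sliceL_coactOfL, sliceR_coactOfR]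
    exact congr($((commute_repL_repR ρ l l').eq) v)
  lcoact_lact a := by
    rw [← diag_left_repH]
    exact coactOfL_straight (regAct k A) (repL ρ) (repH ρ) (straightL_rep ρ) (a ⊗ₜ 1)
  lcoact_ract b := by
    rw [← diag_left_repH']
    exact coactOfL_straight (regAct k A) (repL ρ) (repH ρ) (straightL_rep ρ) (1 ⊗ₜ b)
  rcoact_lact a := by
    rw [← diag_right_repH]
    exact coactOfR_straight (regAct k A) (repR ρ) (repH ρ) (straightR_rep ρ) (a ⊗ₜ 1)
  rcoact_ract b := by
    rw [← diag_right_repH']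
    exact coactOfR_straight (regAct k A) (repR ρ) (repH ρ) (straightR_rep ρ) (1 ⊗ₜ b)

/-- The two copies of A^* and A ⊗ A^{op} generate X, since (l ⊗ l') ⊗ h is the product of their
elements l, l' and h. -/
lemma XAlg.algHom_ext {E : Type*} [Ring E] [Algebra k E] {f g : XAlg k A →ₐ[k] E}
    (hL : ∀ l, f (Crossed.inclL _ l) = g (Crossed.inclL _ l))
    (hR : ∀ l, f (Crossed.inclR _ l) = g (Crossed.inclR _ l))
    (hH : ∀ a b, f (Crossed.inclH _ (a ⊗ₜ b)) = g (Crossed.inclH _ (a ⊗ₜ b))) : f = g := by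
  refine AlgHom.ext fun x => ?_
  obtain ⟨x, rfl⟩ := (Crossed.of (regAct_isModuleCoalgebra k A)).surjective x
  induction x with
  | zero => simp
  | add x y hx hy => simp only [map_add, hx, hy]
  | tmul p h =>
    rw [Crossed.of_tmul, map_mul, map_mul]
    congr 1
    · induction p using PAlg.induction with
      | h0 => simp
      | h1 l l' => rw [Crossed.inclP_tmul, map_mul, map_mul, hL, hR]
      | h2 x y hx hy => simp only [map_add, hx, hy]
    · induction h with
      | zero => simp
      | add x y hx hy => simp only [map_add, hx, hy]
      | tmul a b => exact hH a b

namespace HopfBimod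

variable (M N : HopfBimod k A)

lemma xAct_inclL (l : DualAlg k A) : M.xAct (Crossed.inclL _ l) = M.lslice l := by
  refine LinearMap.ext fun m => (M.xAct_tmul l 1 1 1 m).trans ?_
  rw [rslice_one, MulOpposite.op_one, map_one, map_one]
  rfl

lemma xAct_inclR (l : DualAlg k A) : M.xAct (Crossed.inclR _ l) = M.rslice l := by
  refine LinearMap.ext fun m => (M.xAct_tmul 1 l 1 1 m).trans ?_
  rw [lslice_one, MulOpposite.op_one, map_one, map_one]
  rfl

lemma xAct_inclH (a : A) (b : Aᵐᵒᵖ) :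
    M.xAct (Crossed.inclH _ (a ⊗ₜ b)) = M.lact a * M.ract b := by
  refine LinearMap.ext fun m => (M.xAct_tmul 1 1 a b.unop m).trans ?_
  rw [lslice_one, rslice_one]
  rfl

/-- The coactions were built so that linear forms act by contraction as they do through ρ; agreement
on generators suffices. So every X-module comes from a Hopf bimodule. -/
lemma ofRep_xAct : (ofRep ρ).xAct = ρ := by
  refine XAlg.algHom_ext (fun l => ?_) (fun l => ?_) (fun a b => ?_)
  · rw [xAct_inclL]
    exact LinearMap.ext fun v => sliceL_coactOfL (repL ρ) l v
  · rw [xAct_inclR]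
    exact LinearMap.ext fun v => sliceR_coactOfR (repR ρ) l v
  · rw [xAct_inclH]
    refine (biAct_tmul _ _ (commute_repActL_repActR ρ) a b).symm.trans ?_
    rw [← repH_eq_biAct]
    rfl

variable {M N}

lemma lslice_comp (f : M ⟶ N) (l : DualAlg k A) : f.lin ∘ₗ M.lslice l = N.lslice l ∘ₗ f.lin :=
  LinearMap.ext fun m => (sliceL_lTensor l f.lin (M.lcoact m)).symm.trans
    congr(sliceL k A N l ($(f.lcoact.symm) m))

lemma rslice_comp (f : M ⟶ N) (l : DualAlg k A) : f.lin ∘ₗ M.rslice l = N.rslice l ∘ₗ f.lin :=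
  LinearMap.ext fun m => (sliceR_rTensor l f.lin (M.rcoact m)).symm.trans
    congr(sliceR k A N l ($(f.rcoact.symm) m))

/-- On the generators of X this is naturality of contraction, for linear forms, and compatibility
with the actions, for A ⊗ A^{op}. -/
lemma xAct_comp (f : M ⟶ N) (x : XAlg k A) : f.lin ∘ₗ M.xAct x = N.xAct x ∘ₗ f.lin := by
  obtain ⟨x, rfl⟩ := (Crossed.of (regAct_isModuleCoalgebra k A)).surjective x
  induction x with
  | zero => simp
  | add x y hx hy => simp only [map_add, LinearMap.comp_add, LinearMap.add_comp, hx, hy]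
  | tmul p h =>
    rw [Crossed.of_tmul, map_mul, map_mul]
    have h1 : f.lin ∘ₗ M.xAct (Crossed.inclP _ p) = N.xAct (Crossed.inclP _ p) ∘ₗ f.lin := by
      induction p using PAlg.induction with
      | h0 => simp
      | h1 l l' =>
        rw [Crossed.inclP_tmul, map_mul, map_mul, xAct_inclL, xAct_inclR, xAct_inclL, xAct_inclR,
          Module.End.mul_eq_comp, Module.End.mul_eq_comp, ← LinearMap.comp_assoc, lslice_comp,
          LinearMap.comp_assoc, rslice_comp, LinearMap.comp_assoc]
      | h2 x y hx hy => simp only [map_add, LinearMap.comp_add, LinearMap.add_comp, hx, hy]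
    have h2 : f.lin ∘ₗ M.xAct (Crossed.inclH _ h) = N.xAct (Crossed.inclH _ h) ∘ₗ f.lin := by
      induction h with
      | zero => simp
      | add x y hx hy => simp only [map_add, LinearMap.comp_add, LinearMap.add_comp, hx, hy]
      | tmul a b =>
        rw [xAct_inclH, xAct_inclH, Module.End.mul_eq_comp, Module.End.mul_eq_comp,
          ← LinearMap.comp_assoc, f.lact, LinearMap.comp_assoc, f.ract, LinearMap.comp_assoc]
    rw [Module.End.mul_eq_comp, Module.End.mul_eq_comp, ← LinearMap.comp_assoc, h1,
      LinearMap.comp_assoc, h2, LinearMap.comp_assoc]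

/-- A linear map compatible with the actions of `X` is a morphism of Hopf bimodules. -/
def homOfXAct (f : M →ₗ[k] N) (hf : ∀ x, f ∘ₗ M.xAct x = N.xAct x ∘ₗ f) : M ⟶ N where
  lin := f
  lact a := by
    have h := hf (Crossed.inclH _ (a ⊗ₜ 1))
    rwa [xAct_inclH, xAct_inclH, map_one, map_one, mul_one, mul_one] at h
  ract b := by
    have h := hf (Crossed.inclH _ (1 ⊗ₜ b))
    rwa [xAct_inclH, xAct_inclH, map_one, map_one, one_mul, one_mul] at h
  lcoact := LinearMap.ext fun m => sliceL_ext fun l => by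
    have h := hf (Crossed.inclL _ l)
    rw [xAct_inclL, xAct_inclL] at h
    exact congr($h.symm m).trans (sliceL_lTensor l f (M.lcoact m)).symm
  rcoact := LinearMap.ext fun m => sliceR_ext fun l => by
    have h := hf (Crossed.inclR _ l)
    rw [xAct_inclR, xAct_inclR] at h
    exact congr($h.symm m).trans (sliceR_rTensor l f (M.rcoact m)).symm

end HopfBimod

end Rep

/-! ### Hopf bimodules and X-modules form equivalent categories -/

namespace HopfBimod

variable {k A : Type u} [Field k] [Ring A] [HopfAlgebra k A] [FiniteDimensional k A]

/-- The elements of `M.toX` are those of `M`. -/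
def toXEquiv (M : HopfBimod k A) : M ≃+ M.toX := AddEquiv.refl _

lemma smul_toXEquiv (M : HopfBimod k A) (x : XAlg k A) (m : M) :
    x • M.toXEquiv m = M.toXEquiv (M.xAct x m) := rfl

/-- A morphism of Hopf bimodules as a morphism of `X`-modules. -/
def toXMap {M N : HopfBimod k A} (f : M ⟶ N) : M.toX →ₗ[XAlg k A] N.toX :=
  LinearMap.mk ⟨fun m => N.toXEquiv (f.lin (M.toXEquiv.symm m)), fun m m' => map_add f.lin m m'⟩
    (fun x m => congr($(xAct_comp f x) m))

/-- Scalars act through X as they do on M, so X-linear maps are automatically k-linear; this is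
needed to regard them as morphisms of Hopf bimodules. -/
lemma algebraMap_smul_toX (M : HopfBimod k A) (r : k) (m : M) :
    algebraMap k (XAlg k A) r • M.toXEquiv m = M.toXEquiv (r • m) := by
  rw [smul_toXEquiv, AlgHom.commutes]
  rfl

/-- A morphism of `X`-modules as a morphism of Hopf bimodules. -/
def ofToX {M N : HopfBimod k A} (g : M.toX →ₗ[XAlg k A] N.toX) : M ⟶ N :=
  homOfXAct
    { toFun := fun m => N.toXEquiv.symm (g (M.toXEquiv m))
      map_add' := fun m m' => map_add g m m'
      map_smul' := fun r m => by
        rw [← algebraMap_smul_toX, map_smul]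
        exact algebraMap_smul_toX N r (N.toXEquiv.symm (g (M.toXEquiv m))) }
    (fun x => LinearMap.ext fun m => map_smul g x (M.toXEquiv m))

/-- The functor from Hopf bimodules to `X`-modules. -/
def toXFunctor : HopfBimod k A ⥤ ModuleCat.{u} (XAlg k A) where
  obj M := M.toX
  map {M N} f := show M.toX ⟶ N.toX from ModuleCat.ofHom (X := M.toX) (Y := N.toX) (toXMap f)
  map_id _ := rfl
  map_comp _ _ := rfl

instance : (toXFunctor (k := k) (A := A)).Additive where
  map_add {_ _ _ _} := rfl

instance : (toXFunctor (k := k) (A := A)).Faithful where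
  map_injective {M N} _ _ h := hom_ext <| LinearMap.ext fun m =>
    congr((show M.toX ⟶ N.toX from $h).hom (M.toXEquiv m))

instance : (toXFunctor (k := k) (A := A)).Linear k where
  map_smul {M N} f r := ModuleCat.hom_ext <| LinearMap.ext fun (m : M.toX) =>
    (algebraMap_smul_toX N r (f.lin (M.toXEquiv.symm m))).symm

instance : (toXFunctor (k := k) (A := A)).Full where
  map_surjective {M N} g := ⟨ofToX (show M.toX ⟶ N.toX from g).hom, rfl⟩

open scoped ModuleCat.Algebra

/-- The Hopf bimodule given by an object of the category of `X`-modules. -/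
def ofX (Q : ModuleCat.{u} (XAlg k A)) : HopfBimod k A :=
  ofRep (Algebra.lsmul k k Q : XAlg k A →ₐ[k] Module.End k Q)

/-- The elements of the `X`-module of the Hopf bimodule given by `Q` are those of `Q`. -/
def toXOfXEquiv (Q : ModuleCat.{u} (XAlg k A)) : (ofX Q).toX ≃ₗ[XAlg k A] Q :=
  LinearEquiv.mk (LinearMap.mk ⟨fun m => m, fun _ _ => rfl⟩
    fun x m => congr($(ofRep_xAct (Algebra.lsmul k k Q)) x m)) (fun m => m)
    (fun _ => rfl) (fun _ => rfl)

/-- The `X`-module of the Hopf bimodule given by `Q` is `Q`. -/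
def toXOfX (Q : ModuleCat.{u} (XAlg k A)) : (ofX Q).toX ≅ Q := (toXOfXEquiv Q).toModuleIso

end HopfBimod

end GS

/-! ### Coinvariants and the fundamental theorem of Hopf modules -/

namespace GS

open HopfAlgebra WithConv

namespace HopfBimod

variable {k A : Type u} [Field k] [Ring A] [HopfAlgebra k A]

section Coinvariants

variable (M : HopfBimod k A)

/-- The projection `m ↦ ∑ m₀ S(m₁)` to the coinvariants of the right coaction. -/
def coinv : M →ₗ[k] M := actRLin k A M ∘ₗ (antipode k).lTensor M ∘ₗ M.rcoact

lemma ract_ract (a b : A) (m : M) : M.ract (MulOpposite.op b) (M.ract (MulOpposite.op a) m) =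
    M.ract (MulOpposite.op (a * b)) m := by
  rw [MulOpposite.op_mul, map_mul]
  rfl

lemma rcoact_ract_apply (a : A) (m : M) : M.rcoact (M.ract (MulOpposite.op a) m) =
    ∑ i ∈ (ℛ k a).index, TensorProduct.map (M.ract (MulOpposite.op ((ℛ k a).left i)))
      (LinearMap.mulRight k ((ℛ k a).right i)) (M.rcoact m) := by
  refine congr($(M.rcoact_ract (MulOpposite.op a)) m).trans ?_
  rw [LinearMap.comp_apply, diag_apply _ _ (opRepr (ℛ k a)), LinearMap.sum_apply]
  rfl

/-- In ∑ m₀ a⁽¹⁾ S(m₁ a⁽²⁾) = ∑ m₀ a⁽¹⁾ S(a⁽²⁾) S(m₁) the two middle factors reduce to ε(a). -/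
lemma coinv_ract (a : A) (m : M) :
    M.coinv (M.ract (MulOpposite.op a) m) = counit (R := k) a • M.coinv m := by
  simp only [coinv, LinearMap.comp_apply, rcoact_ract_apply, map_sum]
  generalize M.rcoact m = x
  induction x with
  | zero => simp
  | add x y hx hy => simp only [map_add, smul_add, Finset.sum_add_distrib, hx, hy]
  | tmul m b =>
    simp only [TensorProduct.map_tmul, LinearMap.lTensor_tmul, actRLin_tmul, ract_ract,
      LinearMap.mulRight_apply, antipode_mul_antidistrib]
    simp only [← LinearMap.sum_apply, ← map_sum, ← Finset.op_sum, ← mul_assoc, ← Finset.sum_mul,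
      sum_mul_antipode_eq_smul]
    simp

lemma sum_antipode_tmul (a : A) :
    ∑ i ∈ (ℛ k a).index, ∑ j ∈ (ℛ k ((ℛ k a).right i)).index,
      antipode k ((ℛ k ((ℛ k a).right i)).right j) ⊗ₜ[k]
        ((ℛ k a).left i * antipode k ((ℛ k ((ℛ k a).right i)).left j)) = antipode k a ⊗ₜ[k] 1 := by
  let T : A ⊗[k] (A ⊗[k] A) →ₗ[k] A ⊗[k] A := (TensorProduct.comm k A A).toLinearMap ∘ₗ
    TensorProduct.map (LinearMap.mul' k A ∘ₗ (antipode k).lTensor A) (antipode k) ∘ₗ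
      (TensorProduct.assoc k A A A).symm.toLinearMap
  have hT : ∀ a b d, T (a ⊗ₜ (b ⊗ₜ d)) = antipode k d ⊗ₜ (a * antipode k b) := fun a b d => rfl
  have h1 := congr(T $(Coalgebra.sum_tmul_tmul_eq (ℛ k a) (fun i => ℛ k ((ℛ k a).left i))
        (fun i => ℛ k ((ℛ k a).right i))))
  simp only [map_sum, hT] at h1
  rw [← h1]
  simp only [← TensorProduct.tmul_sum, sum_mul_antipode_eq_smul]
  conv_rhs => rw [← sum_counit_smul (ℛ k a), map_sum, TensorProduct.sum_tmul]
  simp [TensorProduct.smul_tmul]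

/-- As S reverses comultiplication, the coaction of ∑ m₀ S(m₁) is ∑ m₀ S(m₃) ⊗ m₁ S(m₂), and
`sum_antipode_tmul` replaces the second factor by 1. -/
lemma rcoact_coinv (m : M) : M.rcoact (M.coinv m) = M.coinv m ⊗ₜ 1 := by
  -- `G` is the map (m ⊗ b) ⊗ a ↦ ∑ m S(a⁽²⁾) ⊗ b S(a⁽¹⁾).
  let G : (M ⊗[k] A) ⊗[k] A →ₗ[k] M ⊗[k] A :=
    TensorProduct.map (actRLin k A M) (LinearMap.mul' k A) ∘ₗ
      (TensorProduct.tensorTensorTensorComm k M A A A).toLinearMap ∘ₗ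
        (TensorProduct.map (antipode k) (antipode k) ∘ₗ (TensorProduct.comm k A A).toLinearMap ∘ₗ
          comul).lTensor (M ⊗[k] A)
  have h1 : M.rcoact ∘ₗ actRLin k A M ∘ₗ (antipode k).lTensor M = G ∘ₗ M.rcoact.rTensor A := by
    refine TensorProduct.ext' fun m a => ?_
    refine congr($(rcoact_actRLin M) (m ⊗ₜ antipode k a)).trans ?_
    simp only [codiagR, LinearMap.comp_apply, TensorProduct.map_tmul, LinearMap.rTensor_tmul, G,
      LinearMap.lTensor_tmul, comul_antipode, LinearEquiv.coe_coe]
    generalize TensorProduct.map (antipode k) (antipode k) (TensorProduct.comm k A A (comul a)) = y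
    generalize M.rcoact m = x
    induction x with
    | zero => simp
    | add x x' hx hx' => simp only [TensorProduct.add_tmul, map_add, hx, hx']
    | tmul m b =>
      induction y with
      | zero => simp
      | add y y' hy hy' => simp only [TensorProduct.tmul_add, map_add, hy, hy']
      | tmul a a' => simp
  have h2 : ∀ x : M ⊗[k] A, G ((TensorProduct.assoc k M A A).symm (comul.lTensor M x)) =
      actRLin k A M ((antipode k).lTensor M x) ⊗ₜ 1 := by
    intro x
    induction x with
    | zero => simp
    | add x x' hx hx' => simp only [TensorProduct.add_tmul, map_add, hx, hx']
    | tmul m a =>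
      have h3 := congr((M.ract.toLinearMap.flip m ∘ₗ (MulOpposite.opLinearEquiv k).toLinearMap).rTensor
        A $(sum_antipode_tmul (k := k) a))
      refine Eq.trans ?_ h3
      rw [LinearMap.lTensor_tmul]
      conv_lhs => rw [← (ℛ k a).eq]
      simp only [TensorProduct.tmul_sum, map_sum, TensorProduct.assoc_symm_tmul]
      refine Finset.sum_congr rfl fun i _ => ?_
      simp only [G, LinearMap.comp_apply, LinearMap.lTensor_tmul]
      conv_lhs => rw [← (ℛ k ((ℛ k a).right i)).eq]
      simp only [TensorProduct.tmul_sum, map_sum]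
      rfl
  have h4 := congr((TensorProduct.assoc k M A A).symm ($(M.rcoact_coassoc) m))
  simp only [LinearMap.comp_apply, LinearEquiv.coe_coe, LinearEquiv.symm_apply_apply] at h4
  refine congr($h1 (M.rcoact m)).trans ?_
  rw [LinearMap.comp_apply, h4, h2]
  rfl

lemma coinv_of_coinvariant {m : M} (hm : M.rcoact m = m ⊗ₜ 1) : M.coinv m = m := by
  simp [coinv, hm]

lemma rcoact_ract_of_coinvariant {m : M} (hm : M.rcoact m = m ⊗ₜ 1) (a : A) :
    M.rcoact (M.ract (MulOpposite.op a) m) =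
      (actRLin k A M).rTensor A ((TensorProduct.assoc k M A A).symm (m ⊗ₜ comul a)) := by
  rw [rcoact_ract_apply, hm]
  conv_rhs => rw [← (ℛ k a).eq]
  simp [TensorProduct.tmul_sum]

/-- The left side is ∑ m₀ S(m₁) m₂. This is the half of the isomorphism M ≅ M^{co A} ⊗ A which says
that coinvariants generate M as a right module. -/
lemma actRLin_coinv (m : M) : actRLin k A M (M.coinv.rTensor A (M.rcoact m)) = m := by
  have h4 := congr((TensorProduct.assoc k M A A).symm ($(M.rcoact_coassoc) m))
  simp only [LinearMap.comp_apply, LinearEquiv.coe_coe, LinearEquiv.symm_apply_apply] at h4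
  have h5 : actRLin k A M (M.coinv.rTensor A (M.rcoact m)) = actRLin k A M
      ((actRLin k A M ∘ₗ (antipode k).lTensor M).rTensor A
        (M.rcoact.rTensor A (M.rcoact m))) := by
    rw [← LinearMap.comp_apply (LinearMap.rTensor A _) (LinearMap.rTensor A _),
      ← LinearMap.rTensor_comp]
    rfl
  rw [h5, h4]
  refine Eq.trans ?_ congr($(M.rcoact_counit) m)
  simp only [LinearMap.comp_apply, LinearEquiv.coe_coe]
  generalize M.rcoact m = x
  induction x with
  | zero => simp
  | add x y hx hy => simp only [map_add, hx, hy]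
  | tmul m a =>
    rw [LinearMap.lTensor_tmul]
    conv_lhs => rw [← (ℛ k a).eq]
    simp only [TensorProduct.tmul_sum, map_sum, TensorProduct.assoc_symm_tmul,
      LinearMap.rTensor_tmul, LinearMap.comp_apply, LinearMap.lTensor_tmul, actRLin_tmul, ract_ract]
    simp only [← LinearMap.sum_apply, ← map_sum, ← Finset.op_sum, sum_antipode_mul_eq_smul]
    simp

variable {M} {N : HopfBimod k A}

/-- Only the right structures enter the definition of `coinv`, so linear maps respecting these are
enough. -/
lemma coinv_comp {f : M →ₗ[k] N} (h1 : ∀ b, f ∘ₗ M.ract b = N.ract b ∘ₗ f)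
    (h2 : N.rcoact ∘ₗ f = f.rTensor A ∘ₗ M.rcoact) (m : M) : N.coinv (f m) = f (M.coinv m) := by
  have h3 := congr($h2 m)
  simp only [LinearMap.comp_apply] at h3
  simp only [coinv, LinearMap.comp_apply, h3]
  generalize M.rcoact m = x
  induction x with
  | zero => simp
  | add x y hx hy => simp only [map_add, hx, hy]
  | tmul m a => exact congr($((h1 (MulOpposite.op (antipode k a))).symm) m)

/-- The morphism of right Hopf modules attached to a linear map. -/
def average (ψ : M →ₗ[k] N) : M →ₗ[k] N :=
  actRLin k A N ∘ₗ (N.coinv ∘ₗ ψ ∘ₗ M.coinv).rTensor A ∘ₗ M.rcoact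

/-- In terms of M ≅ M^{co A} ⊗ A, the map `average ψ` sends v ⊗ a, for v coinvariant, to the
coinvariant part of ψ(v), times a. Linearity follows because `coinv` turns the factor b⁽¹⁾ into
ε(b⁽¹⁾), which leaves b alone on the right. -/
lemma average_ract (ψ : M →ₗ[k] N) (b : Aᵐᵒᵖ) :
    average ψ ∘ₗ M.ract b = N.ract b ∘ₗ average ψ := by
  obtain ⟨b, rfl⟩ := MulOpposite.op_surjective b
  refine LinearMap.ext fun m => ?_
  simp only [average, LinearMap.comp_apply, rcoact_ract_apply, map_sum]
  generalize M.rcoact m = x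
  induction x with
  | zero => simp
  | add x y hx hy => simp only [map_add, Finset.sum_add_distrib, hx, hy]
  | tmul m a =>
    simp only [TensorProduct.map_tmul, LinearMap.rTensor_tmul, LinearMap.comp_apply, coinv_ract,
      map_smul, LinearMap.mulRight_apply, actRLin_tmul, ract_ract]
    conv_rhs => rw [← sum_counit_smul (ℛ k b)]
    simp [Finset.mul_sum, Finset.op_sum]

/-- The values of `χ` are coinvariant, so the coaction sees only the right-hand factor m₁ of ∑ χ(m₀)
m₁, and coassociativity concludes. -/
lemma average_rcoact (ψ : M →ₗ[k] N) :
    N.rcoact ∘ₗ average ψ = (average ψ).rTensor A ∘ₗ M.rcoact := by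
  let χ := N.coinv ∘ₗ ψ ∘ₗ M.coinv
  have h1 : ∀ x : M ⊗[k] A, N.rcoact (actRLin k A N (χ.rTensor A x)) =
      (actRLin k A N ∘ₗ χ.rTensor A).rTensor A
        ((TensorProduct.assoc k M A A).symm (comul.lTensor M x)) := by
    intro x
    induction x with
    | zero => simp
    | add x y hx hy => simp only [map_add, hx, hy]
    | tmul m a =>
      rw [LinearMap.rTensor_tmul, actRLin_tmul,
        rcoact_ract_of_coinvariant N (m := χ m) (rcoact_coinv N _), LinearMap.lTensor_tmul]
      generalize comul (R := k) a = y
      induction y with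
      | zero => simp
      | add x y hx hy => simp only [TensorProduct.tmul_add, map_add, hx, hy]
      | tmul a b => rfl
  refine LinearMap.ext fun m => ?_
  have h4 := congr((TensorProduct.assoc k M A A).symm ($(M.rcoact_coassoc) m))
  simp only [LinearMap.comp_apply, LinearEquiv.coe_coe, LinearEquiv.symm_apply_apply] at h4
  refine (h1 (M.rcoact m)).trans ?_
  rw [← h4, ← LinearMap.comp_apply (LinearMap.rTensor A _) (LinearMap.rTensor A _),
    ← LinearMap.rTensor_comp]
  rfl

/-- A morphism ψ of right Hopf modules preserves coinvariants, so the outer projection does nothing,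
and ∑ ψ(coinv m₀) m₁ = ψ(∑ coinv(m₀) m₁) = ψ(m). -/
lemma average_eq (ψ : M →ₗ[k] N) (h1 : ∀ b, ψ ∘ₗ M.ract b = N.ract b ∘ₗ ψ)
    (h2 : N.rcoact ∘ₗ ψ = ψ.rTensor A ∘ₗ M.rcoact) : average ψ = ψ := by
  refine LinearMap.ext fun m => ?_
  have h3 : N.coinv ∘ₗ ψ ∘ₗ M.coinv = ψ ∘ₗ M.coinv := LinearMap.ext fun m => by
    simp only [LinearMap.comp_apply]
    rw [coinv_comp h1 h2, coinv_of_coinvariant _ (rcoact_coinv _ _)]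
  rw [average, h3]
  conv_rhs => rw [← actRLin_coinv M m]
  simp only [LinearMap.comp_apply]
  generalize M.rcoact m = x
  induction x with
  | zero => simp
  | add x y hx hy => simp only [map_add, hx, hy]
  | tmul m a => exact congr($((h1 (MulOpposite.op a)).symm) (M.coinv m))

lemma average_comp {K : HopfBimod k A} (f : K ⟶ M) (ψ : M →ₗ[k] N) :
    average ψ ∘ₗ f.lin = average (ψ ∘ₗ f.lin) := by
  have h3 : (N.coinv ∘ₗ ψ ∘ₗ M.coinv) ∘ₗ f.lin = N.coinv ∘ₗ (ψ ∘ₗ f.lin) ∘ₗ K.coinv :=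
    LinearMap.ext fun m => by
      simp only [LinearMap.comp_apply]
      rw [coinv_comp f.ract f.rcoact]
  rw [average, average, LinearMap.comp_assoc, LinearMap.comp_assoc, f.rcoact,
    ← h3, LinearMap.rTensor_comp A _ f.lin, LinearMap.comp_assoc]

/-- Morphisms of right Hopf modules extend along injective morphisms. -/
lemma exists_extension_right {K : HopfBimod k A} (f : K ⟶ M) (hf : Function.Injective f.lin)
    (φ : K →ₗ[k] N) (h1 : ∀ b, φ ∘ₗ K.ract b = N.ract b ∘ₗ φ)
    (h2 : N.rcoact ∘ₗ φ = φ.rTensor A ∘ₗ K.rcoact) :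
    ∃ ψ : M →ₗ[k] N, ψ ∘ₗ f.lin = φ ∧ (∀ b, ψ ∘ₗ M.ract b = N.ract b ∘ₗ ψ) ∧
      N.rcoact ∘ₗ ψ = ψ.rTensor A ∘ₗ M.rcoact := by
  -- The retraction r is merely linear. Averaging φ ∘ r makes it a morphism of right Hopf modules,
  -- and does not disturb the restriction to K since averaging commutes with f and fixes φ.
  obtain ⟨r, hr⟩ := f.lin.exists_leftInverse_of_injective (LinearMap.ker_eq_bot.2 hf)
  refine ⟨average (φ ∘ₗ r), ?_, average_ract _, average_rcoact _⟩
  rw [average_comp, LinearMap.comp_assoc, hr, LinearMap.comp_id, average_eq φ h1 h2]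

end Coinvariants

end HopfBimod

end GS

/-! ### Morphisms from A ⊗ K, with free left action, to A ⊗ Y, with cofree left coaction -/

namespace GS

open HopfAlgebra WithConv

namespace HopfBimod

variable {k A : Type u} [Field k] [Ring A] [HopfAlgebra k A]

section Induced

variable {K P Y Z : HopfBimod k A}

/-- The morphism `a ⊗ m ↦ a φ(m)` attached to a morphism `φ` of right Hopf modules and of left
comodules. -/
def indLLift (φ : P →ₗ[k] Z) (h1 : ∀ b, φ ∘ₗ P.ract b = Z.ract b ∘ₗ φ)
    (h2 : Z.lcoact ∘ₗ φ = φ.lTensor A ∘ₗ P.lcoact) (h3 : Z.rcoact ∘ₗ φ = φ.rTensor A ∘ₗ P.rcoact) :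
    (indL k A).obj P ⟶ Z where
  lin := actLLin k A Z ∘ₗ TensorProduct.map (LinearMap.id (R := k) (M := A)) φ
  lact a := TensorProduct.ext' fun x m => congr($(map_mul Z.lact a x) (φ m))
  ract b := TensorProduct.ext' fun x m => by
    change Z.lact x (φ (P.ract b m)) = Z.ract b (Z.lact x (φ m))
    exact congr(Z.lact x ($(h1 b) m)).trans congr($((Z.act_comm x b).eq) (φ m))
  lcoact := by
    change Z.lcoact ∘ₗ actLLin k A Z ∘ₗ TensorProduct.map (LinearMap.id (R := k) (M := A)) φ =
      (actLLin k A Z ∘ₗ TensorProduct.map (LinearMap.id (R := k) (M := A)) φ).lTensor A ∘ₗ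
        muxL k A A P ∘ₗ TensorProduct.map comul P.lcoact
    rw [← LinearMap.comp_assoc, lcoact_actLLin, codiagL, LinearMap.comp_assoc, LinearMap.comp_assoc,
      ← TensorProduct.map_comp, h2, LinearMap.comp_id]
    -- An identity map is inserted on the first factor to bring the expression to the form required
    -- by `muxL_natural`.
    have h4 : TensorProduct.map (comul (R := k) (A := A)) (φ.lTensor A ∘ₗ P.lcoact) =
        TensorProduct.map ((LinearMap.id (R := k) (M := A)).lTensor A) (φ.lTensor A) ∘ₗ
          TensorProduct.map comul P.lcoact := by
      rw [← TensorProduct.map_comp, LinearMap.lTensor_id, LinearMap.id_comp]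
    rw [h4, ← LinearMap.comp_assoc (TensorProduct.map _ _) (TensorProduct.map _ _), muxL_natural,
      LinearMap.comp_assoc, LinearMap.lTensor_comp]
    rfl
  rcoact := by
    change Z.rcoact ∘ₗ actLLin k A Z ∘ₗ TensorProduct.map (LinearMap.id (R := k) (M := A)) φ =
      (actLLin k A Z ∘ₗ TensorProduct.map (LinearMap.id (R := k) (M := A)) φ).rTensor A ∘ₗ
        muxR k A A P ∘ₗ TensorProduct.map comul P.rcoact
    rw [← LinearMap.comp_assoc, rcoact_actLLin, codiagR, LinearMap.comp_assoc, LinearMap.comp_assoc,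
      ← TensorProduct.map_comp, h3, LinearMap.comp_id]
    have h4 : TensorProduct.map (comul (R := k) (A := A)) (φ.rTensor A ∘ₗ P.rcoact) =
        TensorProduct.map ((LinearMap.id (R := k) (M := A)).rTensor A) (φ.rTensor A) ∘ₗ
          TensorProduct.map comul P.rcoact := by
      rw [← TensorProduct.map_comp, LinearMap.rTensor_id, LinearMap.id_comp]
    rw [h4, ← LinearMap.comp_assoc (TensorProduct.map _ _) (TensorProduct.map _ _), muxR_natural,
      LinearMap.comp_assoc, LinearMap.rTensor_comp]
    rfl

variable (Y) in
/-- The linear map `m ↦ ∑ m₋₁ ⊗ β(m₀)` attached to a linear map `β`. -/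
def coindLLin (β : P →ₗ[k] Y) : P →ₗ[k] (coindL k A).obj Y :=
  show P →ₗ[k] A ⊗[k] Y from β.lTensor A ∘ₗ P.lcoact

lemma coindLLin_ract {β : P →ₗ[k] Y} (h1 : ∀ b, β ∘ₗ P.ract b = Y.ract b ∘ₗ β) (b : Aᵐᵒᵖ) :
    coindLLin Y β ∘ₗ P.ract b = ((coindL k A).obj Y).ract b ∘ₗ coindLLin Y β := by
  change (β.lTensor A ∘ₗ P.lcoact) ∘ₗ P.ract b =
    diag (rreg k A) Y.ract b ∘ₗ β.lTensor A ∘ₗ P.lcoact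
  have h2 : β.lTensor A ∘ₗ diag (rreg k A) P.ract b = diag (rreg k A) Y.ract b ∘ₗ β.lTensor A :=
    diag_natural (f := LinearMap.id) (fun _ => rfl) h1 b
  rw [LinearMap.comp_assoc, P.lcoact_ract, ← LinearMap.comp_assoc, h2, LinearMap.comp_assoc]

lemma coindLLin_lcoact (β : P →ₗ[k] Y) :
    ((coindL k A).obj Y).lcoact ∘ₗ coindLLin Y β = (coindLLin Y β).lTensor A ∘ₗ P.lcoact := by
  refine LinearMap.ext fun m => ?_
  change TensorProduct.assoc k A A Y ((comul (R := k)).rTensor Y (β.lTensor A (P.lcoact m))) =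
    (β.lTensor A ∘ₗ P.lcoact).lTensor A (P.lcoact m)
  have h := congr($(P.lcoact_coassoc) m)
  simp only [LinearMap.comp_apply] at h
  rw [LinearMap.lTensor_comp, LinearMap.comp_apply, ← h]
  generalize P.lcoact m = x
  induction x with
  | zero => simp
  | add x y hx hy => simp only [map_add, hx, hy]
  | tmul a m =>
    simp only [LinearMap.lTensor_tmul, LinearMap.rTensor_tmul, LinearEquiv.coe_coe]
    generalize comul (R := k) a = x
    induction x with
    | zero => simp
    | add x y hx hy => simp only [map_add, TensorProduct.add_tmul, hx, hy]
    | tmul a b => simp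

/-- The right coaction of A ⊗ Y is that of Y, so colinearity of β and the commutation of the two
coactions of P suffice. -/
lemma coindLLin_rcoact {β : P →ₗ[k] Y} (h2 : Y.rcoact ∘ₗ β = β.rTensor A ∘ₗ P.rcoact) :
    ((coindL k A).obj Y).rcoact ∘ₗ coindLLin Y β = (coindLLin Y β).rTensor A ∘ₗ P.rcoact := by
  refine LinearMap.ext fun m => (TensorProduct.assoc k A Y A).injective ?_
  refine ((TensorProduct.assoc k A Y A).apply_symm_apply _).trans ?_
  change Y.rcoact.lTensor A (β.lTensor A (P.lcoact m)) = TensorProduct.assoc k A Y A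
    ((β.lTensor A ∘ₗ P.lcoact).rTensor A (P.rcoact m))
  have h := congr($(P.coact_comm) m)
  simp only [LinearMap.comp_apply] at h
  rw [← LinearMap.comp_apply (LinearMap.lTensor A _) (LinearMap.lTensor A _),
    ← LinearMap.lTensor_comp, h2, LinearMap.lTensor_comp, LinearMap.comp_apply, ← h,
    LinearMap.rTensor_comp, LinearMap.comp_apply]
  generalize P.lcoact.rTensor A (P.rcoact m) = x
  induction x with
  | zero => simp
  | add x y hx hy => simp only [map_add, hx, hy]
  | tmul y b =>
    induction y with
    | zero => simp
    | add x y hx hy => simp only [TensorProduct.add_tmul, map_add, hx, hy]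
    | tmul a m => simp

variable (Y) in
/-- The linear map `a ⊗ y ↦ ε(a) y`. -/
def counitL : A ⊗[k] Y →ₗ[k] Y := (TensorProduct.lid k Y).toLinearMap ∘ₗ counit.rTensor Y

@[simp] lemma counitL_tmul (a : A) (y : Y) : counitL Y (a ⊗ₜ y) = counit (R := k) a • y := rfl

/-- The linear map `m ↦ (ε ⊗ id) (α (1 ⊗ m))`. -/
def coindLCoeff (α : (indL k A).obj K ⟶ (coindL k A).obj Y) : K →ₗ[k] Y :=
  counitL Y ∘ₗ (show A ⊗[k] K →ₗ[k] A ⊗[k] Y from α.lin) ∘ₗ TensorProduct.mk k A K 1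

/-- On A ⊗ K the right action moves only K, so α(1 ⊗ m b) = α(1 ⊗ m) b; the action on A ⊗ Y is
diagonal, but ε is multiplicative and absorbs its part on A. -/
lemma coindLCoeff_ract (α : (indL k A).obj K ⟶ (coindL k A).obj Y) (b : Aᵐᵒᵖ) :
    coindLCoeff α ∘ₗ K.ract b = Y.ract b ∘ₗ coindLCoeff α := by
  refine LinearMap.ext fun m => ?_
  have h : ∀ x : A ⊗[k] Y, counitL Y (diag (rreg k A) Y.ract b x) = Y.ract b (counitL Y x) := by
    obtain ⟨b, rfl⟩ := MulOpposite.op_surjective b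
    intro x
    rw [diag_apply _ _ (opRepr (ℛ k b)), LinearMap.sum_apply]
    induction x with
    | zero => simp
    | add x y hx hy => simp only [map_add, Finset.sum_add_distrib, hx, hy]
    | tmul a y =>
      simp only [TensorProduct.map_tmul, map_sum, counitL_tmul, rreg_apply, opRepr,
        Bialgebra.counit_mul, map_smul, mul_smul]
      rw [← Finset.smul_sum]
      congr 1
      conv_rhs => rw [← sum_counit_smul (ℛ k b)]
      simp
  exact congr(counitL Y ($(α.ract b) ((1 : A) ⊗ₜ[k] m))).trans (h _)

/-- The coaction of A ⊗ K is codiagonal, but Δ(1) = 1 ⊗ 1, so 1 ⊗ m coacts through m alone; on A ⊗ Y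
the right coaction does not involve A, so it commutes with ε ⊗ id. -/
lemma coindLCoeff_rcoact (α : (indL k A).obj K ⟶ (coindL k A).obj Y) :
    Y.rcoact ∘ₗ coindLCoeff α = (coindLCoeff α).rTensor A ∘ₗ K.rcoact := by
  refine LinearMap.ext fun m => ?_
  have h : ∀ x : A ⊗[k] Y, Y.rcoact (counitL Y x) = (counitL Y).rTensor A
      (coactSnd A Y.rcoact x) := by
    intro x
    induction x with
    | zero => simp
    | add x y hx hy => simp only [map_add, hx, hy]
    | tmul a y =>
      simp only [coactSnd, LinearMap.comp_apply, LinearMap.lTensor_tmul, counitL_tmul, map_smul,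
        LinearEquiv.coe_coe]
      generalize Y.rcoact y = x
      induction x with
      | zero => simp
      | add x y hx hy => simp only [map_add, TensorProduct.tmul_add, smul_add, hx, hy]
      | tmul y b => simp [TensorProduct.smul_tmul']
  refine (h _).trans (congr((counitL Y).rTensor A ($(α.rcoact) ((1 : A) ⊗ₜ[k] m))).trans ?_)
  let ψ : A ⊗[k] K →ₗ[k] A ⊗[k] Y := α.lin
  change (counitL Y).rTensor A (ψ.rTensor A (muxR k A A K (comul (1 : A) ⊗ₜ K.rcoact m))) =
    (coindLCoeff α).rTensor A (K.rcoact m)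
  rw [Bialgebra.comul_one, Algebra.TensorProduct.one_def]
  generalize K.rcoact m = x
  induction x with
  | zero => simp
  | add x y hx hy => simp only [map_add, TensorProduct.tmul_add, hx, hy]
  | tmul y b =>
    rw [muxR_tmul, one_mul]
    rfl

/-- Because the left coaction of A ⊗ Y is cofree, an element is recovered by coacting on the left
and then applying ε ⊗ id to the coacted part. For α(1 ⊗ m), colinearity of α expresses the result
through the coefficient of α. -/
lemma coindLLin_coindLCoeff (α : (indL k A).obj K ⟶ (coindL k A).obj Y) (m : K) :
    coindLLin Y (coindLCoeff α) m = α.lin ((1 : A) ⊗ₜ[k] m) := by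
  have h : ∀ x : A ⊗[k] Y, (counitL Y).lTensor A (coactFst comul Y x) = x := by
    intro x
    induction x with
    | zero => simp
    | add x y hx hy => simp only [map_add, hx, hy]
    | tmul a y =>
      simp only [coactFst, LinearMap.comp_apply, LinearMap.rTensor_tmul]
      conv_lhs => rw [← (ℛ k a).eq]
      simp only [TensorProduct.sum_tmul, map_sum, LinearEquiv.coe_coe, TensorProduct.assoc_tmul,
        LinearMap.lTensor_tmul, counitL_tmul]
      simp only [TensorProduct.tmul_smul, TensorProduct.smul_tmul']
      rw [← TensorProduct.sum_tmul, sum_smul_counit (ℛ k a)]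
  refine Eq.trans ?_ (h _)
  refine Eq.trans ?_ congr((counitL Y).lTensor A ($(α.lcoact) ((1 : A) ⊗ₜ[k] m))).symm
  let ψ : A ⊗[k] K →ₗ[k] A ⊗[k] Y := α.lin
  change (coindLCoeff α).lTensor A (K.lcoact m) =
    (counitL Y).lTensor A (ψ.lTensor A (muxL k A A K (comul (1 : A) ⊗ₜ K.lcoact m)))
  rw [Bialgebra.comul_one, Algebra.TensorProduct.one_def]
  generalize K.lcoact m = x
  induction x with
  | zero => simp
  | add x y hx hy => simp only [map_add, TensorProduct.tmul_add, hx, hy]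
  | tmul b y =>
    rw [muxL_tmul, one_mul]
    rfl

/-- The morphism α is determined by the elements α(1 ⊗ m), hence by its coefficient K → Y, a
morphism of right Hopf modules. This extends to β on P by `exists_extension_right`; cofreeness and
then freeness turn β back into a morphism on A ⊗ P. -/
lemma exists_extension_indL (f : K ⟶ P) (hf : Function.Injective f.lin)
    (α : (indL k A).obj K ⟶ (coindL k A).obj Y) :
    ∃ α' : (indL k A).obj P ⟶ (coindL k A).obj Y, (indL k A).map f ≫ α' = α := by
  obtain ⟨β, hβ, h1, h2⟩ := exists_extension_right f hf (coindLCoeff α) (coindLCoeff_ract α)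
    (coindLCoeff_rcoact α)
  refine ⟨indLLift (coindLLin Y β) (coindLLin_ract h1) (coindLLin_lcoact β) (coindLLin_rcoact h2),
    hom_ext <| TensorProduct.ext' fun a m => ?_⟩
  have h3 : coindLLin Y β (f.lin m) = α.lin ((1 : A) ⊗ₜ[k] m) := by
    rw [← coindLLin_coindLCoeff, ← hβ]
    change β.lTensor A (P.lcoact (f.lin m)) = (β ∘ₗ f.lin).lTensor A (K.lcoact m)
    rw [LinearMap.lTensor_comp, LinearMap.comp_apply]
    exact congr(β.lTensor A ($(f.lcoact) m))
  change ((coindL k A).obj Y).lact a (coindLLin Y β (f.lin m)) = _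
  rw [h3]
  refine congr($((α.lact a).symm) ((1 : A) ⊗ₜ[k] m)).trans ?_
  let ψ : A ⊗[k] K →ₗ[k] A ⊗[k] Y := α.lin
  exact congr(ψ ($(mul_one (M := A) a) ⊗ₜ[k] m))

end Induced

end HopfBimod

end GS

/-! ### Associativity of the two tensor products -/

namespace GS

open HopfAlgebra WithConv

section Associativity

variable {k A : Type u} [Field k] [Ring A] [HopfAlgebra k A]
  {U V W : Type*} [AddCommGroup U] [Module k U] [AddCommGroup V] [Module k V]
  [AddCommGroup W] [Module k W]

lemma codiagL_assoc (lU : U →ₗ[k] A ⊗[k] U) (lV : V →ₗ[k] A ⊗[k] V) (lW : W →ₗ[k] A ⊗[k] W) :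
    codiagL lU (codiagL lV lW) ∘ₗ (TensorProduct.assoc k U V W).toLinearMap =
      (TensorProduct.assoc k U V W).toLinearMap.lTensor A ∘ₗ codiagL (codiagL lU lV) lW := by
  refine TensorProduct.ext_threefold fun u v w => ?_
  simp only [codiagL, LinearMap.comp_apply, LinearEquiv.coe_coe, TensorProduct.assoc_tmul,
    TensorProduct.map_tmul]
  generalize lU u = x
  generalize lV v = y
  generalize lW w = z
  induction x with
  | zero => simp
  | add x x' hx hx' => simp only [TensorProduct.add_tmul, map_add, hx, hx']
  | tmul a u =>
    induction y with
    | zero => simp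
    | add x x' hx hx' => simp only [TensorProduct.add_tmul, TensorProduct.tmul_add, map_add, hx, hx']
    | tmul b v =>
      induction z with
      | zero => simp
      | add x x' hx hx' => simp only [TensorProduct.tmul_add, map_add, hx, hx']
      | tmul c w => simp [mul_assoc]

lemma codiagR_assoc (rU : U →ₗ[k] U ⊗[k] A) (rV : V →ₗ[k] V ⊗[k] A) (rW : W →ₗ[k] W ⊗[k] A) :
    codiagR rU (codiagR rV rW) ∘ₗ (TensorProduct.assoc k U V W).toLinearMap =
      (TensorProduct.assoc k U V W).toLinearMap.rTensor A ∘ₗ codiagR (codiagR rU rV) rW := by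
  refine TensorProduct.ext_threefold fun u v w => ?_
  simp only [codiagR, LinearMap.comp_apply, LinearEquiv.coe_coe, TensorProduct.assoc_tmul,
    TensorProduct.map_tmul]
  generalize rU u = x
  generalize rV v = y
  generalize rW w = z
  induction x with
  | zero => simp
  | add x x' hx hx' => simp only [TensorProduct.add_tmul, map_add, hx, hx']
  | tmul u a =>
    induction y with
    | zero => simp
    | add x x' hx hx' => simp only [TensorProduct.add_tmul, TensorProduct.tmul_add, map_add, hx, hx']
    | tmul v b =>
      induction z with
      | zero => simp
      | add x x' hx hx' => simp only [TensorProduct.tmul_add, map_add, hx, hx']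
      | tmul w c => simp [mul_assoc]

variable (A) in
lemma lTensor_injective {f : U →ₗ[k] V} (hf : Function.Injective f) :
    Function.Injective (f.lTensor A) :=
  Module.Flat.lTensor_preserves_injective_linearMap f hf

variable (A) in
lemma rTensor_injective {f : U →ₗ[k] V} (hf : Function.Injective f) :
    Function.Injective (f.rTensor A) :=
  Module.Flat.rTensor_preserves_injective_linearMap f hf

lemma coactFst_assoc (lU : U →ₗ[k] A ⊗[k] U) :
    coactFst (A := A) lU (V ⊗[k] W) ∘ₗ (TensorProduct.assoc k U V W).toLinearMap =
      (TensorProduct.assoc k U V W).toLinearMap.lTensor A ∘ₗ coactFst (coactFst lU V) W := by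
  refine TensorProduct.ext_threefold fun u v w => ?_
  simp only [coactFst, LinearMap.comp_apply, LinearEquiv.coe_coe, TensorProduct.assoc_tmul,
    LinearMap.rTensor_tmul]
  generalize lU u = x
  induction x with
  | zero => simp
  | add x x' hx hx' => simp only [TensorProduct.add_tmul, map_add, hx, hx']
  | tmul a u => simp

lemma coactSnd_assoc (rW : W →ₗ[k] W ⊗[k] A) :
    coactSnd (A := A) U (coactSnd V rW) ∘ₗ (TensorProduct.assoc k U V W).toLinearMap =
      (TensorProduct.assoc k U V W).toLinearMap.rTensor A ∘ₗ coactSnd (U ⊗[k] V) rW := by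
  refine TensorProduct.ext_threefold fun u v w => ?_
  simp only [coactSnd, LinearMap.comp_apply, LinearEquiv.coe_coe, TensorProduct.assoc_tmul,
    LinearMap.lTensor_tmul]
  generalize rW w = x
  induction x with
  | zero => simp
  | add x x' hx hx' => simp only [TensorProduct.tmul_add, map_add, hx, hx']
  | tmul w a => simp

end Associativity

namespace HopfBimod

variable {k A : Type u} [Field k] [Ring A] [HopfAlgebra k A]

/-- A morphism of Hopf bimodules which is a linear isomorphism is an isomorphism. -/
def isoOfLinearEquiv {M N : HopfBimod k A} (f : M ⟶ N) (e : M ≃ₗ[k] N)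
    (h : f.lin = e.toLinearMap) : M ≅ N where
  hom := f
  inv :=
    { lin := e.symm.toLinearMap
      lact := fun a => LinearMap.ext fun n => e.injective <| by
        have h1 := congr($(f.lact a) (e.symm n))
        simp only [h, LinearMap.comp_apply, LinearEquiv.coe_coe, LinearEquiv.apply_symm_apply] at h1 ⊢
        exact h1.symm
      ract := fun a => LinearMap.ext fun n => e.injective <| by
        have h1 := congr($(f.ract a) (e.symm n))
        simp only [h, LinearMap.comp_apply, LinearEquiv.coe_coe, LinearEquiv.apply_symm_apply] at h1 ⊢
        exact h1.symm
      lcoact := by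
        have h1 : M.lcoact = e.symm.toLinearMap.lTensor A ∘ₗ N.lcoact ∘ₗ e.toLinearMap := by
          rw [← h, f.lcoact, h, ← LinearMap.comp_assoc, ← LinearMap.lTensor_comp]
          simp
        rw [h1, LinearMap.comp_assoc, LinearMap.comp_assoc]
        simp
      rcoact := by
        have h1 : M.rcoact = e.symm.toLinearMap.rTensor A ∘ₗ N.rcoact ∘ₗ e.toLinearMap := by
          rw [← h, f.rcoact, h, ← LinearMap.comp_assoc, ← LinearMap.rTensor_comp]
          simp
        rw [h1, LinearMap.comp_assoc, LinearMap.comp_assoc]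
        simp }
  hom_inv_id := hom_ext <| LinearMap.ext fun m => by simp [h]
  inv_hom_id := hom_ext <| LinearMap.ext fun m => by simp [h]

/-- The associativity isomorphism of `hTensor`. -/
def hTensorAssoc (U V W : HopfBimod k A) : hTensor (hTensor U V) W ≅ hTensor U (hTensor V W) :=
  isoOfLinearEquiv
    { lin := (TensorProduct.assoc k U V W).toLinearMap
      lact := fun _ => TensorProduct.ext_threefold fun _ _ _ => rfl
      ract := fun _ => TensorProduct.ext_threefold fun _ _ _ => rfl
      lcoact := codiagL_assoc _ _ _
      rcoact := codiagR_assoc _ _ _ } (TensorProduct.assoc k U V W) rfl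

/-- The associativity isomorphism of `cTensor`. -/
def cTensorAssoc (U V W : HopfBimod k A) : cTensor (cTensor U V) W ≅ cTensor U (cTensor V W) :=
  isoOfLinearEquiv
    { lin := (TensorProduct.assoc k U V W).toLinearMap
      lact := fun _ => LinearMap.ext fun _ => diag_assoc _ _ _ _ _
      ract := fun _ => LinearMap.ext fun _ => diag_assoc _ _ _ _ _
      lcoact := coactFst_assoc _
      rcoact := coactSnd_assoc _ } (TensorProduct.assoc k U V W) rfl

/-! ### Exact sequences, factorisations and admissible pairs of functors -/

/-- Short exact sequences of Hopf bimodules. -/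
structure IsSES {K P M : HopfBimod k A} (f : K ⟶ P) (g : P ⟶ M) : Prop where
  injective : Function.Injective f.lin
  exact : Function.Exact f.lin g.lin
  surjective : Function.Surjective g.lin

variable {K P M : HopfBimod k A} {f : K ⟶ P} {g : P ⟶ M}

lemma IsSES.indL (h : IsSES f g) : IsSES ((indL k A).map f) ((indL k A).map g) where
  injective := lTensor_injective A h.injective
  exact := lTensor_exact A h.exact h.surjective
  surjective := LinearMap.lTensor_surjective A h.surjective

lemma IsSES.indR (h : IsSES f g) : IsSES ((indR k A).map f) ((indR k A).map g) where
  injective := rTensor_injective A h.injective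
  exact := rTensor_exact A h.exact h.surjective
  surjective := LinearMap.rTensor_surjective A h.surjective

lemma IsSES.comp_eq_zero (h : IsSES f g) : f ≫ g = 0 :=
  hom_ext h.exact.linearMap_comp_eq_zero

/-- A morphism vanishing on the image of `f` factors through a surjective morphism `g` whose kernel
is contained in that image. -/
lemma exists_desc (hfg : ∀ x, g.lin x = 0 → ∃ y, f.lin y = x) (hg : Function.Surjective g.lin)
    {Z : HopfBimod k A} (φ : P ⟶ Z) (hφ : f ≫ φ = 0) : ∃ ψ : M ⟶ Z, g ≫ ψ = φ := by
  have hk : LinearMap.ker g.lin ≤ LinearMap.ker φ.lin := fun x hx => by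
    obtain ⟨y, rfl⟩ := hfg x hx
    exact congr(Hom.lin $hφ y)
  -- The linear section only serves to write down a linear factorisation; compatibility with the
  -- structures then follows by cancelling the surjection g (`hc`).
  obtain ⟨s, hs⟩ := g.lin.exists_rightInverse_of_surjective (LinearMap.range_eq_top.2 hg)
  have hs' : ∀ m, g.lin (s m) = m := fun m => congr($hs m)
  have hl : (φ.lin ∘ₗ s) ∘ₗ g.lin = φ.lin := LinearMap.ext fun x => by
    have h1 : s (g.lin x) - x ∈ LinearMap.ker g.lin := by simp [hs']
    have h2 := hk h1
    rw [LinearMap.mem_ker, map_sub, sub_eq_zero] at h2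
    exact h2
  have hc : ∀ {E : Type u} [AddCommGroup E] [Module k E] {u v : M →ₗ[k] E},
      u ∘ₗ g.lin = v ∘ₗ g.lin → u = v := fun {E} _ _ {u v} h => LinearMap.ext fun m => by
    obtain ⟨x, rfl⟩ := hg m
    exact congr($h x)
  refine ⟨⟨φ.lin ∘ₗ s, fun a => hc ?_, fun a => hc ?_, hc ?_, hc ?_⟩, hom_ext hl⟩
  · rw [LinearMap.comp_assoc, ← g.lact, ← LinearMap.comp_assoc, hl, φ.lact, LinearMap.comp_assoc, hl]
  · rw [LinearMap.comp_assoc, ← g.ract, ← LinearMap.comp_assoc, hl, φ.ract, LinearMap.comp_assoc, hl]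
  · rw [LinearMap.comp_assoc, hl, LinearMap.comp_assoc, g.lcoact, ← LinearMap.comp_assoc,
      ← LinearMap.lTensor_comp, hl, φ.lcoact]
  · rw [LinearMap.comp_assoc, hl, LinearMap.comp_assoc, g.rcoact, ← LinearMap.comp_assoc,
      ← LinearMap.rTensor_comp, hl, φ.rcoact]

/-- A morphism killed by `g` factors through an injective morphism `f` whose image contains the
kernel of `g`. -/
lemma exists_lift (hfg : ∀ x, g.lin x = 0 → ∃ y, f.lin y = x) (hf : Function.Injective f.lin)
    {Z : HopfBimod k A} (φ : Z ⟶ P) (hφ : φ ≫ g = 0) : ∃ ψ : Z ⟶ K, ψ ≫ f = φ := by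
  have hr : LinearMap.range φ.lin ≤ LinearMap.range f.lin := by
    rintro _ ⟨z, rfl⟩
    exact hfg _ congr(Hom.lin $hφ z)
  obtain ⟨r, hr'⟩ := f.lin.exists_leftInverse_of_injective (LinearMap.ker_eq_bot.2 hf)
  have hl : f.lin ∘ₗ (r ∘ₗ φ.lin) = φ.lin := LinearMap.ext fun z => by
    obtain ⟨y, hy⟩ := hr ⟨z, rfl⟩
    have h1 : r (f.lin y) = y := congr($hr' y)
    change f.lin (r (φ.lin z)) = φ.lin z
    rw [← hy, h1]
  -- Dually, f is cancelled on the left. For the coactions it is f tensored with A that must be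
  -- injective, which holds by flatness over a field.
  have hc : ∀ {E : Type u} [AddCommGroup E] [Module k E] {B : Type u} [AddCommGroup B] [Module k B]
      {i : E →ₗ[k] B} (_ : Function.Injective i) {u v : Z →ₗ[k] E}, i ∘ₗ u = i ∘ₗ v → u = v :=
    fun {_} _ _ {_} _ _ {_} hi {u v} h => LinearMap.ext fun z => hi congr($h z)
  refine ⟨⟨r ∘ₗ φ.lin, fun a => hc hf ?_, fun a => hc hf ?_,
    hc (lTensor_injective A hf) ?_,
    hc (rTensor_injective A hf) ?_⟩, hom_ext hl⟩
  · rw [← LinearMap.comp_assoc, hl, ← LinearMap.comp_assoc, f.lact, LinearMap.comp_assoc, hl, φ.lact]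
  · rw [← LinearMap.comp_assoc, hl, ← LinearMap.comp_assoc, f.ract, LinearMap.comp_assoc, hl, φ.ract]
  · rw [← LinearMap.comp_assoc, ← f.lcoact, LinearMap.comp_assoc, hl, φ.lcoact,
      ← LinearMap.comp_assoc, ← LinearMap.lTensor_comp, hl]
  · rw [← LinearMap.comp_assoc, ← f.rcoact, LinearMap.comp_assoc, hl, φ.rcoact,
      ← LinearMap.comp_assoc, ← LinearMap.rTensor_comp, hl]

/-- The properties of a pair of functors `F`, `G`, with an augmentation of `F` and a coaugmentation
of `G`, which make the cohomology of the double complex `Hom (B_q, C^p)` an `Ext`. -/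
structure IsAdmissible {F G : HopfBimod k A ⥤ HopfBimod k A} (ε : F ⟶ 𝟭 _) (η : 𝟭 _ ⟶ G) :
    Prop where
  isSES : ∀ {K P M : HopfBimod k A} {f : K ⟶ P} {g : P ⟶ M}, IsSES f g → IsSES (F.map f) (F.map g)
  section' : ∃ s : ∀ M : HopfBimod k A, M →ₗ[k] F.obj M,
    (∀ M m, (counitApp ε M).lin (s M m) = m) ∧
      ∀ {M N : HopfBimod k A} (f : M ⟶ N) m, s N (f.lin m) = (F.map f).lin (s M m)
  retraction : ∃ θ : ∀ N : HopfBimod k A, G.obj N →ₗ[k] N,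
    (∀ N n, θ N ((unitApp η N).lin n) = n) ∧
      ∀ {M N : HopfBimod k A} (f : M ⟶ N) x, θ N ((G.map f).lin x) = f.lin (θ M x)
  extension : ∀ {K P : HopfBimod k A} (Y : HopfBimod k A) (f : K ⟶ P),
    Function.Injective f.lin → ∀ α : F.obj K ⟶ G.obj Y, ∃ α' : F.obj P ⟶ G.obj Y, F.map f ≫ α' = α

lemma counitL_lcoact (N : HopfBimod k A) (n : N) : counitL N (N.lcoact n) = n :=
  congr($(N.lcoact_counit) n)

lemma counitL_lTensor {M N : HopfBimod k A} (f : M →ₗ[k] N) (x : A ⊗[k] M) :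
    counitL N (f.lTensor A x) = f (counitL M x) := by
  induction x with
  | zero => simp
  | add x x' hx hx' => simp only [map_add, hx, hx']
  | tmul a m => simp

-- The section m ↦ 1 ⊗ m and the retraction ε ⊗ id are natural but only linear, which is all that
-- exactness of the bar and cobar complexes requires.
variable (k A) in
lemma isAdmissible_act : IsAdmissible (actL k A) (coactL k A) where
  isSES h := h.indL
  section' := ⟨fun M => show M →ₗ[k] A ⊗[k] M from TensorProduct.mk k A M 1,
    fun M m => congr($(map_one M.lact) m), fun _ _ => rfl⟩
  retraction := ⟨fun N => show A ⊗[k] N →ₗ[k] N from counitL N, fun N n => counitL_lcoact N n,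
    fun f x => counitL_lTensor f.lin x⟩
  extension _ f hf α := exists_extension_indL f hf α

/-- The linear map `y ⊗ a ↦ ε(a) y`. -/
def counitR (Y : HopfBimod k A) : Y ⊗[k] A →ₗ[k] Y :=
  (TensorProduct.rid k Y).toLinearMap ∘ₗ counit.lTensor Y

@[simp] lemma counitR_tmul {Y : HopfBimod k A} (a : A) (y : Y) :
    counitR Y (y ⊗ₜ a) = counit (R := k) a • y := rfl

lemma counitR_rcoact (N : HopfBimod k A) (n : N) : counitR N (N.rcoact n) = n :=
  congr($(N.rcoact_counit) n)

lemma counitR_rTensor {M N : HopfBimod k A} (f : M →ₗ[k] N) (x : M ⊗[k] A) :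
    counitR N (f.rTensor A x) = f (counitR M x) := by
  induction x with
  | zero => simp
  | add x x' hx hx' => simp only [map_add, hx, hx']
  | tmul a m => simp

/-- Regrouping (A ⊗ K) ⊗ A as A ⊗ (K ⊗ A), and likewise on the coinduced side, reduces the two-sided
problem to the one-sided one for the injection K ⊗ A → P ⊗ A and the bimodule Y ⊗ A. -/
lemma exists_extension_indLR {K P : HopfBimod k A} (Y : HopfBimod k A) (f : K ⟶ P)
    (hf : Function.Injective f.lin) (α : (indLR k A).obj K ⟶ (coindLR k A).obj Y) :
    ∃ α' : (indLR k A).obj P ⟶ (coindLR k A).obj Y, (indLR k A).map f ≫ α' = α := by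
  let a (M : HopfBimod k A) : (indLR k A).obj M ≅ (indL k A).obj ((indR k A).obj M) :=
    hTensorAssoc (regular k A) M (regular k A)
  let c : (coindLR k A).obj Y ≅ (coindL k A).obj ((coindR k A).obj Y) :=
    cTensorAssoc (regular k A) Y (regular k A)
  have ha : (indLR k A).map f ≫ (a P).hom = (a K).hom ≫ (indL k A).map ((indR k A).map f) :=
    hom_ext <| TensorProduct.ext_threefold fun _ _ _ => rfl
  obtain ⟨β, hβ⟩ := exists_extension_indL ((indR k A).map f)
    (rTensor_injective A hf) ((a K).inv ≫ α ≫ c.hom)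
  refine ⟨(a P).hom ≫ β ≫ c.inv, ?_⟩
  rw [← Category.assoc, ha, Category.assoc, ← Category.assoc ((indL k A).map _), hβ]
  simp

variable (k A) in
lemma isAdmissible_actLR : IsAdmissible (actLR k A) (coactLR k A) where
  isSES h := h.indL.indR
  section' := ⟨fun M => show M →ₗ[k] (A ⊗[k] M) ⊗[k] A from
      (TensorProduct.mk k (A ⊗[k] M) A).flip 1 ∘ₗ TensorProduct.mk k A M 1,
    fun M m => congr($(map_one M.lact) ($(map_one M.ract) m)), fun _ _ => rfl⟩
  retraction := ⟨fun N => show (A ⊗[k] N) ⊗[k] A →ₗ[k] N from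
      counitL N ∘ₗ counitR ((coindL k A).obj N),
    fun N n => congr(counitL N $(counitR_rcoact ((coindL k A).obj N) (N.lcoact n))).trans
      (counitL_lcoact N n),
    fun {_ N} f x => congr(counitL N $(counitR_rTensor (k := k) (A := A) ((coindL k A).map f).lin x)).trans
      (counitL_lTensor f.lin _)⟩
  extension := exists_extension_indLR

end HopfBimod

end GS

/-! ### Bar complexes and the double complex of morphisms -/

namespace GS

namespace HopfBimod

variable {k A : Type u} [Field k] [Ring A] [HopfAlgebra k A]

section Bar

variable {F G : HopfBimod k A ⥤ HopfBimod k A} (ε : F ⟶ 𝟭 _) (η : 𝟭 _ ⟶ G)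

/-- The morphism of augmented bar complexes induced by a morphism. -/
def barMap (F : HopfBimod k A ⥤ HopfBimod k A) {M M' : HopfBimod k A} (f : M ⟶ M') :
    ∀ n, barX F M n ⟶ barX F M' n
  | 0 => f
  | n + 1 => F.map (barMap F f n)

variable {ε} in
lemma map_barSucc {X X' : HopfBimod k A} (u : X ⟶ X') {d : F.obj X ⟶ X} {d' : F.obj X' ⟶ X'}
    (h : F.map u ≫ d' = d ≫ u) : F.map (F.map u) ≫ barSucc ε d' = barSucc ε d ≫ F.map u := by
  rw [barSucc, barSucc, Preadditive.comp_sub, Preadditive.sub_comp, counitApp_natural,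
    ← F.map_comp, ← F.map_comp, h]

lemma barMap_barD {M M' : HopfBimod k A} (f : M ⟶ M') :
    ∀ n, barMap F f (n + 1) ≫ barD ε M' n = barD ε M n ≫ barMap F f n
  | 0 => counitApp_natural ε f
  | n + 1 => map_barSucc (barMap F f n) (barMap_barD f n)

/-- The homotopy contracting the augmented bar complex attached to a section of the augmentation. -/
def barHomotopy (F : HopfBimod k A ⥤ HopfBimod k A) {P : HopfBimod k A} (σ : P ⟶ F.obj P) :
    ∀ n, barX F P n ⟶ barX F P (n + 1)
  | 0 => σ
  | n + 1 => -F.map (barHomotopy F σ n)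

-- The inductive step for the homotopy. The sign in -F(h) matches the one in ∂ₙ₊₁ = ε - F(∂ₙ):
-- applying F to the identity of the previous degree produces the identity and a term F(∂) F(h) that
-- cancels, and naturality of ε cancels the remaining two terms.
variable {ε} in
lemma barSucc_homotopy [F.Additive] {X : HopfBimod k A} {d : F.obj X ⟶ X} {h : X ⟶ F.obj X}
    (ih : (-F.map h) ≫ barSucc ε d + d ≫ h = 𝟙 _) :
    (-F.map (-F.map h)) ≫ barSucc ε (barSucc ε d) + barSucc ε d ≫ (-F.map h) = 𝟙 _ := by
  have h1 : F.map (-F.map h) ≫ F.map (barSucc ε d) = 𝟙 _ - F.map d ≫ F.map h := by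
    rw [← F.map_comp, ← F.map_comp, eq_sub_of_add_eq ih, F.map_sub, F.map_id]
  have h2 : barSucc ε (barSucc ε d) = counitApp ε _ - F.map (barSucc ε d) := rfl
  have h3 : barSucc ε d ≫ (-F.map h) = -(counitApp ε _ ≫ F.map h) + F.map d ≫ F.map h := by
    rw [barSucc, Preadditive.comp_neg, Preadditive.sub_comp]
    abel
  rw [h2, h3, Preadditive.comp_sub, Preadditive.neg_comp, Preadditive.neg_comp, h1,
    counitApp_natural, Preadditive.comp_neg]
  abel

lemma barHomotopy_barD [F.Additive] {P : HopfBimod k A} (σ : P ⟶ F.obj P)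
    (hσ : σ ≫ counitApp ε P = 𝟙 P) :
    ∀ n, barHomotopy F σ (n + 1) ≫ barD ε P (n + 1) + barD ε P n ≫ barHomotopy F σ n = 𝟙 _
  | 0 => by
    change (-F.map σ) ≫ barSucc ε (counitApp ε P) + counitApp ε P ≫ σ = 𝟙 (F.obj P)
    rw [barSucc, Preadditive.comp_sub, Preadditive.neg_comp, Preadditive.neg_comp, ← F.map_comp, hσ,
      F.map_id, counitApp_natural]
    abel
  | n + 1 => barSucc_homotopy (barHomotopy_barD σ hσ n)

/-- The double complex of spaces of morphisms from the bar to the cobar complex. -/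
def homDC [F.Additive] [G.Additive] (M N : HopfBimod k A) : DoubleCx k where
  X q p := barX F M (q + 1) ⟶ cobarX G N (p + 1)
  dh q p := CategoryTheory.Linear.leftComp k _ (barD ε M (q + 1))
  dv q p := CategoryTheory.Linear.rightComp k _ (cobarD η N (p + 1))
  dh_dh q p x := by
    change barD ε M (q + 2) ≫ barD ε M (q + 1) ≫ x = 0
    rw [← Category.assoc, barD_comp, Limits.zero_comp]
  dv_dv q p x := by
    change (x ≫ cobarD η N (p + 1)) ≫ cobarD η N (p + 2) = 0
    rw [Category.assoc, cobarD_comp, Limits.comp_zero]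
  dh_dv q p x := by
    change barD ε M (q + 1) ≫ x ≫ cobarD η N (p + 1) = (barD ε M (q + 1) ≫ x) ≫ cobarD η N (p + 1)
    rw [Category.assoc]

/-- The total complex of `homDoubleComplex`, in terms of cochains. -/
def homTotalIso [F.Additive] [G.Additive] (M N : HopfBimod k A) :
    (homDoubleComplex k ε η M N).total (ComplexShape.up ℕ) ≅ (homDC ε η M N).tot :=
  DoubleCx.totalIso _ _ (fun _ _ => Iso.refl _)
    (fun q p => by
      have h : (homDoubleComplex k ε η M N).d q (q + 1) = homCobarMap k η N (barD ε M (q + 1)) :=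
        CochainComplex.of_d (fun q => homCobar k η N (barX F M (q + 1)))
          (fun q => homCobarMap k η N (barD ε M (q + 1))) q
      rw [h]
      rfl)
    (fun q p => CochainComplex.of_d (fun p => ModuleCat.of k (barX F M (q + 1) ⟶ cobarX G N (p + 1)))
        (fun p => postComp k _ (cobarD η N (p + 1))) p)

/-- The morphism of double complexes induced by a morphism in the first variable. -/
def homDCMap [F.Additive] [G.Additive] {M M' : HopfBimod k A} (f : M ⟶ M') (N : HopfBimod k A) :
    DoubleCx.Hom (homDC ε η M' N) (homDC ε η M N) where
  f q p := CategoryTheory.Linear.leftComp k _ (barMap F f (q + 1))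
  comm_h q p (x : barX F M' (q + 1) ⟶ cobarX G N (p + 1)) := by
    change barMap F f (q + 2) ≫ barD ε M' (q + 1) ≫ x = barD ε M (q + 1) ≫ barMap F f (q + 1) ≫ x
    rw [← Category.assoc, barMap_barD, Category.assoc]
  comm_v q p (x : barX F M' (q + 1) ⟶ cobarX G N (p + 1)) := by
    change barMap F f (q + 1) ≫ x ≫ cobarD η N (p + 1) = (barMap F f (q + 1) ≫ x) ≫ cobarD η N (p + 1)
    rw [Category.assoc]

variable {ε η}

lemma IsAdmissible.isSES_barMap (h : IsAdmissible ε η) {K P M : HopfBimod k A} {f : K ⟶ P}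
    {g : P ⟶ M} (hfg : IsSES f g) : ∀ n, IsSES (barMap F f n) (barMap F g n)
  | 0 => hfg
  | n + 1 => h.isSES (h.isSES_barMap hfg n)

/-- Left exactness of Hom handles all but surjectivity. There the source is F applied to the bar
term one step lower and the target is G applied to a cobar term, because q, p ≥ 0 keeps the
unaugmented terms only; this is the situation of the extension property. -/
lemma IsAdmissible.isShortExact [F.Additive] [G.Additive] (h : IsAdmissible ε η)
    {K P M : HopfBimod k A} {f : K ⟶ P} {g : P ⟶ M} (hfg : IsSES f g) (N : HopfBimod k A) :
    DoubleCx.IsShortExact (homDCMap ε η g N) (homDCMap ε η f N) where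
  injective q p x y hxy := by
    have hs := (h.isSES_barMap hfg (q + 1)).surjective
    refine hom_ext (LinearMap.ext fun m => ?_)
    obtain ⟨m, rfl⟩ := hs m
    exact congr(Hom.lin $hxy m)
  exact q p x := by
    have hs := h.isSES_barMap hfg (q + 1)
    constructor
    · intro hx
      exact exists_desc (fun x hx => (hs.exact x).1 hx) hs.surjective x hx
    · rintro ⟨y, rfl⟩
      change barX F M (q + 1) ⟶ cobarX G N (p + 1) at y
      change barMap F f (q + 1) ≫ barMap F g (q + 1) ≫ y = 0
      rw [← Category.assoc, hs.comp_eq_zero, Limits.zero_comp]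
  surjective q p x := h.extension _ _ (h.isSES_barMap hfg q).injective x

lemma IsAdmissible.counitApp_surjective (h : IsAdmissible ε η) (M : HopfBimod k A) :
    Function.Surjective (counitApp ε M).lin := by
  obtain ⟨s, hs, -⟩ := h.section'
  exact fun m => ⟨s M m, hs M m⟩

lemma IsAdmissible.unitApp_injective (h : IsAdmissible ε η) (N : HopfBimod k A) :
    Function.Injective (unitApp η N).lin := by
  obtain ⟨θ, hθ, -⟩ := h.retraction
  exact Function.LeftInverse.injective (hθ N)

/-- The natural section s gives the preimage: ε(s(x)) = x, while F(ε)(s(x)) = s(ε(x)) = 0. -/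
lemma IsAdmissible.bar_exact_zero [F.Additive] (h : IsAdmissible ε η) (M : HopfBimod k A) (x : F.obj M)
    (hx : (barD ε M 0).lin x = 0) : ∃ y, (barD ε M 1).lin y = x := by
  obtain ⟨s, hs, hs'⟩ := h.section'
  refine ⟨s _ x, ?_⟩
  change (counitApp ε (F.obj M) - F.map (counitApp ε M)).lin (s _ x) = x
  have h1 : (F.map (counitApp ε M)).lin (s (F.obj M) x) = 0 := by
    rw [← hs']
    exact congr(s M $hx).trans (map_zero _)
  rw [sub_lin, LinearMap.sub_apply, hs, h1, sub_zero]

/-- A cocycle x satisfies η(x) = G(d)(x). Applying the retraction θ, which undoes η and is natural,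
gives x = d(θ(x)). -/
lemma IsAdmissible.cobar_exact [G.Additive] (h : IsAdmissible ε η) (N : HopfBimod k A) (n : ℕ)
    (x : (cobarX G N (n + 1)).carrier) (hx : (cobarD η N (n + 1)).lin x = 0) :
    ∃ y, (cobarD η N n).lin y = x := by
  obtain ⟨θ, hθ, hθ'⟩ := h.retraction
  have key : ∀ {X : HopfBimod k A} (d : X ⟶ G.obj X) (x : G.obj X),
      (cobarSucc η d).lin x = 0 → d.lin (θ X x) = x := fun {X} d x hx => by
    rw [cobarSucc, sub_lin, LinearMap.sub_apply, sub_eq_zero] at hx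
    rw [← hθ', ← hx, hθ]
  exact ⟨θ _ x, key _ x hx⟩

variable [F.Additive] [G.Additive]

variable (ε η) in
/-- The augmentation of the double complex of morphisms. -/
def homAug (M N : HopfBimod k A) : (M ⟶ N) →ₗ[k] (homDC ε η M N).X 0 0 :=
  CategoryTheory.Linear.leftComp k _ (counitApp ε M) ∘ₗ
    CategoryTheory.Linear.rightComp k _ (unitApp η N)

lemma homAug_cocycle (M N : HopfBimod k A) (x : M ⟶ N) :
    (homDC ε η M N).dh 0 0 (homAug ε η M N x) = 0 ∧
      (homDC ε η M N).dv 0 0 (homAug ε η M N x) = 0 := by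
  constructor
  · let y : barX F M 0 ⟶ N := x
    change barD ε M 1 ≫ barD ε M 0 ≫ y ≫ unitApp η N = 0
    rw [← Category.assoc, barD_comp, Limits.zero_comp]
  · let y : M ⟶ cobarX G N 0 := x
    change (counitApp ε M ≫ y ≫ cobarD η N 0) ≫ cobarD η N 1 = 0
    rw [Category.assoc, Category.assoc, cobarD_comp, Limits.comp_zero, Limits.comp_zero]

lemma IsAdmissible.homAug_injective (h : IsAdmissible ε η) (M N : HopfBimod k A) :
    Function.Injective (homAug ε η M N) := fun x y hxy => by
  refine hom_ext (LinearMap.ext fun m => h.unitApp_injective N ?_)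
  obtain ⟨m, rfl⟩ := h.counitApp_surjective M m
  exact congr(Hom.lin $hxy m)

/-- A map z : B_0 → C^0 killed by ∂₁ descends along the augmentation B_0 → M; the resulting map M →
C^0 is killed by ∂⁰, and so lifts through N → C^0. -/
lemma IsAdmissible.exists_homAug_eq (h : IsAdmissible ε η) (M N : HopfBimod k A)
    (z : (homDC ε η M N).X 0 0) (hz : (homDC ε η M N).dh 0 0 z = 0)
    (hz' : (homDC ε η M N).dv 0 0 z = 0) : ∃ x, homAug ε η M N x = z := by
  obtain ⟨y, hy⟩ := exists_desc (f := barD ε M 1) (g := barD ε M 0) (h.bar_exact_zero M)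
    (h.counitApp_surjective M) z hz
  have hy' : y ≫ cobarD η N 1 = 0 := by
    refine hom_ext (LinearMap.ext fun m => ?_)
    obtain ⟨m, rfl⟩ := h.counitApp_surjective M m
    have h1 : (barD ε M 0 ≫ y) ≫ cobarD η N 1 = 0 := by rw [hy]; exact hz'
    exact congr(Hom.lin $h1 m)
  obtain ⟨x, hx⟩ := exists_lift (f := cobarD η N 0) (g := cobarD η N 1) (h.cobar_exact N 0)
    (h.unitApp_injective N) y hy'
  refine ⟨x, ?_⟩
  change barD ε M 0 ≫ x ≫ cobarD η N 0 = z
  rw [hx, hy]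

/-! ### Vanishing for projective X-modules -/

section Projective

variable [FiniteDimensional k A]

/-- The lift exists among X-modules, and fullness and faithfulness of `toXFunctor` bring it back. -/
lemma exists_lift_of_projective {P X Y Z : HopfBimod k A} (hP : Projective P.toX) {d : X ⟶ Y}
    {e : Y ⟶ Z} (hde : Function.Exact d.lin e.lin) (φ : P ⟶ Y) (hφ : φ ≫ e = 0) :
    ∃ ψ : P ⟶ X, ψ ≫ d = φ := by
  have hde' : d ≫ e = 0 := hom_ext hde.linearMap_comp_eq_zero
  have : Projective (toXFunctor.obj P) := hP
  let S : ShortComplex (ModuleCat.{u} (XAlg k A)) :=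
    ShortComplex.mk (toXFunctor.map d) (toXFunctor.map e) (by
      rw [← Functor.map_comp, hde', Functor.map_zero])
  have hS : S.Exact := by
    rw [ShortComplex.moduleCat_exact_iff]
    exact fun y hy => (hde y).1 hy
  have h1 : toXFunctor.map φ ≫ S.g = 0 := by
    change toXFunctor.map φ ≫ toXFunctor.map e = 0
    rw [← Functor.map_comp, hφ, Functor.map_zero]
  obtain ⟨ψ, hψ⟩ := toXFunctor.map_surjective (hS.liftFromProjective (toXFunctor.map φ) h1)
  refine ⟨ψ, toXFunctor.map_injective ?_⟩
  rw [Functor.map_comp, hψ]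
  exact hS.liftFromProjective_comp _ _

lemma IsAdmissible.isZero_of_projective (h : IsAdmissible ε η) {P : HopfBimod k A}
    (hP : Projective P.toX) (N : HopfBimod k A) (n : ℕ) :
    Limits.IsZero ((homDC ε η P N).tot.homology (n + 1)) := by
  -- With e = 0 exactness means surjectivity of the augmentation F P → P, and lifting the identity
  -- produces a section that is a morphism of Hopf bimodules. It contracts the augmented bar complex
  -- inside the category, hence makes every row exact in positive degrees.
  obtain ⟨σ, hσ⟩ := exists_lift_of_projective hP (d := counitApp ε P) (e := (0 : P ⟶ P))
    (fun y => ⟨fun _ => h.counitApp_surjective P y, fun _ => rfl⟩) (𝟙 P) Limits.comp_zero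
  have hb := barHomotopy_barD ε σ hσ
  refine DoubleCx.tot_homology_isZero _ n (DoubleCx.exists_totD_eq ?_ ?_ n)
  · intro q p (z : barX F P (q + 2) ⟶ cobarX G N (p + 1)) hz
    refine ⟨barHomotopy F σ (q + 1) ≫ z, ?_⟩
    change barD ε P (q + 1) ≫ barHomotopy F σ (q + 1) ≫ z = z
    have hz' : barD ε P (q + 2) ≫ z = 0 := hz
    rw [← Category.assoc, eq_sub_of_add_eq' (hb (q + 1)), Preadditive.sub_comp, Category.assoc, hz',
      Limits.comp_zero, sub_zero, Category.id_comp]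
  · intro p (z : barX F P 1 ⟶ cobarX G N (p + 2)) hz hz'
    have h1 : barD ε P 1 ≫ z = 0 := hz
    have h2 : z ≫ cobarD η N (p + 2) = 0 := hz'
    -- The kernels of the first row differentials form the complex Hom(P, C^•): such a z factors
    -- through the augmentation as ε followed by σ ≫ z.
    have h3 : barD ε P 0 ≫ barHomotopy F σ 0 ≫ z = z := by
      rw [← Category.assoc, eq_sub_of_add_eq' (hb 0), Preadditive.sub_comp, Category.assoc, h1,
        Limits.comp_zero, sub_zero, Category.id_comp]
    have h5 : (barHomotopy F σ 0 ≫ z) ≫ cobarD η N (p + 2) = 0 := by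
      rw [Category.assoc, h2, Limits.comp_zero]
    -- Exactness of the cobar resolution and projectivity of P lift the cocycle P → C^{p+1} to a map
    -- P → C^p.
    obtain ⟨w, hw⟩ : ∃ w : barX F P 0 ⟶ _, w ≫ _ = barHomotopy F σ 0 ≫ z :=
      exists_lift_of_projective hP (d := cobarD η N (p + 1)) (e := cobarD η N (p + 2))
        (fun y => ⟨h.cobar_exact N (p + 1) y, fun ⟨x, hx⟩ => hx ▸
          congr(Hom.lin $(cobarD_comp η N (p + 1)) x)⟩) (barHomotopy F σ 0 ≫ z) h5
    refine ⟨barD ε P 0 ≫ w, ?_, ?_⟩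
    · change barD ε P 1 ≫ barD ε P 0 ≫ w = 0
      rw [← Category.assoc, barD_comp, Limits.zero_comp]
    · change (barD ε P 0 ≫ w) ≫ cobarD η N (p + 1) = z
      rw [Category.assoc, hw, h3]

end Projective

end Bar

end HopfBimod

end GS

/-! ### Dimension shifting for Ext and conclusion -/

namespace GS

section ExtShift

open Abelian

variable {k : Type u} [Field k] {C : Type (u + 1)} [Category.{u} C] [Abelian C]
  [CategoryTheory.Linear k C] [HasExt.{u} C]

variable (k) in
/-- The map on `Ext` induced by a morphism in the first variable. -/
def extPrecomp {X Y : C} (f : X ⟶ Y) (Z : C) (n : ℕ) : Ext.{u} Y Z n →ₗ[k] Ext.{u} X Z n :=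
  Ext.bilinearCompOfLinear k X Y Z 0 n n (zero_add n) (Ext.mk₀ f)

variable (k) in
/-- Dimension shifting for `Ext` along a short exact sequence. -/
def extShift {S : ShortComplex C} (hS : S.ShortExact) (Z : C) (n : ℕ)
    (h0 : ∀ x : Ext.{u} S.X₂ Z (n + 1), x = 0) :
    (Ext.{u} S.X₁ Z n ⧸ LinearMap.range (extPrecomp k S.f Z n)) ≃ₗ[k] Ext.{u} S.X₃ Z (n + 1) :=
  let δ : Ext.{u} S.X₁ Z n →ₗ[k] Ext.{u} S.X₃ Z (n + 1) :=
    Ext.bilinearCompOfLinear k _ _ Z 1 n (n + 1) (add_comm 1 n) hS.extClass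
  (Submodule.quotEquivOfEq _ (LinearMap.ker δ) (by
    ext x
    constructor
    · rintro ⟨y, rfl⟩
      change hS.extClass.comp ((Ext.mk₀ S.f).comp y (zero_add n)) (add_comm 1 n) = 0
      exact hS.extClass_comp_assoc _
    · intro hx
      obtain ⟨y, hy⟩ := Ext.contravariant_sequence_exact₁ hS Z x (add_comm 1 n) hx
      exact ⟨y, hy⟩)).trans
  (δ.quotKerEquivOfSurjective fun x => by
    obtain ⟨y, hy⟩ := Ext.contravariant_sequence_exact₃ hS Z x (h0 _) (add_comm 1 n)
    exact ⟨y, hy⟩)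

end ExtShift

namespace HopfBimod

variable {k A : Type u} [Field k] [Ring A] [HopfAlgebra k A] [FiniteDimensional k A]

lemma IsSES.shortExact {K P M : HopfBimod k A} {f : K ⟶ P} {g : P ⟶ M} (h : IsSES f g) :
    (ShortComplex.mk (toXFunctor.map f) (toXFunctor.map g) (by
      rw [← Functor.map_comp, h.comp_eq_zero, Functor.map_zero])).ShortExact :=
  ModuleCat.shortComplex_shortExact _ h.exact h.injective h.surjective

/-- X-modules have enough projectives; a projective cover of M as a mere surjection, together with
its kernel, is carried to Hopf bimodules by `ofX`. -/
lemma exists_isSES (M : HopfBimod k A) : ∃ (K P : HopfBimod k A) (f : K ⟶ P) (g : P ⟶ M),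
    IsSES f g ∧ Projective P.toX := by
  let Q : ModuleCat.{u} (XAlg k A) := Projective.over M.toX
  let π : Q →ₗ[XAlg k A] M.toX := (Projective.π M.toX).hom
  have hπ : Function.Surjective π := (ModuleCat.epi_iff_surjective _).1 inferInstance
  let L : ModuleCat.{u} (XAlg k A) := ModuleCat.of _ (LinearMap.ker π)
  let ι : L →ₗ[XAlg k A] Q := (LinearMap.ker π).subtype
  refine ⟨ofX L, ofX Q, ofToX ((toXOfXEquiv Q).symm.toLinearMap ∘ₗ ι ∘ₗ (toXOfXEquiv L).toLinearMap),
    ofToX (π ∘ₗ (toXOfXEquiv Q).toLinearMap), ⟨?_, ?_, ?_⟩, ?_⟩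
  · exact Subtype.val_injective (p := fun x => x ∈ LinearMap.ker π)
  · intro x
    exact ⟨fun hx => ⟨⟨x, hx⟩, rfl⟩, fun ⟨y, hy⟩ => hy ▸ y.2⟩
  · exact hπ
  · exact Projective.of_iso (toXOfX Q).symm inferInstance

variable (k) in
/-- Morphisms of Hopf bimodules are the elements of `Ext⁰`. -/
def homEquivExt (M N : HopfBimod k A) : (M ⟶ N) ≃ₗ[k] Abelian.Ext.{u} M.toX N.toX 0 :=
  (LinearEquiv.ofBijective (toXFunctor.mapLinearMap k (X := M) (Y := N))
    ⟨toXFunctor.map_injective, toXFunctor.map_surjective⟩).trans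
      (Abelian.Ext.linearEquiv₀ (R := k) (X := M.toX) (Y := N.toX)).symm

lemma homEquivExt_apply {M N : HopfBimod k A} (x : M ⟶ N) :
    homEquivExt k M N x = Abelian.Ext.mk₀ (toXFunctor.map x) := rfl

variable {F G : HopfBimod k A ⥤ HopfBimod k A} {ε : F ⟶ 𝟭 _} {η : 𝟭 _ ⟶ G} [F.Additive] [G.Additive]

/-- The cohomology of the double complex of morphisms in degree `0`. -/
def IsAdmissible.zeroEquiv (h : IsAdmissible ε η) (M N : HopfBimod k A) :
    (M ⟶ N) ≃ₗ[k] (homDC ε η M N).tot.homology 0 :=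
  LinearEquiv.ofBijective (DoubleCx.augHomology (homAug ε η M N) (homAug_cocycle M N)).hom
    (DoubleCx.augHomology_bijective _ _ (h.homAug_injective M N) (h.exists_homAug_eq M N))

/-- Naturality in degree 0 is what identifies the two cokernels in the passage from degree 0 to
degree 1; in higher degrees none is needed. -/
lemma IsAdmissible.zeroEquiv_naturality (h : IsAdmissible ε η) {M M' : HopfBimod k A} (f : M ⟶ M')
    (N : HopfBimod k A) (x : M' ⟶ N) :
    (HomologicalComplex.homologyMap (homDCMap ε η f N).tot 0).hom (h.zeroEquiv M' N x) =
      h.zeroEquiv M N (f ≫ x) :=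
  congr(($(DoubleCx.augHomology_naturality (homDCMap ε η f N) (homAug ε η M' N)
    (homAug_cocycle M' N) (homAug ε η M N) (homAug_cocycle M N)
    (CategoryTheory.Linear.leftComp k N f) fun v => by
      change barMap F f 1 ≫ counitApp ε M' ≫ v ≫ unitApp η N = counitApp ε M ≫ (f ≫ v) ≫ unitApp η N
      have h1 : F.map f ≫ counitApp ε M' = counitApp ε M ≫ f := counitApp_natural ε f
      change F.map f ≫ counitApp ε M' ≫ v ≫ unitApp η N = _
      rw [← Category.assoc, h1, Category.assoc, Category.assoc])).hom x)

/-- Dimension shifting along 0 → K → P → M → 0 with P projective. The induction hypothesis is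
applied to K, so M must remain quantified. -/
theorem IsAdmissible.nonempty_homology_equiv_ext (h : IsAdmissible ε η) (N : HopfBimod k A) (n : ℕ) :
    ∀ M : HopfBimod k A,
      Nonempty ((homDC ε η M N).tot.homology n ≃ₗ[k] Abelian.Ext.{u} M.toX N.toX n) := by
  induction n with
  | zero => exact fun M => ⟨(h.zeroEquiv M N).symm.trans (homEquivExt k M N)⟩
  | succ n ih =>
    intro M
    obtain ⟨K, P, f, g, hfg, hP⟩ := exists_isSES M
    have hP' : Projective (toXFunctor.obj P) := hP
    let e₁ := DoubleCx.homologyShift (h.isShortExact hfg N) n (h.isZero_of_projective hP N n)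
    let e₂ := extShift k hfg.shortExact N.toX n fun x => x.eq_zero_of_projective
    suffices Nonempty (((homDC ε η K N).tot.homology n ⧸ LinearMap.range
        (HomologicalComplex.homologyMap (homDCMap ε η f N).tot n).hom) ≃ₗ[k]
        (Abelian.Ext.{u} K.toX N.toX n ⧸
          LinearMap.range (extPrecomp k (toXFunctor.map f) N.toX n))) by
      obtain ⟨e⟩ := this
      exact ⟨(e₁.symm.trans e).trans e₂⟩
    rcases n with _ | n
    -- From degree 0 to degree 1: under the identification of both groups with Hom(K, N), both
    -- images consist of the maps f ≫ y with y : P → N.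
    · refine ⟨Submodule.Quotient.equiv _ _ ((h.zeroEquiv K N).symm.trans (homEquivExt k K N)) ?_⟩
      ext x
      constructor
      · rintro ⟨_, ⟨y, rfl⟩, rfl⟩
        obtain ⟨y, rfl⟩ := (h.zeroEquiv P N).surjective y
        refine ⟨homEquivExt k P N y, ?_⟩
        rw [h.zeroEquiv_naturality]
        change _ = homEquivExt k K N ((h.zeroEquiv K N).symm (h.zeroEquiv K N (f ≫ y)))
        rw [LinearEquiv.symm_apply_apply, homEquivExt_apply, homEquivExt_apply, Functor.map_comp]
        exact Abelian.Ext.mk₀_comp_mk₀ _ _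
      · rintro ⟨y, rfl⟩
        obtain ⟨y, rfl⟩ := (homEquivExt k P N).surjective y
        refine ⟨h.zeroEquiv K N (f ≫ y), ⟨h.zeroEquiv P N y, h.zeroEquiv_naturality f N y⟩, ?_⟩
        change homEquivExt k K N ((h.zeroEquiv K N).symm (h.zeroEquiv K N (f ≫ y))) = _
        rw [LinearEquiv.symm_apply_apply, homEquivExt_apply, homEquivExt_apply, Functor.map_comp]
        exact (Abelian.Ext.mk₀_comp_mk₀ _ _).symm
    · obtain ⟨e⟩ := ih K
      -- From a positive degree upward both groups at P vanish, so both quotients are by zero and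
      -- the isomorphism for K is enough.
      have h1 : Subsingleton ((homDC ε η P N).tot.homology (n + 1)) :=
        ModuleCat.subsingleton_of_isZero (h.isZero_of_projective hP N n)
      refine ⟨((Submodule.quotEquivOfEqBot _ ?_).trans e).trans (Submodule.quotEquivOfEqBot _ ?_).symm⟩
      · rw [LinearMap.range_eq_bot]
        ext x
        rw [Subsingleton.elim x 0, map_zero, map_zero]
      · refine LinearMap.range_eq_bot.2 (LinearMap.ext fun x => ?_)
        have hx : x = 0 := Abelian.Ext.eq_zero_of_projective (P := toXFunctor.obj P) x
        rw [hx, map_zero, map_zero]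

theorem IsAdmissible.nonempty_homTotalCohomology_equiv_ext (h : IsAdmissible ε η)
    (M N : HopfBimod k A) (n : ℕ) :
    Nonempty (homTotalCohomology k ε η M N n ≃ₗ[k] Abelian.Ext.{u} M.toX N.toX n) := by
  obtain ⟨e⟩ := h.nonempty_homology_equiv_ext N n M
  exact ⟨((HomologicalComplex.homologyFunctor _ _ n).mapIso
    (homTotalIso ε η M N)).toLinearEquiv.trans e⟩

end HopfBimod

end GS

end

theorem mainTheorem2 {k A : Type u} [Field k] [Ring A] [HopfAlgebra k A] [FiniteDimensional k A] :
    (∀ (M N : GS.HopfBimod k A) (n : ℕ),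
      Nonempty (GS.HGS M N n ≃ₗ[k] CategoryTheory.Abelian.Ext.{u} M.toX N.toX n)) ∧
    (∀ n : ℕ, Nonempty (GS.Hb k A n ≃ₗ[k] CategoryTheory.Abelian.Ext.{u}
      (GS.HopfBimod.regular k A).toX (GS.HopfBimod.regular k A).toX n)) :=
  ⟨(GS.HopfBimod.isAdmissible_actLR k A).nonempty_homTotalCohomology_equiv_ext,
    (GS.HopfBimod.isAdmissible_act k A).nonempty_homTotalCohomology_equiv_ext _ _⟩
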